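/- Let $k$ be a field. **Fans.** $\mathrm{Fan}^{\twoheadrightarrow}$ is the category whose objects are pairs $(M,\Sigma)$ of a lattice $M$ and a (finite, strongly convex, rational polyhedral) fan $\Sigma$ in $M_{\mathbb R}=M\otimes\mathbb R$; a morphism $(M,\Sigma)\to(M',\Sigma')$ is a cone $\sigma\in\Sigma$ together with an isomorphism $M/\mathrm{Span}(\sigma)\cong M'$ such that $\Sigma'=\Sigma/\sigma$ consists of the images of the cones of $\Sigma$ that contain $\sigma$. The functor $\mathbf T:(\mathrm{Fan}^{\twoheadrightarrow})^{op}\to\mathrm{Schemes}$ sends $(M,\Sigma)$ to its toric variety over $k$, glued from the $\mathrm{Spec}\,k[\sigma^\vee\cap M^\vee]$, and sends the morphism given by $\sigma$ to the closed embedding $\mathbf T(\Sigma/\sigma)\cong\overline{O(\sigma)}\subset\mathbf T(\Sigma)$ of the orbit closure. **Exit paths.** For a stratified space $\Phi$, $\mathrm{Exit}(\Phi)$ is its exit path category: the objects are the points, and the morphisms are generated by paths which for all positive times lie in the stratum of their end point, subject to the relations given by constant paths and by stratified triangles (the homotopy category of the simplicial set of exit paths). **Fanifolds.** A fanifold is a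 closed subset $\Phi$ of a smooth manifold $\mathcal M$, stratified by finitely many contractible smooth submanifolds, with a functor $\mathrm{Exit}(\Phi)\to\mathrm{Fan}^{\twoheadrightarrow}$, written $F\mapsto(M_F,\Sigma_F)$ on strata, and, for each stratum $F$, an isomorphism $\phi_F$ of the normal bundle $\mathrm T_F\mathcal M$ with the trivial bundle $M_F\otimes\mathbb R$, such that: * for each $F$ there is a tubular neighbourhood of $F$, that is, a diffeomorphism from an open neighbourhood of the zero section of $\mathrm T_F\mathcal M\cong F\times(M_F\otimes\mathbb R)$ onto an open subset of $\mathcal M$ which is the identity on $F$ and has normal derivative $\phi_F^{-1}$ along $F$, that carries the stratification of $F\times|\Sigma_F|$ by the cones of $\Sigma_F$ to the stratification induced by $\Phi$ near $F$; * an exit path that leaves $F$ through the part $F'$ of this neighbourhood corresponding to a cone $\sigma\in\Sigma_F$ is sent to a morphism of fans with cone $\sigma$, and the trivialization of the normal bundle of $F'$ extends over $F$ to $\phi_F$ followed by the quotient map $M_F\to M_F/\mathrm{Span}(\sigma)\cong M_{F'}$. **Proposition.** Let $\Phi$ be a fanifold such that $\mathrm{Exit}(\Phi)$ is equivalent to a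 poset. Then the colimit $$\mathbf T(\Phi):=\varinjlim_{\mathrm{Exit}(\Phi)^{op}}\mathbf T(F)$$ of the composite $\mathrm{Exit}(\Phi)^{op}\to(\mathrm{Fan}^{\twoheadrightarrow})^{op}\xrightarrow{\mathbf T}\mathrm{Schemes}$ exists in the category of schemes. Moreover it is an iterated pushout along closed immersions: there is an enumeration $F_0,\dots,F_{N-1}$ of the strata, in order of non-decreasing codimension, such that for all $i\le N$ the colimit $Z_i$ of $\mathbf T$ over the strata $F_0,\dots,F_{i-1}$ exists, and for all $i<N$ there is a pushout square of schemes $$Z_{i+1}=\varinjlim\bigl(Z_i\leftarrow\partial\mathbf T(F_i)\to\mathbf T(F_i)\bigr)$$ in which both maps out of $\partial\mathbf T(F_i)$ are closed immersions, the maps $Z_i\to Z_{i+1}\leftarrow \mathbf T(F_i)$ are the canonical ones, and $\partial\mathbf T(F_i)\subset\mathbf T(F_i)$ is the toric boundary: the reduced closed subscheme that is the union of the images of the $\mathbf T(F')$ for the exit paths from $F_i$ to strata $F'\neq F_i$. -/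

import Mathlib

open CategoryTheory CategoryTheory.Limits AlgebraicGeometry Opposite
open scoped TensorProduct Manifold ContDiff Topology

universe u v w

noncomputable section

/-! ### Fans and the category of fans and quotient maps -/

section Cones

variable {M : Type u} [AddCommGroup M]

/-- The pairing of a covector `m ∈ Hom(M, ℤ)` with a vector of `M_ℝ = ℝ ⊗ M`. -/
def realPairing (m : Module.Dual ℤ M) : (ℝ ⊗[ℤ] M) →ₗ[ℝ] ℝ :=
  Module.Dual.baseChange ℝ m

@[simp] lemma realPairing_tmul (m : Module.Dual ℤ M) (r : ℝ) (x : M) :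
    realPairing m (r ⊗ₜ x) = m x * r := by
  simp [realPairing]

lemma realPairing_add (m m' : Module.Dual ℤ M) (x : ℝ ⊗[ℤ] M) :
    realPairing (m + m') x = realPairing m x + realPairing m' x := by
  simp [realPairing]

lemma realPairing_zero (x : ℝ ⊗[ℤ] M) : realPairing (0 : Module.Dual ℤ M) x = 0 := by
  simp [realPairing]

lemma realPairing_comp {M' : Type u} [AddCommGroup M'] (m : Module.Dual ℤ M') (f : M →ₗ[ℤ] M')
    (x : ℝ ⊗[ℤ] M) : realPairing (m ∘ₗ f) x = realPairing m (f.baseChange ℝ x) := by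
  induction x with
  | zero => simp
  | tmul r x => simp
  | add x y hx hy => simp [hx, hy]

/-- The monoid `σ^∨ ∩ Hom(M, ℤ)` of integral covectors that are nonnegative on the cone `σ`. -/
def dualMonoid (σ : PointedCone ℝ (ℝ ⊗[ℤ] M)) : AddSubmonoid (Module.Dual ℤ M) where
  carrier := {m | ∀ x ∈ σ, 0 ≤ realPairing m x}
  add_mem' {a b} ha hb x hx := by
    rw [realPairing_add]; exact add_nonneg (ha x hx) (hb x hx)
  zero_mem' x _ := by rw [realPairing_zero]

/-- A rational polyhedral cone: the cone generated by finitely many lattice vectors. -/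
def IsRationalPolyhedral (σ : PointedCone ℝ (ℝ ⊗[ℤ] M)) : Prop :=
  ∃ S : Set M, S.Finite ∧ σ = PointedCone.hull ℝ ((fun m : M => (1 : ℝ) ⊗ₜ[ℤ] m) '' S)

/-- The integral covector `m`, nonnegative on `σ`, cuts out `τ = σ ∩ m^⊥`. -/
def CutsOut (m : Module.Dual ℤ M) (τ σ : PointedCone ℝ (ℝ ⊗[ℤ] M)) : Prop :=
  m ∈ dualMonoid σ ∧ ∀ x, x ∈ τ ↔ x ∈ σ ∧ realPairing m x = 0

/-- `τ` is a face of the rational polyhedral cone `σ`, that is, `τ = σ ∩ m^⊥` for some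
`m ∈ σ^∨ ∩ Hom(M, ℤ)`. -/
def IsRationalFace (τ σ : PointedCone ℝ (ℝ ⊗[ℤ] M)) : Prop :=
  ∃ m, CutsOut m τ σ

lemma dualMonoid_anti {τ σ : PointedCone ℝ (ℝ ⊗[ℤ] M)} (h : τ ≤ σ) :
    dualMonoid σ ≤ dualMonoid τ := fun _ hm x hx => hm x (h hx)

end Cones

/-- A fan: a lattice `M` with a finite set of rational polyhedral cones in `M_ℝ`, containing the
zero cone, closed under passage to faces, and such that any two cones meet in a common face.
(The cones are strongly convex, as `0` is a face of each of them.) -/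
structure ToricFan : Type (u + 1) where
  /-- the lattice -/
  lattice : Type u
  [addCommGroup : AddCommGroup lattice]
  [free : Module.Free ℤ lattice]
  [finite : Module.Finite ℤ lattice]
  /-- the cones of the fan -/
  cones : Set (PointedCone ℝ (ℝ ⊗[ℤ] lattice))
  finite_cones : cones.Finite
  rational : ∀ σ ∈ cones, IsRationalPolyhedral σ
  bot_mem : ⊥ ∈ cones
  face_mem : ∀ σ ∈ cones, ∀ τ, IsRationalFace τ σ → τ ∈ cones
  inter_face : ∀ σ ∈ cones, ∀ τ ∈ cones, IsRationalFace (σ ⊓ τ) σ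

namespace ToricFan

attribute [instance] ToricFan.addCommGroup ToricFan.free ToricFan.finite

/-- The real vector space `M_ℝ` in which the fan lives. -/
abbrev space (A : ToricFan.{u}) : Type u := ℝ ⊗[ℤ] A.lattice

/-- The poset of cones of a fan. -/
abbrev Cone (A : ToricFan.{u}) : Type u := {σ : PointedCone ℝ A.space // σ ∈ A.cones}

/-- The open stratum of `|Σ|` belonging to the cone `σ`: the points of `σ` lying in no smaller cone
of the fan, i.e. the relative interior of `σ`. -/
def openCone (A : ToricFan.{u}) (σ : PointedCone ℝ A.space) : Set A.space :=
  {x | x ∈ σ ∧ ∀ τ ∈ A.cones, τ < σ → x ∉ τ}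

lemma isRationalFace_of_le (A : ToricFan.{u}) {τ σ : PointedCone ℝ A.space} (hσ : σ ∈ A.cones)
    (hτ : τ ∈ A.cones) (h : τ ≤ σ) : IsRationalFace τ σ := by
  have := A.inter_face σ hσ τ hτ
  rwa [inf_eq_right.mpr h] at this

/-- A morphism `(M, Σ) ⟶ (M', Σ')`: a cone `σ ∈ Σ` and an isomorphism `M / Span σ ≅ M'`, given as
a surjection `M → M'` with kernel `M ∩ Span σ`, such that `Σ'` consists of the images of the cones
of `Σ` containing `σ`. -/
@[ext]
structure Hom (A B : ToricFan.{u}) : Type u where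
  /-- the cone `σ` -/
  cone : PointedCone ℝ A.space
  cone_mem : cone ∈ A.cones
  /-- the quotient map of lattices -/
  map : A.lattice →ₗ[ℤ] B.lattice
  surjective : Function.Surjective map
  ker : ∀ m, map m = 0 ↔ (1 : ℝ) ⊗ₜ[ℤ] m ∈ Submodule.span ℝ (cone : Set A.space)
  cones_eq : ∀ ρ, ρ ∈ B.cones ↔ ∃ τ ∈ A.cones, cone ≤ τ ∧ τ.map (map.baseChange ℝ) = ρ

namespace Hom

variable {A B C : ToricFan.{u}}

/-- The induced linear map `M_ℝ → M'_ℝ`. -/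
abbrev realMap (h : Hom A B) : A.space →ₗ[ℝ] B.space := h.map.baseChange ℝ

lemma realMap_eq_zero_iff (h : Hom A B) (x : A.space) :
    h.realMap x = 0 ↔ x ∈ Submodule.span ℝ (h.cone : Set A.space) := by
  constructor
  · intro hx
    have hex : Function.Exact (LinearMap.ker h.map).subtype h.map :=
      LinearMap.exact_subtype_ker_map h.map
    have := (lTensor_exact ℝ hex h.surjective x).mp (by simpa [LinearMap.baseChange_eq_ltensor] using hx)
    obtain ⟨y, rfl⟩ := this
    induction y with
    | zero => simp
    | tmul r m =>
      have h1 := (h.ker m.1).mp m.2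
      have h2 := Submodule.smul_mem _ r h1
      simpa [TensorProduct.smul_tmul'] using h2
    | add a b ha hb =>
      rw [map_add]
      refine add_mem (ha ?_) (hb ?_)
      all_goals
        simp only [LinearMap.baseChange_eq_ltensor]
        rw [← LinearMap.comp_apply, ← LinearMap.lTensor_comp]
        have : h.map ∘ₗ (LinearMap.ker h.map).subtype = 0 := by ext m; simp
        simp [this]
  · intro hx
    obtain ⟨S, -, hS⟩ := A.rational _ h.cone_mem
    have key : h.cone ≤ PointedCone.comap h.realMap ⊥ := by
      rw [hS]
      refine Submodule.span_le.mpr ?_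
      rintro _ ⟨m, hm, rfl⟩
      have h1 : (1 : ℝ) ⊗ₜ[ℤ] m ∈ (h.cone : Set A.space) := by
        rw [hS]; exact Submodule.subset_span ⟨m, hm, rfl⟩
      have := (h.ker m).mpr (Submodule.subset_span h1)
      simp [this]
    have : Submodule.span ℝ (h.cone : Set A.space) ≤ LinearMap.ker h.realMap := by
      refine Submodule.span_le.mpr fun y hy => ?_
      have := key hy
      simpa using this
    simpa using this hx

/-- If `f(τ) ⊆ f(τ')` for cones `τ, τ'` containing `σ`, then `τ ⊆ τ'`. -/
lemma le_of_map_le (h : Hom A B) {τ τ' : PointedCone ℝ A.space} (hτ : τ ∈ A.cones)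
    (hτ' : τ' ∈ A.cones) (hσ : h.cone ≤ τ) (hσ' : h.cone ≤ τ')
    (hle : τ.map h.realMap ≤ τ'.map h.realMap) : τ ≤ τ' := by
  intro x hx
  obtain ⟨y, hy, hxy⟩ := PointedCone.mem_map.mp (hle (PointedCone.mem_map.mpr ⟨x, hx, rfl⟩))
  have hker : x - y ∈ Submodule.span ℝ (h.cone : Set A.space) := by
    rw [← h.realMap_eq_zero_iff, map_sub, hxy, sub_self]
  obtain ⟨a, ha, b, hb, hab⟩ : ∃ a ∈ h.cone, ∃ b ∈ h.cone, x - y = b - a := by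
    have key : ∀ z ∈ Submodule.span ℝ (h.cone : Set A.space),
        ∃ a ∈ h.cone, ∃ b ∈ h.cone, z = b - a := by
      intro z hz
      induction hz using Submodule.span_induction with
      | mem z hz => exact ⟨0, zero_mem _, z, hz, by simp⟩
      | zero => exact ⟨0, zero_mem _, 0, zero_mem _, by simp⟩
      | add z z' _ _ hz hz' =>
        obtain ⟨a, ha, b, hb, rfl⟩ := hz
        obtain ⟨a', ha', b', hb', rfl⟩ := hz'
        exact ⟨a + a', add_mem ha ha', b + b', add_mem hb hb', by abel⟩
      | smul r z _ hz =>
        obtain ⟨a, ha, b, hb, rfl⟩ := hz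
        rcases le_total 0 r with hr | hr
        · exact ⟨r • a, PointedCone.smul_mem _ hr ha, r • b, PointedCone.smul_mem _ hr hb,
            by rw [smul_sub]⟩
        · exact ⟨(-r) • b, PointedCone.smul_mem _ (by linarith) hb, (-r) • a,
            PointedCone.smul_mem _ (by linarith) ha, by rw [smul_sub]; module⟩
    exact key _ hker
  have hsum : x + a = y + b := by
    have : x = y + (b - a) := by rw [← hab]; abel
    rw [this]; abel
  obtain ⟨m, hm, hm'⟩ := A.inter_face τ hτ τ' hτ'
  have h1 : x + a ∈ τ ⊓ τ' := ⟨add_mem hx (hσ ha), by rw [hsum]; exact add_mem hy (hσ' hb)⟩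
  have h2 := ((hm' _).mp h1).2
  rw [map_add] at h2
  have h3 := hm x hx
  have h4 := hm a (hσ ha)
  exact ((hm' x).mpr ⟨hx, by linarith⟩).2

lemma eq_of_map_eq (h : Hom A B) {τ τ' : PointedCone ℝ A.space} (hτ : τ ∈ A.cones)
    (hτ' : τ' ∈ A.cones) (hσ : h.cone ≤ τ) (hσ' : h.cone ≤ τ')
    (heq : τ.map h.realMap = τ'.map h.realMap) : τ = τ' :=
  le_antisymm (h.le_of_map_le hτ hτ' hσ hσ' heq.le) (h.le_of_map_le hτ' hτ hσ' hσ heq.ge)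

/-- The cone of `Σ` containing `σ` that corresponds to a given cone of `Σ' = Σ / σ`. -/
def lift (h : Hom A B) (ρ : B.Cone) : A.Cone :=
  ⟨((h.cones_eq ρ.1).mp ρ.2).choose, ((h.cones_eq ρ.1).mp ρ.2).choose_spec.1⟩

lemma cone_le_lift (h : Hom A B) (ρ : B.Cone) : h.cone ≤ (h.lift ρ).1 :=
  ((h.cones_eq ρ.1).mp ρ.2).choose_spec.2.1

lemma map_lift (h : Hom A B) (ρ : B.Cone) : (h.lift ρ).1.map h.realMap = ρ.1 :=
  ((h.cones_eq ρ.1).mp ρ.2).choose_spec.2.2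

lemma lift_mono (h : Hom A B) {ρ ρ' : B.Cone} (hle : ρ ≤ ρ') : h.lift ρ ≤ h.lift ρ' :=
  h.le_of_map_le (h.lift ρ).2 (h.lift ρ').2 (h.cone_le_lift ρ) (h.cone_le_lift ρ')
    (by rw [map_lift, map_lift]; exact hle)

lemma eq_lift (h : Hom A B) {τ : A.Cone} {ρ : B.Cone} (hσ : h.cone ≤ τ.1)
    (heq : τ.1.map h.realMap = ρ.1) : τ = h.lift ρ :=
  Subtype.ext (h.eq_of_map_eq τ.2 (h.lift ρ).2 hσ (h.cone_le_lift ρ) (by rw [map_lift, heq]))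

/-- The identity morphism, given by the zero cone. -/
def id (A : ToricFan.{u}) : Hom A A where
  cone := ⊥
  cone_mem := A.bot_mem
  map := LinearMap.id
  surjective := Function.surjective_id
  ker m := by
    have hb : ((⊥ : PointedCone ℝ A.space) : Set A.space) = {0} := rfl
    have hinj : (1 : ℝ) ⊗ₜ[ℤ] m = 0 → m = 0 := by
      intro h
      refine (Module.Free.chooseBasis ℤ A.lattice).ext_elem fun i => ?_
      have := congrArg (realPairing ((Module.Free.chooseBasis ℤ A.lattice).coord i)) h
      simpa using this
    rw [hb, Submodule.span_zero_singleton, Submodule.mem_bot]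
    refine ⟨fun h => ?_, fun h => ?_⟩
    · have : m = 0 := h
      simp [this]
    · exact hinj h
  cones_eq ρ := by
    refine ⟨fun h => ⟨ρ, h, bot_le, by simp [PointedCone.map_id]⟩, ?_⟩
    rintro ⟨τ, hτ, -, rfl⟩
    simpa [PointedCone.map_id] using hτ

lemma realMap_comp (g : Hom B C) (f : Hom A B) (x : A.space) :
    (g.map ∘ₗ f.map).baseChange ℝ x = g.realMap (f.realMap x) := by
  simp [LinearMap.baseChange_comp]

lemma map_comp_cone (g : Hom B C) (f : Hom A B) (τ : PointedCone ℝ A.space) :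
    τ.map ((g.map ∘ₗ f.map).baseChange ℝ) = (τ.map f.realMap).map g.realMap := by
  rw [PointedCone.map_map, LinearMap.baseChange_comp]

lemma image_span (f : Hom A B) (τ : PointedCone ℝ A.space) :
    (Submodule.span ℝ (τ : Set A.space)).map f.realMap =
      Submodule.span ℝ ((τ.map f.realMap : PointedCone ℝ B.space) : Set B.space) := by
  rw [Submodule.map_span, PointedCone.coe_map]

/-- Composition: the cone of the composite is the cone of `Σ` corresponding to the cone of `Σ'`. -/
def comp (f : Hom A B) (g : Hom B C) : Hom A C where
  cone := (f.lift ⟨g.cone, g.cone_mem⟩).1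
  cone_mem := (f.lift ⟨g.cone, g.cone_mem⟩).2
  map := g.map ∘ₗ f.map
  surjective := g.surjective.comp f.surjective
  ker m := by
    set τ := f.lift ⟨g.cone, g.cone_mem⟩
    have h0 : f.realMap ((1 : ℝ) ⊗ₜ[ℤ] m) = (1 : ℝ) ⊗ₜ[ℤ] f.map m := by simp
    have h1 := f.image_span τ.1
    rw [f.map_lift] at h1
    rw [LinearMap.comp_apply, g.ker, ← h1, ← h0, Submodule.mem_map]
    constructor
    · rintro ⟨y, hy, hxy⟩
      have h2 : (1 : ℝ) ⊗ₜ[ℤ] m - y ∈ Submodule.span ℝ (f.cone : Set A.space) := by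
        rw [← f.realMap_eq_zero_iff, map_sub, hxy, sub_self]
      have h3 := Submodule.span_mono (f.cone_le_lift ⟨g.cone, g.cone_mem⟩) h2
      simpa using add_mem h3 hy
    · exact fun h => ⟨_, h, rfl⟩
  cones_eq ρ := by
    rw [g.cones_eq]
    constructor
    · rintro ⟨τ, hτ, hle, rfl⟩
      refine ⟨_, (f.lift ⟨τ, hτ⟩).2, f.lift_mono (ρ := ⟨g.cone, g.cone_mem⟩) (ρ' := ⟨τ, hτ⟩) hle, ?_⟩
      rw [map_comp_cone, f.map_lift]
    · rintro ⟨τ, hτ, hle, rfl⟩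
      refine ⟨τ.map f.realMap, (f.cones_eq _).mpr
        ⟨τ, hτ, (f.cone_le_lift ⟨g.cone, g.cone_mem⟩).trans hle, rfl⟩, ?_, ?_⟩
      · have := f.map_lift ⟨g.cone, g.cone_mem⟩
        simp only at this
        rw [← this]
        exact Submodule.map_mono hle
      · rw [map_comp_cone]

lemma cone_le_comp_cone (f : Hom A B) (g : Hom B C) : f.cone ≤ (f.comp g).cone :=
  f.cone_le_lift _

lemma map_comp_cone_eq (f : Hom A B) (g : Hom B C) :
    (f.comp g).cone.map f.realMap = g.cone :=
  f.map_lift _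

end Hom

/-- The category of fans and quotient maps. -/
instance : Category ToricFan.{u} where
  Hom := Hom
  id := Hom.id
  comp := Hom.comp
  id_comp {A B} f := by
    refine Hom.ext ?_ rfl
    have := (Hom.id A).map_comp_cone_eq f
    simpa [Hom.id, Hom.realMap, PointedCone.map_id] using this
  comp_id {A B} f := by
    refine Hom.ext ?_ rfl
    refine f.eq_of_map_eq (f.comp (Hom.id B)).cone_mem f.cone_mem (f.cone_le_comp_cone _) le_rfl ?_
    rw [f.map_comp_cone_eq]
    symm
    refine le_antisymm ?_ bot_le
    rintro _ ⟨x, hx, rfl⟩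
    exact (f.realMap_eq_zero_iff x).mpr (Submodule.subset_span hx)
  assoc {A B C D} f g h := by
    refine Hom.ext ?_ rfl
    have h1 := (f.comp (g.comp h)).cone_mem
    have h2 := ((f.comp g).comp h).cone_mem
    have h3 := (f.comp g).cone_le_comp_cone h
    have h4 := f.cone_le_comp_cone g
    refine f.eq_of_map_eq h2 h1 (h4.trans h3) (f.cone_le_comp_cone _) ?_
    rw [f.map_comp_cone_eq]
    have e1 := (f.comp g).map_comp_cone_eq h
    have e2 := g.map_comp_cone_eq h
    have hm : (((f.comp g).comp h).cone.map f.realMap) ∈ B.cones :=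
      (f.cones_eq _).mpr ⟨_, h2, h4.trans h3, rfl⟩
    have hle : g.cone ≤ ((f.comp g).comp h).cone.map f.realMap := by
      rw [← f.map_comp_cone_eq g]
      exact Submodule.map_mono h3
    refine g.eq_of_map_eq hm (g.comp h).cone_mem hle (g.cone_le_comp_cone _) ?_
    rw [e2, ← e1]
    exact (Hom.map_comp_cone g f _).symm

end ToricFan

/-! ### Toric varieties -/

section FaceProjection

variable (k : Type u) [CommRing k] {N S : Type u} [AddCommMonoid N] [AddCommMonoid S]

open Classical in
/-- For an injective homomorphism `j : N → S` of monoids onto a face of `S`, the ring homomorphism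
`k[S] → k[N]` that sends `χ^{j n}` to `χ^n` and kills all other monomials. -/
def faceProjection (j : N →+ S) (hj : Function.Injective j)
    (hface : ∀ a b, a + b ∈ Set.range j → a ∈ Set.range j ∧ b ∈ Set.range j) :
    AddMonoidAlgebra k S →ₐ[k] AddMonoidAlgebra k N :=
  AddMonoidAlgebra.lift k (AddMonoidAlgebra k N) S
    { toFun := fun s => if h : ∃ n, j n = s.toAdd then AddMonoidAlgebra.single h.choose 1 else 0
      map_one' := by
        have h : ∃ n, j n = (1 : Multiplicative S).toAdd := ⟨0, by simp⟩
        have h0 : h.choose = 0 := hj (by rw [h.choose_spec]; simp)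
        rw [dif_pos h, h0]; rfl
      map_mul' := fun s t => by
        by_cases hs : ∃ n, j n = s.toAdd
        · by_cases ht : ∃ n, j n = t.toAdd
          · have hst : ∃ n, j n = (s * t).toAdd :=
              ⟨hs.choose + ht.choose, by rw [map_add, hs.choose_spec, ht.choose_spec]; rfl⟩
            have h0 : hst.choose = hs.choose + ht.choose :=
              hj (by rw [hst.choose_spec, map_add, hs.choose_spec, ht.choose_spec]; rfl)
            rw [dif_pos hs, dif_pos ht, dif_pos hst, h0, AddMonoidAlgebra.single_mul_single, one_mul]
          · rw [dif_neg ht, mul_zero, dif_neg]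
            exact fun hst => ht (hface s.toAdd t.toAdd hst).2
        · rw [dif_neg hs, zero_mul, dif_neg]
          exact fun hst => hs (hface s.toAdd t.toAdd hst).1 }

variable {k} (j : N →+ S) (hj : Function.Injective j)
    (hface : ∀ a b, a + b ∈ Set.range j → a ∈ Set.range j ∧ b ∈ Set.range j)

lemma faceProjection_single (n : N) (r : k) :
    faceProjection k j hj hface (AddMonoidAlgebra.single (j n) r) =
      AddMonoidAlgebra.single n r := by
  have h : ∃ n', j n' = (Multiplicative.ofAdd (j n)).toAdd := ⟨n, rfl⟩
  have h0 : h.choose = n := hj h.choose_spec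
  rw [faceProjection, AddMonoidAlgebra.lift_single]
  simp only [MonoidHom.coe_mk, OneHom.coe_mk]
  rw [dif_pos h, h0]
  simp

lemma faceProjection_single_of_notMem {s : S} (hs : s ∉ Set.range j) (r : k) :
    faceProjection k j hj hface (AddMonoidAlgebra.single s r) = 0 := by
  rw [faceProjection, AddMonoidAlgebra.lift_single]
  simp only [MonoidHom.coe_mk, OneHom.coe_mk]
  rw [dif_neg (show ¬ ∃ n, j n = (Multiplicative.ofAdd s).toAdd from hs), smul_zero]

end FaceProjection

section Charts

variable (k : Type u) [CommRing k] {M : Type u} [AddCommGroup M]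

/-- The coordinate ring `k[σ^∨ ∩ Hom(M, ℤ)]` of the affine toric variety of the cone `σ`. -/
abbrev ConeRing (σ : PointedCone ℝ (ℝ ⊗[ℤ] M)) : Type u := AddMonoidAlgebra k (dualMonoid σ)

/-- The inclusion `k[σ^∨ ∩ Hom(M, ℤ)] ⊆ k[τ^∨ ∩ Hom(M, ℤ)]` for `τ ⊆ σ`. -/
def coneRingMap {τ σ : PointedCone ℝ (ℝ ⊗[ℤ] M)} (h : τ ≤ σ) : ConeRing k σ →+* ConeRing k τ :=
  AddMonoidAlgebra.mapDomainRingHom k (AddSubmonoid.inclusion (dualMonoid_anti h))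

lemma coneRingMap_single {τ σ : PointedCone ℝ (ℝ ⊗[ℤ] M)} (h : τ ≤ σ) (a : dualMonoid σ) (r : k) :
    coneRingMap k h (AddMonoidAlgebra.single a r) =
      AddMonoidAlgebra.single (AddSubmonoid.inclusion (dualMonoid_anti h) a) r := by
  simp [coneRingMap]

lemma coneRing_hom_ext {σ : PointedCone ℝ (ℝ ⊗[ℤ] M)} {R : Type u} [CommRing R]
    {f g : ConeRing k σ →+* R}
    (h : ∀ a r, f (AddMonoidAlgebra.single a r) = g (AddMonoidAlgebra.single a r)) : f = g :=
  AddMonoidAlgebra.ringHom_ext (fun r => h 0 r) (fun a => h a 1)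

lemma exists_add_smul_mem {τ σ : PointedCone ℝ (ℝ ⊗[ℤ] M)} (hσ : IsRationalPolyhedral σ)
    {m : Module.Dual ℤ M} (hm : CutsOut m τ σ) {a : Module.Dual ℤ M} (ha : a ∈ dualMonoid τ) :
    ∃ n : ℕ, a + n • m ∈ dualMonoid σ := by
  obtain ⟨S, hS, hσ⟩ := hσ
  have hmem : ∀ s ∈ S, (1 : ℝ) ⊗ₜ[ℤ] s ∈ σ := fun s hs => by
    rw [hσ]; exact Submodule.subset_span ⟨s, hs, rfl⟩
  have hpt : ∀ s ∈ S, ∀ n : ℕ, (a s).natAbs ≤ n → 0 ≤ a s + n * m s := by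
    intro s hs n hn
    have h1 : 0 ≤ m s := by simpa using hm.1 _ (hmem s hs)
    rcases h1.eq_or_lt with h1 | h1
    · have h2 : (1 : ℝ) ⊗ₜ[ℤ] s ∈ τ := (hm.2 _).mpr ⟨hmem s hs, by simp [← h1]⟩
      have h3 : 0 ≤ a s := by simpa using ha _ h2
      rw [← h1]; simpa using h3
    · have h2 : (n : ℤ) ≤ n * m s := by nlinarith
      omega
  refine ⟨hS.toFinset.sup fun s => (a s).natAbs, ?_⟩
  set n := hS.toFinset.sup fun s => (a s).natAbs
  have key : σ ≤ PointedCone.comap (realPairing (a + n • m)) (PointedCone.positive ℝ ℝ) := by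
    rw [hσ]
    refine Submodule.span_le.mpr ?_
    rintro _ ⟨s, hs, rfl⟩
    have h1 := hpt s hs n (Finset.le_sup (f := fun s => (a s).natAbs) (hS.mem_toFinset.mpr hs))
    have h2 : (0 : ℝ) ≤ ((a s + n * m s : ℤ) : ℝ) := by exact_mod_cast h1
    simpa using h2
  intro x hx
  simpa using key hx

lemma isLocalization_coneRingMap {τ σ : PointedCone ℝ (ℝ ⊗[ℤ] M)} (hσ : IsRationalPolyhedral σ)
    (h : τ ≤ σ) {m : Module.Dual ℤ M} (hm : CutsOut m τ σ) :
    @IsLocalization.Away _ _ (AddMonoidAlgebra.single (⟨m, hm.1⟩ : dualMonoid σ) (1 : k))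
      (ConeRing k τ) _ (coneRingMap k h).toAlgebra := by
  let _ := (coneRingMap k h).toAlgebra
  have halg : ∀ x, algebraMap (ConeRing k σ) (ConeRing k τ) x = coneRingMap k h x := fun _ => rfl
  have hneg : -m ∈ dualMonoid τ := fun x hx => by
    have := ((hm.2 x).mp hx).2
    simp only [realPairing, map_neg, LinearMap.neg_apply] at this ⊢
    rw [this, neg_zero]
  have hinv : coneRingMap k h (AddMonoidAlgebra.single (⟨m, hm.1⟩ : dualMonoid σ) (1 : k)) *
      AddMonoidAlgebra.single (⟨-m, hneg⟩ : dualMonoid τ) (1 : k) = 1 := by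
    rw [coneRingMap_single, AddMonoidAlgebra.single_mul_single, one_mul,
      AddMonoidAlgebra.one_def]
    congr 1
    ext x
    simp [AddSubmonoid.inclusion]
  have hinj : Function.Injective (coneRingMap k h) := by
    refine AddMonoidAlgebra.mapDomain_injective ?_
    exact AddSubmonoid.inclusion_injective _
  set X := AddMonoidAlgebra.single (⟨m, hm.1⟩ : dualMonoid σ) (1 : k) with hX
  have hsurj : ∀ z : ConeRing k τ, ∃ (n : ℕ) (x : ConeRing k σ),
      z * coneRingMap k h X ^ n = coneRingMap k h x := by
    intro z
    induction z using AddMonoidAlgebra.induction_linear with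
    | zero => exact ⟨0, 0, by simp⟩
    | add z z' hz hz' =>
      obtain ⟨n, x, hx⟩ := hz
      obtain ⟨n', x', hx'⟩ := hz'
      refine ⟨n + n', x * X ^ n' + x' * X ^ n, ?_⟩
      rw [map_add, map_mul, map_mul, ← hx, ← hx', map_pow, map_pow]
      ring
    | single a r =>
      obtain ⟨n, hn⟩ := exists_add_smul_mem hσ hm a.2
      refine ⟨n, AddMonoidAlgebra.single ⟨_, hn⟩ r, ?_⟩
      rw [hX, coneRingMap_single, coneRingMap_single, AddMonoidAlgebra.single_pow,
        AddMonoidAlgebra.single_mul_single, one_pow, mul_one]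
      congr 1
  refine (isLocalization_iff _ _).mpr ⟨?_, ?_, ?_⟩
  · rintro ⟨_, n, rfl⟩
    rw [halg, map_pow]
    exact (IsUnit.of_mul_eq_one _ hinv).pow n
  · intro z
    obtain ⟨n, x, hx⟩ := hsurj z
    exact ⟨⟨x, ⟨X ^ n, n, rfl⟩⟩, by rw [halg, halg, map_pow, hx]⟩
  · intro x y hxy
    exact ⟨1, by rw [hinj hxy]⟩

/-- The open immersion of affine toric varieties `U_τ ⟶ U_σ` for `τ ⊆ σ`. -/
def coneChartMap {τ σ : PointedCone ℝ (ℝ ⊗[ℤ] M)} (h : τ ≤ σ) :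
    Spec (CommRingCat.of (ConeRing k τ)) ⟶ Spec (CommRingCat.of (ConeRing k σ)) :=
  Spec.map (CommRingCat.ofHom (coneRingMap k h))

lemma isOpenImmersion_coneChartMap {τ σ : PointedCone ℝ (ℝ ⊗[ℤ] M)}
    (hσ : IsRationalPolyhedral σ) (h : τ ≤ σ) (hf : IsRationalFace τ σ) :
    IsOpenImmersion (coneChartMap k h) := by
  obtain ⟨m, hm⟩ := hf
  let _ := (coneRingMap k h).toAlgebra
  have := isLocalization_coneRingMap k hσ h hm
  exact IsOpenImmersion.of_isLocalization (S := ConeRing k τ)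
    (AddMonoidAlgebra.single (⟨m, hm.1⟩ : dualMonoid σ) (1 : k))

lemma mem_range_coneChartMap {τ σ : PointedCone ℝ (ℝ ⊗[ℤ] M)}
    (hσ : IsRationalPolyhedral σ) (h : τ ≤ σ) {m : Module.Dual ℤ M} (hm : CutsOut m τ σ)
    (p : Spec (CommRingCat.of (ConeRing k σ))) :
    p ∈ Set.range (coneChartMap k h) ↔
      AddMonoidAlgebra.single (⟨m, hm.1⟩ : dualMonoid σ) (1 : k) ∉ p.asIdeal := by
  let _ := (coneRingMap k h).toAlgebra
  have := isLocalization_coneRingMap k hσ h hm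
  exact Set.ext_iff.mp (PrimeSpectrum.localization_away_comap_range (ConeRing k τ)
    (AddMonoidAlgebra.single (⟨m, hm.1⟩ : dualMonoid σ) (1 : k))) p

end Charts

namespace ToricFan

variable (k : Type u) [CommRing k] (A : ToricFan.{u})

/-- The diagram of affine toric varieties `U_σ = Spec k[σ^∨ ∩ Hom(M, ℤ)]` and of the evident
inclusions `U_τ ⊆ U_σ` over the poset of cones of the fan. -/
def charts : A.Cone ⥤ Scheme.{u} where
  obj σ := Spec (CommRingCat.of (ConeRing k σ.1))
  map f := coneChartMap k (leOfHom f)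
  map_id σ := by
    have : coneRingMap k (leOfHom (𝟙 σ)) = RingHom.id _ :=
      coneRing_hom_ext k fun a r => by rw [coneRingMap_single]; rfl
    rw [coneChartMap, this]
    exact Spec.map_id _
  map_comp f g := by
    have : coneRingMap k (leOfHom (f ≫ g)) =
        (coneRingMap k (leOfHom f)).comp (coneRingMap k (leOfHom g)) :=
      coneRing_hom_ext k fun a r => by
        rw [RingHom.comp_apply, coneRingMap_single, coneRingMap_single, coneRingMap_single]; rfl
    rw [coneChartMap, this, CommRingCat.ofHom_comp, Spec.map_comp]
    rfl

instance {σ τ : A.Cone} (f : τ ⟶ σ) : IsOpenImmersion ((A.charts k).map f) :=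
  isOpenImmersion_coneChartMap k (A.rational _ σ.2) (leOfHom f)
    (A.isRationalFace_of_le σ.2 τ.2 (leOfHom f))

lemma inter_mem {σ τ : PointedCone ℝ A.space} (hσ : σ ∈ A.cones) (hτ : τ ∈ A.cones) :
    σ ⊓ τ ∈ A.cones :=
  A.face_mem σ hσ _ (A.inter_face σ hσ τ hτ)

instance : (A.charts k ⋙ Scheme.forget).IsLocallyDirected where
  cond {i j l} fi fj xi xj hx := by
    have hx : coneChartMap k (leOfHom fi) xi = coneChartMap k (leOfHom fj) xj := hx
    let o : A.Cone := ⟨i.1 ⊓ j.1, A.inter_mem i.2 j.2⟩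
    have hoi : o ≤ i := inf_le_left (a := i.1) (b := j.1)
    have hoj : o ≤ j := inf_le_right (a := i.1) (b := j.1)
    have hol : o ≤ l := hoi.trans (leOfHom fi)
    obtain ⟨a, ha⟩ := A.isRationalFace_of_le l.2 i.2 (leOfHom fi)
    obtain ⟨b, hb⟩ := A.isRationalFace_of_le l.2 j.2 (leOfHom fj)
    have hab : CutsOut (a + b) o.1 l.1 := by
      refine ⟨add_mem ha.1 hb.1, fun x => ⟨fun h => ?_, fun h => ?_⟩⟩
      · have h1 := (ha.2 x).mp h.1
        have h2 := (hb.2 x).mp h.2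
        exact ⟨h1.1, by rw [realPairing_add, h1.2, h2.2, add_zero]⟩
      · have h1 := ha.1 x h.1
        have h2 := hb.1 x h.1
        have h3 := h.2
        rw [realPairing_add] at h3
        exact ⟨(ha.2 x).mpr ⟨h.1, by linarith⟩, (hb.2 x).mpr ⟨h.1, by linarith⟩⟩
    have hrat := A.rational _ l.2
    have h1 := (mem_range_coneChartMap k hrat (leOfHom fi) ha _).mp ⟨xi, rfl⟩
    have h2 := (mem_range_coneChartMap k hrat (leOfHom fj) hb _).mp ⟨xj, rfl⟩
    rw [← hx] at h2
    have h3 : coneChartMap k (leOfHom fi) xi ∈ Set.range (coneChartMap k (τ := o.1) hol) := by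
      rw [mem_range_coneChartMap k hrat hol hab]
      intro h4
      have h5 : AddMonoidAlgebra.single (⟨a, ha.1⟩ : dualMonoid l.1) (1 : k) *
          AddMonoidAlgebra.single (⟨b, hb.1⟩ : dualMonoid l.1) (1 : k) =
          AddMonoidAlgebra.single (⟨a + b, hab.1⟩ : dualMonoid l.1) (1 : k) := by
        rw [AddMonoidAlgebra.single_mul_single, one_mul]; rfl
      rw [← h5] at h4
      exact (Ideal.IsPrime.mem_or_mem (PrimeSpectrum.isPrime _) h4).elim h1 h2
    obtain ⟨x, hx'⟩ := h3
    refine ⟨o, homOfLE hoi, homOfLE hoj, x, ?_, ?_⟩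
    · have hinj : Function.Injective ((A.charts k).map fi) :=
        ((A.charts k).map fi).isOpenEmbedding.injective
      apply hinj
      refine Eq.trans ?_ hx'
      change ((A.charts k).map (homOfLE hoi) ≫ (A.charts k).map fi) x = _
      rw [← Functor.map_comp]
      rfl
    · have hinj : Function.Injective ((A.charts k).map fj) :=
        ((A.charts k).map fj).isOpenEmbedding.injective
      apply hinj
      refine Eq.trans ?_ (hx'.trans hx)
      change ((A.charts k).map (homOfLE hoj) ≫ (A.charts k).map fj) x = _
      rw [← Functor.map_comp]
      rfl

/-- The toric variety `T(Σ)`: the affine toric varieties `U_σ`, `σ ∈ Σ`, glued along the open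
subschemes `U_{σ ∩ σ'} ⊆ U_σ, U_σ'`. -/
def toricVariety : Scheme.{u} := colimit (A.charts k)

/-- The open chart `U_σ` of `T(Σ)`. -/
def toricChart (σ : A.Cone) : (A.charts k).obj σ ⟶ A.toricVariety k := colimit.ι (A.charts k) σ

end ToricFan

/-! ### Functoriality: orbit closures -/

namespace ToricFan.Hom

variable {A B C : ToricFan.{u}} (h : Hom A B)

lemma realPairing_eq_zero_of_factors (m' : Module.Dual ℤ B.lattice) {x : A.space}
    (hx : x ∈ h.cone) : realPairing (m' ∘ₗ h.map) x = 0 := by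
  rw [realPairing_comp, (h.realMap_eq_zero_iff x).mpr (Submodule.subset_span hx), map_zero]

lemma exists_factor {m : Module.Dual ℤ A.lattice} (hm : ∀ x ∈ h.cone, realPairing m x = 0) :
    ∃ m' : Module.Dual ℤ B.lattice, m' ∘ₗ h.map = m := by
  have hspan : Submodule.span ℝ (h.cone : Set A.space) ≤ LinearMap.ker (realPairing m) :=
    Submodule.span_le.mpr fun y hy => hm y hy
  have hker : LinearMap.ker h.map ≤ LinearMap.ker m := fun x hx => by
    have h1 := hspan ((h.ker x).mp hx)
    simpa using h1
  refine ⟨(LinearMap.ker h.map).liftQ m hker ∘ₗ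
    (h.map.quotKerEquivOfSurjective h.surjective).symm.toLinearMap, ?_⟩
  ext x
  have : (h.map.quotKerEquivOfSurjective h.surjective).symm (h.map x) =
      (LinearMap.ker h.map).mkQ x := by
    rw [LinearEquiv.symm_apply_eq]; rfl
  simp [this]

/-- Pulling back covectors along `M → M'`: the inclusion of `σ'^∨ ∩ Hom(M', ℤ)` into
`τ^∨ ∩ Hom(M, ℤ)` as the face of covectors vanishing on `σ`, for `σ'` the image of `τ ⊇ σ`. -/
def pullbackDual {τ : PointedCone ℝ A.space} {ρ : PointedCone ℝ B.space}
    (hρ : τ.map h.realMap = ρ) : dualMonoid ρ →+ dualMonoid τ where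
  toFun m' := ⟨m'.1 ∘ₗ h.map, fun x hx => by
    rw [realPairing_comp]
    exact m'.2 _ (by rw [← hρ]; exact PointedCone.mem_map.mpr ⟨x, hx, rfl⟩)⟩
  map_zero' := by ext x; simp
  map_add' a b := by ext x; simp

lemma pullbackDual_injective {τ : PointedCone ℝ A.space} {ρ : PointedCone ℝ B.space}
    (hρ : τ.map h.realMap = ρ) : Function.Injective (h.pullbackDual hρ) := by
  intro a b hab
  ext y
  obtain ⟨x, rfl⟩ := h.surjective y
  exact LinearMap.congr_fun (congrArg Subtype.val hab) x

lemma mem_range_pullbackDual {τ : PointedCone ℝ A.space} {ρ : PointedCone ℝ B.space}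
    (hρ : τ.map h.realMap = ρ) (m : dualMonoid τ) :
    m ∈ Set.range (h.pullbackDual hρ) ↔ ∀ x ∈ h.cone, realPairing m.1 x = 0 := by
  constructor
  · rintro ⟨m', rfl⟩ x hx
    exact h.realPairing_eq_zero_of_factors m'.1 hx
  · intro hm
    obtain ⟨m', hm'⟩ := h.exists_factor hm
    refine ⟨⟨m', fun y hy => ?_⟩, Subtype.ext hm'⟩
    rw [← hρ] at hy
    obtain ⟨x, hx, rfl⟩ := PointedCone.mem_map.mp hy
    rw [← realPairing_comp, hm']
    exact m.2 x hx

lemma pullbackDual_face {τ : PointedCone ℝ A.space} {ρ : PointedCone ℝ B.space}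
    (hσ : h.cone ≤ τ) (hρ : τ.map h.realMap = ρ) (a b : dualMonoid τ)
    (hab : a + b ∈ Set.range (h.pullbackDual hρ)) :
    a ∈ Set.range (h.pullbackDual hρ) ∧ b ∈ Set.range (h.pullbackDual hρ) := by
  rw [mem_range_pullbackDual] at hab ⊢
  rw [mem_range_pullbackDual]
  have key : ∀ x ∈ h.cone, realPairing a.1 x = 0 ∧ realPairing b.1 x = 0 := fun x hx => by
    have h1 := hab x hx
    have h2 := a.2 x (hσ hx)
    have h3 := b.2 x (hσ hx)
    rw [AddSubmonoid.coe_add, realPairing_add] at h1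
    exact ⟨by linarith, by linarith⟩
  exact ⟨fun x hx => (key x hx).1, fun x hx => (key x hx).2⟩

variable (k : Type u) [CommRing k]

/-- The surjection `k[τ^∨ ∩ Hom(M, ℤ)] → k[σ'^∨ ∩ Hom(M', ℤ)]`, for `σ'` the image of `τ ⊇ σ`: a
monomial `χ^m` goes to `χ^m` if `m` vanishes on `σ`, and to `0` otherwise. -/
def orbitRingMap {τ : PointedCone ℝ A.space} {ρ : PointedCone ℝ B.space}
    (hσ : h.cone ≤ τ) (hρ : τ.map h.realMap = ρ) : ConeRing k τ →+* ConeRing k ρ :=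
  (faceProjection k (h.pullbackDual hρ) (h.pullbackDual_injective hρ)
    (h.pullbackDual_face hσ hρ)).toRingHom

variable {k}

lemma orbitRingMap_single {τ : PointedCone ℝ A.space} {ρ : PointedCone ℝ B.space}
    (hσ : h.cone ≤ τ) (hρ : τ.map h.realMap = ρ) (n : dualMonoid ρ) (r : k) :
    h.orbitRingMap k hσ hρ (AddMonoidAlgebra.single (h.pullbackDual hρ n) r) =
      AddMonoidAlgebra.single n r :=
  faceProjection_single _ _ _ n r

lemma orbitRingMap_single_of_notMem {τ : PointedCone ℝ A.space} {ρ : PointedCone ℝ B.space}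
    (hσ : h.cone ≤ τ) (hρ : τ.map h.realMap = ρ) {m : dualMonoid τ}
    (hm : ¬ ∀ x ∈ h.cone, realPairing m.1 x = 0) (r : k) :
    h.orbitRingMap k hσ hρ (AddMonoidAlgebra.single m r) = 0 :=
  faceProjection_single_of_notMem _ _ _ (fun hm' => hm ((h.mem_range_pullbackDual hρ m).mp hm')) r

/-- The orbit ring maps are compatible with restriction to smaller charts. -/
lemma coneRingMap_comp_orbitRingMap {τ τ' : PointedCone ℝ A.space} {ρ ρ' : PointedCone ℝ B.space}
    (hσ : h.cone ≤ τ) (hρ : τ.map h.realMap = ρ) (hσ' : h.cone ≤ τ') (hρ' : τ'.map h.realMap = ρ')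
    (hτ : τ ≤ τ') (hle : ρ ≤ ρ') :
    (coneRingMap k hle).comp (h.orbitRingMap k hσ' hρ') =
      (h.orbitRingMap k hσ hρ).comp (coneRingMap k hτ) := by
  refine coneRing_hom_ext k fun m r => ?_
  rw [RingHom.comp_apply, RingHom.comp_apply, coneRingMap_single]
  by_cases hm : ∀ x ∈ h.cone, realPairing m.1 x = 0
  · obtain ⟨n, rfl⟩ := (h.mem_range_pullbackDual hρ' m).mpr hm
    rw [orbitRingMap_single, coneRingMap_single]
    exact (h.orbitRingMap_single hσ hρ _ r).symm
  · rw [orbitRingMap_single_of_notMem h hσ' hρ' hm, map_zero]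
    exact (h.orbitRingMap_single_of_notMem hσ hρ (m := AddSubmonoid.inclusion _ m) hm r).symm

lemma orbitRingMap_id {τ ρ : PointedCone ℝ A.space} (hσ : (Hom.id A).cone ≤ τ)
    (hρ : τ.map (Hom.id A).realMap = ρ) (hle : ρ ≤ τ) :
    (Hom.id A).orbitRingMap k hσ hρ = coneRingMap k hle := by
  refine coneRing_hom_ext k fun m r => ?_
  have hm : ∀ x ∈ (Hom.id A).cone, realPairing m.1 x = 0 := fun x hx => by
    have : x = 0 := hx
    rw [this, map_zero]
  obtain ⟨n, rfl⟩ := ((Hom.id A).mem_range_pullbackDual hρ m).mpr hm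
  rw [orbitRingMap_single, coneRingMap_single]
  rfl

lemma orbitRingMap_comp (g : Hom B C) {τ : PointedCone ℝ A.space} {ρ : PointedCone ℝ B.space}
    {π : PointedCone ℝ C.space} (hσ : h.cone ≤ τ) (hρ : τ.map h.realMap = ρ)
    (hσ' : g.cone ≤ ρ) (hπ : ρ.map g.realMap = π) (hσ'' : (h.comp g).cone ≤ τ)
    (hπ' : τ.map (h.comp g).realMap = π) :
    (h.comp g).orbitRingMap k hσ'' hπ' =
      (g.orbitRingMap k hσ' hπ).comp (h.orbitRingMap k hσ hρ) := by
  refine coneRing_hom_ext k fun m r => ?_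
  rw [RingHom.comp_apply]
  by_cases hm : ∀ x ∈ h.cone, realPairing m.1 x = 0
  · obtain ⟨n, rfl⟩ := (h.mem_range_pullbackDual hρ m).mpr hm
    rw [orbitRingMap_single]
    by_cases hn : ∀ y ∈ g.cone, realPairing n.1 y = 0
    · obtain ⟨l, rfl⟩ := (g.mem_range_pullbackDual hπ n).mpr hn
      rw [orbitRingMap_single]
      exact (h.comp g).orbitRingMap_single hσ'' hπ' l r
    · rw [orbitRingMap_single_of_notMem g hσ' hπ hn]
      refine (h.comp g).orbitRingMap_single_of_notMem hσ'' hπ' (fun hc => hn fun y hy => ?_) r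
      rw [← h.map_comp_cone_eq g] at hy
      obtain ⟨x, hx, rfl⟩ := PointedCone.mem_map.mp hy
      rw [← realPairing_comp]
      exact hc x hx
  · rw [orbitRingMap_single_of_notMem h hσ hρ hm, map_zero]
    exact (h.comp g).orbitRingMap_single_of_notMem hσ'' hπ'
      (fun hc => hm fun x hx => hc x (h.cone_le_comp_cone g hx)) r

variable (k)

/-- The closed immersion of charts `U_σ' ⟶ U_τ`, for `σ'` the image of `τ ⊇ σ`. -/
def orbitChartMap {τ : A.Cone} {ρ : B.Cone} (hσ : h.cone ≤ τ.1) (hρ : τ.1.map h.realMap = ρ.1) :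
    (B.charts k).obj ρ ⟶ (A.charts k).obj τ :=
  Spec.map (CommRingCat.ofHom (h.orbitRingMap k hσ hρ))

/-- The closed immersion `T(Σ/σ) ⟶ T(Σ)` onto the closure of the torus orbit of `σ`, glued from the
maps of charts `U_σ' ⟶ U_τ`, where `τ ⊇ σ` is the cone of `Σ` with image `σ'`. -/
def toricMap : B.toricVariety k ⟶ A.toricVariety k :=
  colimit.desc (B.charts k)
    { pt := A.toricVariety k
      ι :=
        { app := fun ρ => h.orbitChartMap k (h.cone_le_lift ρ) (h.map_lift ρ) ≫
            A.toricChart k (h.lift ρ)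
          naturality := fun ρ ρ' f => by
            have hle := h.lift_mono (leOfHom f)
            have key : (B.charts k).map f ≫
                h.orbitChartMap k (h.cone_le_lift ρ') (h.map_lift ρ') =
                h.orbitChartMap k (h.cone_le_lift ρ) (h.map_lift ρ) ≫
                  (A.charts k).map (homOfLE hle) := by
              change Spec.map _ ≫ Spec.map _ = Spec.map _ ≫ Spec.map _
              rw [← Spec.map_comp, ← Spec.map_comp, ← CommRingCat.ofHom_comp,
                ← CommRingCat.ofHom_comp, h.coneRingMap_comp_orbitRingMap (h.cone_le_lift ρ)
                (h.map_lift ρ) (h.cone_le_lift ρ') (h.map_lift ρ') hle (leOfHom f)]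
            have w : (A.charts k).map (homOfLE hle) ≫ A.toricChart k (h.lift ρ') =
                A.toricChart k (h.lift ρ) := colimit.w (A.charts k) (homOfLE hle)
            rw [reassoc_of% key, w]
            exact (Category.comp_id _).symm } }

lemma toricChart_comp_toricMap {τ : A.Cone} {ρ : B.Cone} (hσ : h.cone ≤ τ.1)
    (hρ : τ.1.map h.realMap = ρ.1) :
    B.toricChart k ρ ≫ h.toricMap k = h.orbitChartMap k hσ hρ ≫ A.toricChart k τ := by
  obtain rfl := h.eq_lift hσ hρ
  exact colimit.ι_desc _ _

lemma toricVariety_hom_ext {X : Scheme.{u}} {f g : A.toricVariety k ⟶ X}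
    (hfg : ∀ σ, A.toricChart k σ ≫ f = A.toricChart k σ ≫ g) : f = g :=
  colimit.hom_ext hfg

lemma toricMap_id : (Hom.id A).toricMap k = 𝟙 _ := by
  refine toricVariety_hom_ext k fun σ => ?_
  have h1 : σ.1.map (Hom.id A).realMap = σ.1 := by simp [Hom.id, Hom.realMap, PointedCone.map_id]
  have h0 : (Hom.id A).cone ≤ σ.1 := bot_le (α := PointedCone ℝ A.space)
  rw [(Hom.id A).toricChart_comp_toricMap k (τ := σ) h0 h1, Category.comp_id]
  have : (Hom.id A).orbitChartMap k (τ := σ) (ρ := σ) h0 h1 = (A.charts k).map (𝟙 σ) := by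
    change Spec.map (CommRingCat.ofHom ((Hom.id A).orbitRingMap k _ h1)) = _
    rw [orbitRingMap_id _ h1 le_rfl]; rfl
  rw [this, CategoryTheory.Functor.map_id, Category.id_comp]

lemma toricMap_comp (g : Hom B C) : (h.comp g).toricMap k = g.toricMap k ≫ h.toricMap k := by
  refine toricVariety_hom_ext k fun π => ?_
  have hσ' := g.cone_le_lift π
  have hπ := g.map_lift π
  set ρ := g.lift π
  have hσ := h.cone_le_lift ρ
  have hρ := h.map_lift ρ
  set τ := h.lift ρ
  have hσ'' : (h.comp g).cone ≤ τ.1 :=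
    h.lift_mono (ρ := ⟨g.cone, g.cone_mem⟩) (ρ' := ρ) hσ'
  have hπ' : τ.1.map (h.comp g).realMap = π.1 := by
    rw [← hπ, ← hρ]; exact map_comp_cone g h τ.1
  rw [(h.comp g).toricChart_comp_toricMap k hσ'' hπ',
    reassoc_of% g.toricChart_comp_toricMap k hσ' hπ, h.toricChart_comp_toricMap k hσ hρ,
    ← Category.assoc]
  congr 1
  rw [orbitChartMap, orbitChartMap, orbitChartMap, h.orbitRingMap_comp g hσ hρ hσ' hπ hσ'' hπ',
    CommRingCat.ofHom_comp, Spec.map_comp]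
  rfl

end ToricFan.Hom

/-- The functor `T` from the opposite of the category of fans to schemes: it sends a fan to its
toric variety over `k` and a quotient map `Σ ⟶ Σ/σ` to the inclusion of the closure of the torus
orbit of `σ`. -/
def toricFunctor (k : Type u) [CommRing k] : ToricFan.{u}ᵒᵖ ⥤ Scheme.{u} where
  obj A := A.unop.toricVariety k
  map f := ToricFan.Hom.toricMap f.unop k
  map_id _ := ToricFan.Hom.toricMap_id k
  map_comp f g := ToricFan.Hom.toricMap_comp g.unop k f.unop

/-! ### Stratified subsets of manifolds and their exit path categories -/

/-- A closed subset of an `n`-manifold, stratified by finitely many smooth submanifolds. -/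
structure StratifiedSubset (n : ℕ) (𝓜 : Type v) [TopologicalSpace 𝓜]
    [ChartedSpace (EuclideanSpace ℝ (Fin n)) 𝓜] : Type (v + 1) where
  /-- the index type of the strata -/
  Stratum : Type
  [finite : Finite Stratum]
  /-- the strata -/
  carrier : Stratum → Set 𝓜
  disjoint : ∀ s s', s ≠ s' → Disjoint (carrier s) (carrier s')
  isClosed : IsClosed (⋃ s, carrier s)
  /-- the dimensions of the strata -/
  dim : Stratum → ℕ
  [charted : ∀ s, ChartedSpace (EuclideanSpace ℝ (Fin (dim s))) (carrier s)]
  [manifold : ∀ s, IsManifold (𝓡 (dim s)) ∞ (carrier s)]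
  embedding : ∀ s, Manifold.IsSmoothEmbedding (𝓡 (dim s)) (𝓡 n) ∞
    (Subtype.val : carrier s → 𝓜)

attribute [instance] StratifiedSubset.finite StratifiedSubset.charted StratifiedSubset.manifold

namespace StratifiedSubset

variable {n : ℕ} {𝓜 : Type v} [TopologicalSpace 𝓜] [ChartedSpace (EuclideanSpace ℝ (Fin n)) 𝓜]
  (S : StratifiedSubset n 𝓜)

/-- A point of the stratified set, recorded with its stratum. -/
structure Point : Type v where
  /-- the stratum -/
  stratum : S.Stratum
  /-- the point of the ambient manifold -/
  val : 𝓜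
  mem : val ∈ S.carrier stratum

variable {S}

/-- An elementary exit path: a path that lies in the stratum of its end point at all times but
(possibly) its starting time. These are the `1`-simplices of the simplicial set of exit paths. -/
structure ExitPath (x y : S.Point) : Type v where
  /-- the path in the ambient manifold -/
  path : Path x.val y.val
  exit : ∀ t, t ≠ 0 → path t ∈ S.carrier y.stratum

/-- The constant exit path. -/
def ExitPath.const (x : S.Point) : ExitPath x x := ⟨Path.refl x.val, fun _ _ => x.mem⟩

/-- `γ`, `δ`, `ε` bound a `2`-simplex of the simplicial set of exit paths: a continuous map from
the triangle `0 ≤ b ≤ a ≤ 1`, with vertices `(0, 0)`, `(1, 0)`, `(1, 1)` and with edges `γ`, `δ`,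
`ε`, that sends all points off the first edge into the stratum of the last vertex. -/
def BoundsTriangle {x y z : S.Point} (γ : ExitPath x y) (δ : ExitPath y z) (ε : ExitPath x z) :
    Prop :=
  ∃ H : ℝ × ℝ → 𝓜,
    ContinuousOn H {q | 0 ≤ q.2 ∧ q.2 ≤ q.1 ∧ q.1 ≤ 1} ∧
    (∀ t : unitInterval, H ((t : ℝ), 0) = γ.path t) ∧
    (∀ t : unitInterval, H (1, (t : ℝ)) = δ.path t) ∧
    (∀ t : unitInterval, H ((t : ℝ), (t : ℝ)) = ε.path t) ∧
    ∀ a b : ℝ, 0 < b → b ≤ a → a ≤ 1 → H (a, b) ∈ S.carrier z.stratum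

instance : Quiver S.Point where
  Hom := ExitPath

/-- The relations of the exit path category: constant paths are identities, and `2`-simplices
commute. -/
inductive ExitRel : HomRel (Paths S.Point)
  | const (x : S.Point) :
      ExitRel ((Paths.of S.Point).map (ExitPath.const x)) (𝟙 ((Paths.of S.Point).obj x))
  | triangle {x y z : S.Point} (γ : ExitPath x y) (δ : ExitPath y z) (ε : ExitPath x z)
      (h : BoundsTriangle γ δ ε) :
      ExitRel ((Paths.of S.Point).map γ ≫ (Paths.of S.Point).map δ) ((Paths.of S.Point).map ε)

variable (S) in
/-- The exit path category: its objects are the points of the stratified set, and its morphisms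
are generated by the elementary exit paths, subject to the relations given by the `2`-simplices.
This is the homotopy category of the simplicial set of exit paths. -/
abbrev Exit : Type v := CategoryTheory.Quotient (ExitRel (S := S))

/-- A point as an object of the exit path category. -/
def Point.toExit (x : S.Point) : S.Exit := ⟨x⟩

/-- The underlying point of an object of the exit path category. -/
def Exit.point (x : S.Exit) : S.Point := x.as

/-- The class of an elementary exit path in the exit path category. -/
def ExitPath.toExit {x y : S.Point} (γ : ExitPath x y) : x.toExit ⟶ y.toExit :=
  (CategoryTheory.Quotient.functor (ExitRel (S := S))).map ((Paths.of S.Point).map γ)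

/-- The tangent space at `x` of the stratum of `x`. -/
def tangentSpace (x : S.Point) : Submodule ℝ (TangentSpace (𝓡 n) x.val) :=
  LinearMap.range (mfderiv (𝓡 (S.dim x.stratum)) (𝓡 n)
    (Subtype.val : S.carrier x.stratum → 𝓜) ⟨x.val, x.mem⟩).toLinearMap

/-- The normal space at `x` of the stratum of `x`. -/
abbrev normalSpace (x : S.Point) : Type := TangentSpace (𝓡 n) x.val ⧸ tangentSpace x

/-- The class of a tangent vector in the normal space. -/
def toNormal (x : S.Point) (w : TangentSpace (𝓡 n) x.val) : normalSpace x :=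
  (tangentSpace x).mkQ w

end StratifiedSubset

/-! ### Fanifolds -/

open StratifiedSubset

section Tubular

variable {n : ℕ} {𝓜 : Type v} [TopologicalSpace 𝓜] [ChartedSpace (EuclideanSpace ℝ (Fin n)) 𝓜]

/-- A tubular neighbourhood of the stratum `F` of `p`, in which the stratified set is the product
of `F` with the fan at `p`. Here `fan` is a functor from the exit path category to fans, and
`framing` is a family of isomorphisms of the normal spaces with the real vector spaces of the
fans. The normal bundle of `F` is trivialized by `framing`, the lattices at different points of
`F` being identified along the morphisms of the exit path category. -/
structure ConicalNeighborhood (S : StratifiedSubset n 𝓜) (fan : S.Exit ⥤ ToricFan.{u})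
    (framing : ∀ x : S.Point, normalSpace x ≃ₗ[ℝ] (fan.obj x.toExit).space)
    (p : S.Point) where
  /-- the codimension of the stratum -/
  codim : ℕ
  /-- linear coordinates on the vector space of the fan at `p` -/
  coord : EuclideanSpace ℝ (Fin codim) ≃ₗ[ℝ] (fan.obj p.toExit).space
  /-- the domain: a neighbourhood of the zero section of the trivialized normal bundle -/
  source : Set (S.carrier p.stratum × EuclideanSpace ℝ (Fin codim))
  isOpen_source : IsOpen source
  zero_mem : ∀ x, (x, 0) ∈ source
  /-- the tubular neighbourhood -/
  toFun : S.carrier p.stratum × EuclideanSpace ℝ (Fin codim) → 𝓜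
  injOn : Set.InjOn toFun source
  isLocalDiffeomorphOn : IsLocalDiffeomorphOn ((𝓡 (S.dim p.stratum)).prod (𝓡 codim)) (𝓡 n) ∞
    toFun source
  map_zero : ∀ x, toFun (x, 0) = x.1
  /-- along the zero section, the derivative in the normal directions is inverse to the framing -/
  deriv : ∀ (x : S.Point) (hx : x.val ∈ S.carrier p.stratum) (f : x.toExit ⟶ p.toExit)
    (u : EuclideanSpace ℝ (Fin codim)) (w : TangentSpace (𝓡 n) x.val),
    w = mfderiv ((𝓡 (S.dim p.stratum)).prod (𝓡 codim)) (𝓡 n) toFun (⟨x.val, hx⟩, 0)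
      ((0 : EuclideanSpace ℝ (Fin (S.dim p.stratum))), u) →
    ToricFan.Hom.realMap (fan.map f) (framing x (toNormal x w)) = coord u
  /-- the part of the neighbourhood belonging to a cone of the fan -/
  piece : PointedCone ℝ (fan.obj p.toExit).space → Set 𝓜
  piece_eq : ∀ σ, piece σ = toFun '' {q ∈ source | coord q.2 ∈ (fan.obj p.toExit).openCone σ}
  /-- the part belonging to a cone lies in a single stratum -/
  exists_stratum : ∀ σ ∈ (fan.obj p.toExit).cones, ∃ s, piece σ ⊆ S.carrier s
  /-- a cone and a proper face of it belong to different strata -/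
  ne_stratum : ∀ σ ∈ (fan.obj p.toExit).cones, ∀ τ ∈ (fan.obj p.toExit).cones, τ < σ →
    ∀ s, piece σ ⊆ S.carrier s → ¬ piece τ ⊆ S.carrier s
  /-- in the neighbourhood, the stratified set is the union of the parts belonging to the cones -/
  mem_piece : ∀ q ∈ source, (∃ s, toFun q ∈ S.carrier s) →
    ∃ σ ∈ (fan.obj p.toExit).cones, toFun q ∈ piece σ

/-- The coordinate of a tangent vector `v` at `x` given by the framing at `x`, a morphism from `x`
to `y` in the exit path category and an integral covector on the lattice at `y`. -/
def framingCoord {S : StratifiedSubset n 𝓜} {fan : S.Exit ⥤ ToricFan.{u}}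
    (framing : ∀ x : S.Point, normalSpace x ≃ₗ[ℝ] (fan.obj x.toExit).space)
    {x y : S.Point} (f : x.toExit ⟶ y.toExit) (m : Module.Dual ℤ (fan.obj y.toExit).lattice)
    (v : TangentSpace (𝓡 n) x.val) : ℝ :=
  realPairing m (ToricFan.Hom.realMap (fan.map f) (framing x (toNormal x v)))

/-- The compatibility of the functor to fans with the framings. An exit path from `p` to `y` that
starts out in the part `F'` of the neighbourhood of `p` belonging to the cone `σ` must be sent to a
morphism of fans with cone `σ`; and as points `q` of `F'` tend to `p`, the framing of the normal
bundle of `F'` (the lattices being identified with that at `y`) must tend to the framing at `p`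
followed by the quotient map `M_p → M_y = M_p / Span σ`: for each integral covector `m`, the
corresponding coordinate of a tangent vector `v` at `q` tends to that of `w`, as `(q, v)` tends to
`(p, w)` in the tangent bundle. -/
def ConicalNeighborhood.IsCompatible [IsManifold (𝓡 n) ∞ 𝓜] {S : StratifiedSubset n 𝓜} {fan : S.Exit ⥤ ToricFan.{u}}
    {framing : ∀ x : S.Point, normalSpace x ≃ₗ[ℝ] (fan.obj x.toExit).space}
    {p : S.Point} (N : ConicalNeighborhood S fan framing p) : Prop :=
  ∀ (y : S.Point) (γ : ExitPath p y), ∀ σ ∈ (fan.obj p.toExit).cones,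
    (∀ᶠ t in 𝓝[>] (0 : unitInterval), γ.path t ∈ N.piece σ) →
      ToricFan.Hom.cone (fan.map γ.toExit) = σ ∧
      ∀ (m : Module.Dual ℤ (fan.obj y.toExit).lattice) (w : TangentSpace (𝓡 n) p.val),
      ∀ ε > 0, ∀ᶠ P in 𝓝[{P : TangentBundle (𝓡 n) 𝓜 | P.proj ∈ N.piece σ}] ⟨p.val, w⟩,
        ∀ (q : S.Point) (v : TangentSpace (𝓡 n) q.val) (f : q.toExit ⟶ y.toExit),
          P = ⟨q.val, v⟩ → q.stratum = y.stratum →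
          |framingCoord framing f m v - framingCoord framing γ.toExit m w| < ε

end Tubular

/-- A fanifold in the manifold `𝓜`, with contractible strata. -/
structure Fanifold (n : ℕ) (𝓜 : Type v) [TopologicalSpace 𝓜]
    [ChartedSpace (EuclideanSpace ℝ (Fin n)) 𝓜] [IsManifold (𝓡 n) ∞ 𝓜] extends StratifiedSubset n 𝓜 where
  contractible : ∀ s, ContractibleSpace (carrier s)
  /-- the functor from exit paths to fans -/
  fan : toStratifiedSubset.Exit ⥤ ToricFan.{u}
  /-- the isomorphisms of the normal spaces with `M_F ⊗ ℝ` -/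
  framing : ∀ x : toStratifiedSubset.Point, normalSpace x ≃ₗ[ℝ] (fan.obj x.toExit).space
  conical : ∀ p, ∃ N : ConicalNeighborhood toStratifiedSubset fan framing p, N.IsCompatible

namespace Fanifold

variable {n : ℕ} {𝓜 : Type v} [TopologicalSpace 𝓜] [ChartedSpace (EuclideanSpace ℝ (Fin n)) 𝓜]
  [IsManifold (𝓡 n) ∞ 𝓜]
  (Φ : Fanifold.{u} n 𝓜) (k : Type u) [Field k]

/-- The diagram of toric varieties of a fanifold, indexed by the opposite of the exit path
category. -/
def toricDiagram : Φ.Exitᵒᵖ ⥤ Scheme.{u} := Φ.fan.op ⋙ toricFunctor k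

/-- The objects of `Exit(Φ)ᵒᵖ` that lie in one of the given strata. -/
def overStrata (s : Set Φ.Stratum) : ObjectProperty Φ.Exitᵒᵖ :=
  fun x => x.unop.point.stratum ∈ s

/-- The restriction of the diagram of toric varieties to some of the strata. -/
def restrictedDiagram (s : Set Φ.Stratum) : (Φ.overStrata s).FullSubcategory ⥤ Scheme.{u} :=
  (Φ.overStrata s).ι ⋙ Φ.toricDiagram k

/-- The toric boundary `∂T(F) ⟶ T(F)` for the stratum `F` of `x`: a reduced closed subscheme, whose
points are those of the toric varieties of the strata to which one can exit from `F`. -/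
structure IsToricBoundary (x : Φ.Exit) {B : Scheme.{u}} (j : B ⟶ (Φ.toricDiagram k).obj (op x)) :
    Prop where
  isReduced : IsReduced B
  isClosedImmersion : IsClosedImmersion j
  range_eq : Set.range j = ⋃ (y : Φ.Exit) (f : x ⟶ y) (_ : y.point.stratum ≠ x.point.stratum),
    Set.range ((Φ.toricDiagram k).map f.op)

/-- The colimit of the diagram of toric varieties of `Φ` is an iterated pushout along closed
immersions: for some enumeration `F_0, …, F_(N-1)` of the strata by increasing codimension, the
colimits `Z_i` over `F_0, …, F_(i-1)` exist, and `Z_(i+1)` is the pushout of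
`Z_i ⟵ ∂T(F_i) ⟶ T(F_i)`, where both maps are closed immersions. -/
def ColimitIsIteratedPushout : Prop :=
  ∃ (N : ℕ) (e : Fin N ≃ Φ.Stratum), (∀ i j, i ≤ j → Φ.dim (e j) ≤ Φ.dim (e i)) ∧
    ∃ Z : ∀ i : Fin (N + 1), ColimitCocone
      (Φ.restrictedDiagram k {s | (e.symm s).castSucc < i}),
    ∀ (i : Fin N) (x : Φ.Exit) (hx : x.point.stratum = e i),
      ∃ (B : Scheme.{u}) (b : B ⟶ (Z i.castSucc).cocone.pt)
        (j : B ⟶ (Φ.toricDiagram k).obj (op x))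
        (z : (Z i.castSucc).cocone.pt ⟶ (Z i.succ).cocone.pt),
        (∀ (y : Φ.Exit) (hy : (e.symm y.point.stratum).castSucc < i.castSucc),
          (Z i.castSucc).cocone.ι.app ⟨op y, hy⟩ ≫ z =
            (Z i.succ).cocone.ι.app ⟨op y, hy.trans (Fin.castSucc_lt_succ)⟩) ∧
        IsClosedImmersion b ∧ Φ.IsToricBoundary k x j ∧
        IsPushout b j z ((Z i.succ).cocone.ι.app
          ⟨op x, by
            change (e.symm x.point.stratum).castSucc < i.succ
            rw [hx, Equiv.symm_apply_apply]; exact Fin.castSucc_lt_succ⟩)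

end Fanifold

end

/-! The argument separates into a description of the exit paths, a formal statement about colimits,
and two facts about schemes.

Exit paths. Cones are closed, and a cone and a proper face of it belong to different strata, so an
exit path from `x` starts inside a single piece of a conical neighbourhood
(`exists_eventually_mem_piece`). Together with the compatibility of the functor with the pieces and
with thinness, this shows that the strata reachable from `x` correspond to the cones of the fan at
`x`, and that exit paths between them correspond to inclusions of cones (`piece_cone_subset`,
`stratum_eq_of_cone_eq`, `nonempty_hom_of_cone_le`). Leaving a stratum raises the dimension, because
a nonzero cone lies in the kernel of the quotient map (`dim_lt_of_hom`).

Colimits. Let a sieve of the opposite exit path category be enlarged by the stratum of `x`, when the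
other strata mapping to `x` are already present. The new colimit is then the pushout of the old one
and `T(x)` along the colimit over the strata mapping to `x` (`IsAttachment.isPushout`,
`IsAttachment.exists_isColimit`). It remains to see that the pushout exists, that the colimit over
the strata mapping to `x` is the toric boundary, and that both maps out of it are closed immersions.

Pushouts. A span of closed immersions has a pushout in locally ringed spaces. It is covered by the
spectra of fibre products of rings `R₁ ×_S R₂`, so it is a scheme, and its legs are closed
immersions (`exists_isPushout_of_isClosedImmersion`).

Boundary. Compatible functions on the proper orbit closures inside an affine chart glue monomial by
monomial: the coefficient of `χ^m` is read off on the orbit closure of the face on which `m`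
vanishes (`exists_orbitRingMap_eq`). Hence the reduced union of the orbit closures is their colimit
(`exists_toricBoundary`).

Finally, induction on the number of strata shows simultaneously that colimits over sieves exist and
that enlarging the sieve induces a closed immersion of colimits
(`exists_isColimit_and_isClosedImmersion`). The latter gives the closed immersion of the boundary
into `Z_i`. -/

noncomputable section

/-! ### Pullback of sections between open subsets of locally ringed spaces -/

namespace AlgebraicGeometry.LocallyRingedSpace

open TopologicalSpace

variable {X Y Z : LocallyRingedSpace.{u}}

/-- The pullback of sections along `f : X ⟶ Y` from `U ⊆ Y` to `V ⊆ f⁻¹ U`. -/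
def pullSec (f : X ⟶ Y) (U : Opens Y) (V : Opens X) (h : ∀ x ∈ V, f.base x ∈ U) :
    Y.presheaf.obj (op U) ⟶ X.presheaf.obj (op V) :=
  f.c.app (op U) ≫ X.presheaf.map (homOfLE (show V ≤ (Opens.map f.base).obj U from h)).op

/-- The preimage of an open subset. -/
abbrev preim (f : X ⟶ Y) (U : Opens Y) : Opens X := (Opens.map f.base).obj U

lemma mem_preim {f : X ⟶ Y} {U : Opens Y} {x : X} : x ∈ preim f U ↔ f.base x ∈ U := Iff.rfl

lemma preim_self (f : X ⟶ Y) (U : Opens Y) : ∀ x ∈ preim f U, f.base x ∈ U := fun _ h => h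

lemma pullSec_comp (f : X ⟶ Y) (g : Y ⟶ Z) (U : Opens Z) (V : Opens Y) (W : Opens X)
    (h : ∀ y ∈ V, g.base y ∈ U) (h' : ∀ x ∈ W, f.base x ∈ V) (h'' : ∀ x ∈ W, (f ≫ g).base x ∈ U) :
    pullSec (f ≫ g) U W h'' = pullSec g U V h ≫ pullSec f V W h' := by
  simp only [pullSec, Category.assoc]
  rw [NatTrans.naturality_assoc]
  refine (Category.assoc (g.c.app (op U)) (f.c.app _) _).trans ?_
  congr 2
  exact (X.presheaf.map_comp _ _)

lemma pullSec_comp_apply (f : X ⟶ Y) (g : Y ⟶ Z) (U : Opens Z) (V : Opens Y) (W : Opens X)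
    (h : ∀ y ∈ V, g.base y ∈ U) (h' : ∀ x ∈ W, f.base x ∈ V) (h'' : ∀ x ∈ W, (f ≫ g).base x ∈ U)
    (s : Z.presheaf.obj (op U)) :
    pullSec (f ≫ g) U W h'' s = pullSec f V W h' (pullSec g U V h s) := by
  rw [pullSec_comp f g U V W h h' h'']; rfl

lemma pullSec_congr {f g : X ⟶ Y} (hfg : f = g) (U : Opens Y) (V : Opens X)
    (h : ∀ x ∈ V, f.base x ∈ U) : pullSec f U V h = pullSec g U V (hfg ▸ h) := by
  subst hfg; rfl

lemma pullSec_res (f : X ⟶ Y) {U : Opens Y} {V V' : Opens X} (h : ∀ x ∈ V, f.base x ∈ U)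
    (i : V' ≤ V) :
    pullSec f U V h ≫ X.presheaf.map (homOfLE i).op = pullSec f U V' (fun x hx => h x (i hx)) := by
  rw [pullSec, pullSec, Category.assoc, ← X.presheaf.map_comp]
  rfl

lemma pullSec_res_apply (f : X ⟶ Y) {U : Opens Y} {V V' : Opens X} (h : ∀ x ∈ V, f.base x ∈ U)
    (i : V' ≤ V) (s : Y.presheaf.obj (op U)) :
    X.presheaf.map (homOfLE i).op (pullSec f U V h s) =
      pullSec f U V' (fun x hx => h x (i hx)) s := by
  rw [← pullSec_res f h i]; rfl

lemma res_pullSec (f : X ⟶ Y) {U U' : Opens Y} {V : Opens X} (h : ∀ x ∈ V, f.base x ∈ U')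
    (i : U' ≤ U) :
    Y.presheaf.map (homOfLE i).op ≫ pullSec f U' V h = pullSec f U V (fun x hx => i (h x hx)) := by
  rw [pullSec, pullSec, NatTrans.naturality_assoc]
  congr 1
  exact (X.presheaf.map_comp _ _).symm

lemma res_pullSec_apply (f : X ⟶ Y) {U U' : Opens Y} {V : Opens X} (h : ∀ x ∈ V, f.base x ∈ U')
    (i : U' ≤ U) (s : Y.presheaf.obj (op U)) :
    pullSec f U' V h (Y.presheaf.map (homOfLE i).op s) =
      pullSec f U V (fun x hx => i (h x hx)) s := by
  rw [← res_pullSec f h i]; rfl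

lemma pullSec_preim (f : X ⟶ Y) (U : Opens Y) :
    pullSec f U (preim f U) (preim_self _ _) = f.c.app (op U) := by
  exact (congrArg _ (X.presheaf.map_id _)).trans (Category.comp_id _)

/-- The two preimages of an open set are equal only through `hb`, so the sections are compared after
a restriction map that bridges them. -/
lemma presheafedSpace_hom_ext {X Y : PresheafedSpace CommRingCat.{u}} {f g : X ⟶ Y}
    (hb : ∀ x, f.base x = g.base x)
    (hs : ∀ (U : Opens Y) (s : Y.presheaf.obj (op U)),
      X.presheaf.map (homOfLE (show (Opens.map g.base).obj U ≤ (Opens.map f.base).obj U from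
        fun x hx => (congrArg (· ∈ U) (hb x)).mpr hx)).op (f.c.app (op U) s) = g.c.app (op U) s) :
    f = g := by
  obtain ⟨fb, fc⟩ := f
  obtain ⟨gb, gc⟩ := g
  obtain rfl : fb = gb := by ext x; exact hb x
  obtain rfl : fc = gc := by
    refine NatTrans.ext (funext fun U => ?_)
    induction U with | op U =>
    ext s
    refine Eq.trans ?_ (hs U s)
    exact (congr($(X.presheaf.map_id _) _)).symm
  rfl

lemma hom_ext_of_pullSec {f g : X ⟶ Y} (hb : ∀ x, f.base x = g.base x)
    (hs : ∀ (U : Opens Y) (s : Y.presheaf.obj (op U)),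
      pullSec f U (preim f U) (preim_self _ _) s =
        pullSec g U (preim f U) (fun x h => by rw [← hb]; exact h) s) : f = g := by
  refine Hom.ext' (presheafedSpace_hom_ext hb fun U s => ?_)
  have h := congrArg (X.presheaf.map (homOfLE (show preim g U ≤ preim f U from
    fun x hx => by rw [mem_preim, ← hb] at hx; exact hx)).op) (hs U s)
  rw [pullSec_res_apply] at h
  erw [pullSec_res_apply, pullSec_preim] at h
  exact h

end AlgebraicGeometry.LocallyRingedSpace

/-! ### Glued cocones of locally ringed spaces are colimits -/

namespace AlgebraicGeometry.LocallyRingedSpace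

open TopologicalSpace

section Quotient

variable {J : Type v} [Category.{w} J] {F : J ⥤ LocallyRingedSpace.{u}}

lemma cocone_base (c : Cocone F) {i j : J} (a : i ⟶ j) (x : F.obj i) :
    (c.ι.app j).base ((F.map a).base x) = (c.ι.app i).base x := by
  rw [← c.w a]; rfl

/-- Compatible families of sections over the members of a diagram, on the preimages of an open
subset `U` of the vertex of a cocone, come from unique sections over `U`. -/
structure SectionsGlue (c : Cocone F) (U : Opens c.pt) : Prop where
  inj : ∀ s t : c.pt.presheaf.obj (op U),
    (∀ j, pullSec (c.ι.app j) U (preim (c.ι.app j) U) (preim_self _ _) s =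
      pullSec (c.ι.app j) U (preim (c.ι.app j) U) (preim_self _ _) t) → s = t
  glue : ∀ s : ∀ j, (F.obj j).presheaf.obj (op (preim (c.ι.app j) U)),
    (∀ {i j : J} (a : i ⟶ j), pullSec (F.map a) (preim (c.ι.app j) U) (preim (c.ι.app i) U)
      (fun x hx => by rw [mem_preim, cocone_base]; exact hx) (s j) = s i) →
    ∃ t : c.pt.presheaf.obj (op U),
      ∀ j, pullSec (c.ι.app j) U (preim (c.ι.app j) U) (preim_self _ _) t = s j

/-- A cocone of locally ringed spaces whose vertex is the topological quotient of the members of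
the diagram, with the glued structure sheaf. -/
structure IsGlued (c : Cocone F) : Prop where
  surj : ∀ z : c.pt, ∃ j, ∃ x : F.obj j, (c.ι.app j).base x = z
  isOpen : ∀ U : Set c.pt, (∀ j, IsOpen ((c.ι.app j).base ⁻¹' U)) → IsOpen U
  fiber : ∀ {i j : J} (x : F.obj i) (y : F.obj j), (c.ι.app i).base x = (c.ι.app j).base y →
    ∃ (l : J) (a : l ⟶ i) (b : l ⟶ j) (z : F.obj l),
      (F.map a).base z = x ∧ (F.map b).base z = y
  sections : ∀ U, SectionsGlue c U

namespace IsGlued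

variable {c : Cocone F} (hc : IsGlued c) (s : Cocone F)

-- A point of the vertex may have many representatives, but by `fiber` any two of them come from one
-- point of some member of the diagram, so their images under a second cocone agree.
include hc in
lemma exists_map : ∃ f : c.pt → s.pt, ∀ j (x : F.obj j),
    f ((c.ι.app j).base x) = (s.ι.app j).base x := by
  choose j x hx using hc.surj
  refine ⟨fun z => (s.ι.app (j z)).base (x z), fun i y => ?_⟩
  obtain ⟨l, a, b, z, h1, h2⟩ := hc.fiber _ _ (hx ((c.ι.app i).base y))
  refine Eq.trans ?_ (congrArg _ h2)
  rw [cocone_base, ← cocone_base s a]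
  exact congrArg _ h1.symm

/-- The continuous map induced by a cocone. -/
def descBase : c.pt.toTopCat ⟶ s.pt.toTopCat :=
  TopCat.ofHom ⟨(hc.exists_map s).choose, ⟨fun U hU => hc.isOpen _ fun j => by
    have : (c.ι.app j).base ⁻¹' ((hc.exists_map s).choose ⁻¹' U) = (s.ι.app j).base ⁻¹' U := by
      ext x
      exact iff_of_eq (congrArg (· ∈ U) ((hc.exists_map s).choose_spec j x))
    rw [this]
    exact hU.preimage (s.ι.app j).base.hom.continuous⟩⟩

lemma descBase_apply (j : J) (x : F.obj j) :
    hc.descBase s ((c.ι.app j).base x) = (s.ι.app j).base x :=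
  (hc.exists_map s).choose_spec j x

lemma exists_section (U : Opens s.pt) (t : s.pt.presheaf.obj (op U)) :
    ∃ r : c.pt.presheaf.obj (op ((Opens.map (hc.descBase s)).obj U)),
      ∀ j, pullSec (c.ι.app j) _ (preim (c.ι.app j) _) (preim_self _ _) r =
        pullSec (s.ι.app j) U _ (fun x hx => by
          rw [← hc.descBase_apply]; exact hx) t := by
  refine (hc.sections _).glue (fun j => pullSec (s.ι.app j) U _ (fun x hx => by
          rw [← hc.descBase_apply]; exact hx) t) fun {i j} a => ?_
  rw [← pullSec_comp_apply (F.map a) (s.ι.app j) U _ _ _ _ (fun x hx => by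
    rw [s.w a, ← hc.descBase_apply]; exact hx)]
  rw [pullSec_congr (s.w a)]

/-- The map on sections induced by a cocone. -/
def descFun (U : Opens s.pt) (t : s.pt.presheaf.obj (op U)) :
    c.pt.presheaf.obj (op ((Opens.map (hc.descBase s)).obj U)) :=
  (hc.exists_section s U t).choose

lemma pullSec_descFun (U : Opens s.pt) (t : s.pt.presheaf.obj (op U)) (j : J) :
    pullSec (c.ι.app j) _ (preim (c.ι.app j) _) (preim_self _ _) (hc.descFun s U t) =
        pullSec (s.ι.app j) U _ (fun x hx => by
          rw [← hc.descBase_apply]; exact hx) t :=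
  (hc.exists_section s U t).choose_spec j

/-- The ring homomorphism on sections induced by a cocone. -/
def descApp (U : Opens s.pt) : s.pt.presheaf.obj (op U) →+*
    c.pt.presheaf.obj (op ((Opens.map (hc.descBase s)).obj U)) where
  toFun := hc.descFun s U
  map_one' := (hc.sections _).inj _ _ fun j => by rw [hc.pullSec_descFun]; simp
  map_zero' := (hc.sections _).inj _ _ fun j => by rw [hc.pullSec_descFun]; simp
  map_mul' a b := (hc.sections _).inj _ _ fun j => by
    rw [map_mul, hc.pullSec_descFun, hc.pullSec_descFun, hc.pullSec_descFun, map_mul]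
  map_add' a b := (hc.sections _).inj _ _ fun j => by
    rw [map_add, hc.pullSec_descFun, hc.pullSec_descFun, hc.pullSec_descFun, map_add]

/-- The morphism of presheafed spaces induced by a cocone. -/
def descHom : c.pt.toPresheafedSpace ⟶ s.pt.toPresheafedSpace where
  base := hc.descBase s
  c :=
    { app := fun U => CommRingCat.ofHom (hc.descApp s U.unop)
      naturality := fun U V i => by
        induction U with | op U =>
        induction V with | op V =>
        have i' : V ≤ U := leOfHom i.unop
        obtain rfl : i = (homOfLE i').op := rfl
        ext t
        refine (hc.sections _).inj _ _ fun j => ?_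
        change pullSec _ _ _ _ (hc.descFun s V _) =
          pullSec _ _ _ _ (c.pt.presheaf.map (homOfLE _).op (hc.descFun s U t))
        refine (hc.pullSec_descFun s V _ j).trans ?_
        refine (res_pullSec_apply (s.ι.app j) _ i' t).trans ?_
        refine Eq.trans ?_ (res_pullSec_apply (c.ι.app j) _ _ (hc.descFun s U t)).symm
        have := hc.pullSec_descFun s U t j
        have h2 := congrArg ((F.obj j).presheaf.map (homOfLE (show
          preim (c.ι.app j) ((Opens.map (hc.descBase s)).obj V) ≤
          preim (c.ι.app j) ((Opens.map (hc.descBase s)).obj U) from fun x hx => i' hx)).op) this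
        exact ((pullSec_res_apply _ _ _ _).symm.trans
          (h2.trans (pullSec_res_apply _ _ _ _))).symm }

lemma ι_comp_descHom (j : J) : (c.ι.app j).toHom ≫ hc.descHom s = (s.ι.app j).toHom := by
  refine presheafedSpace_hom_ext (hc.descBase_apply s j) fun U t => ?_
  have h2 := congrArg ((F.obj j).presheaf.map (homOfLE (show
    preim (s.ι.app j) U ≤ preim (c.ι.app j) ((Opens.map (hc.descBase s)).obj U) from
      fun x hx => (congrArg (· ∈ U) (hc.descBase_apply s j x)).mpr hx)).op) (hc.pullSec_descFun s U t j)
  refine Eq.trans ?_ (h2.trans ((pullSec_res_apply _ _ _ _).trans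
    congr($(pullSec_preim (s.ι.app j) U) t)))
  exact congrArg ((F.obj j).presheaf.map _) (congr($(pullSec_preim (c.ι.app j) _) _)).symm

/-- The morphism of locally ringed spaces induced by a cocone. -/
def desc : c.pt ⟶ s.pt where
  toHom := hc.descHom s
  prop z := by
    -- Locality of the stalk map may be tested after composing with the stalk map of a leg of `c`;
    -- the composite is the stalk map of a leg of `s`, up to an isomorphism.
    obtain ⟨j, x, rfl⟩ := hc.surj z
    have h1 := PresheafedSpace.stalkMap.comp (c.ι.app j).toHom (hc.descHom s) x
    rw [PresheafedSpace.stalkMap.congr_hom _ _ (hc.ι_comp_descHom s j) x] at h1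
    set φ := (hc.descHom s).stalkMap ((c.ι.app j).base x)
    have : IsLocalHom (((c.ι.app j).toHom.stalkMap x).hom.comp φ.hom) := by
      rw [← CommRingCat.hom_comp]
      refine (congrArg (fun f => IsLocalHom f.hom) h1).mp ?_
      have := (s.ι.app j).prop x
      rw [CommRingCat.hom_comp]
      exact RingHom.isLocalHom_comp _ _
    exact isLocalHom_of_comp φ.hom ((c.ι.app j).toHom.stalkMap x).hom

lemma ι_desc (j : J) : c.ι.app j ≫ hc.desc s = s.ι.app j :=
  LocallyRingedSpace.Hom.ext' (hc.ι_comp_descHom s j)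

/-- A cocone that glues the topology and the structure sheaves is a colimit cocone. -/
def isColimit : IsColimit c where
  desc := hc.desc
  fac := hc.ι_desc
  uniq s m hm := by
    have hb : ∀ z, m.base z = (hc.desc s).base z := fun z => by
      obtain ⟨j, x, rfl⟩ := hc.surj z
      have h1 : ∀ f : c.pt ⟶ s.pt, f.base ((c.ι.app j).base x) = (c.ι.app j ≫ f).base x :=
        fun f => rfl
      rw [h1, h1, hm, hc.ι_desc]
    refine hom_ext_of_pullSec hb fun U t => (hc.sections _).inj _ _ fun j => ?_
    refine (pullSec_comp_apply (c.ι.app j) m U (preim m U) _ (preim_self _ _) (preim_self _ _)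
      (preim_self (c.ι.app j ≫ m) U) t).symm.trans ?_
    refine congr($(pullSec_congr ((hm j).trans (hc.ι_desc s j).symm) U _ _) t).trans ?_
    exact pullSec_comp_apply (c.ι.app j) (hc.desc s) U (preim m U) _ _ (preim_self _ _) _ t

end IsGlued

end Quotient

end AlgebraicGeometry.LocallyRingedSpace

/-! ### Gluing on a basis, and the structure of colimits of locally ringed spaces -/

namespace AlgebraicGeometry.LocallyRingedSpace

open TopologicalSpace

section Basis

variable {J : Type v} [Category.{w} J] {F : J ⥤ LocallyRingedSpace.{u}}

lemma eq_of_locally_eq {X : LocallyRingedSpace.{u}} {U : Opens X}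
    (s t : X.presheaf.obj (op U))
    (h : ∀ x ∈ U, ∃ (V : Opens X) (i : V ≤ U), x ∈ V ∧
      X.presheaf.map (homOfLE i).op s = X.presheaf.map (homOfLE i).op t) : s = t := by
  choose V i hx hV using fun x : U => h x.1 x.2
  exact X.sheaf.eq_of_locally_eq' V U (fun x => homOfLE (i x))
    (fun x hx' => Opens.mem_iSup.mpr ⟨⟨x, hx'⟩, hx _⟩) s t hV

/-- Uniqueness is local, so it passes from a basis to all open sets. It then makes the sections
found on the basic open sets agree on overlaps, and the sheaf property assembles them. -/
lemma SectionsGlue.of_basis {c : Cocone F}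
    (hB : ∀ (U : Opens c.pt), ∀ z ∈ U, ∃ V ≤ U, z ∈ V ∧ SectionsGlue c V)
    (U : Opens c.pt) : SectionsGlue c U := by
  have hinj : ∀ (U : Opens c.pt) (s t : c.pt.presheaf.obj (op U)),
      (∀ j, pullSec (c.ι.app j) U (preim (c.ι.app j) U) (preim_self _ _) s =
        pullSec (c.ι.app j) U (preim (c.ι.app j) U) (preim_self _ _) t) → s = t := by
    intro U s t hst
    refine eq_of_locally_eq s t fun z hz => ?_
    obtain ⟨V, hVU, hzV, hV⟩ := hB U z hz
    refine ⟨V, hVU, hzV, hV.inj _ _ fun j => ?_⟩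
    have h1 := congrArg ((F.obj j).presheaf.map
      (homOfLE (show preim (c.ι.app j) V ≤ preim (c.ι.app j) U from fun x hx => hVU hx)).op) (hst j)
    refine (res_pullSec_apply _ _ hVU s).trans (Eq.trans ?_ (res_pullSec_apply _ _ hVU t).symm)
    exact (pullSec_res_apply _ _ _ _).symm.trans (h1.trans (pullSec_res_apply _ _ _ _))
  refine ⟨hinj U, fun s hs => ?_⟩
  choose V hVU hzV hV using fun z : U => hB U z.1 z.2
  have hle : ∀ (z : U) (j : J), preim (c.ι.app j) (V z) ≤ preim (c.ι.app j) U :=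
    fun z j x hx => hVU z hx
  have hloc : ∀ z : U, ∃ t : c.pt.presheaf.obj (op (V z)), ∀ j,
      pullSec (c.ι.app j) (V z) (preim (c.ι.app j) (V z)) (preim_self _ _) t =
        (F.obj j).presheaf.map (homOfLE (hle z j)).op (s j) := by
    intro z
    refine (hV z).glue (fun j => (F.obj j).presheaf.map (homOfLE (hle z j)).op (s j))
      fun {i j} a => ?_
    rw [← hs a]
    exact (res_pullSec_apply _ _ _ _).trans (pullSec_res_apply _ _ _ _).symm
  choose t ht using hloc
  obtain ⟨r, hr, -⟩ := c.pt.sheaf.existsUnique_gluing' V U (fun z => homOfLE (hVU z))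
    (fun z hz => Opens.mem_iSup.mpr ⟨⟨z, hz⟩, hzV _⟩) t fun z z' => by
      refine hinj _ _ _ fun j => ?_
      have key : ∀ (z : U) (W : Opens c.pt) (i : W ≤ V z),
          pullSec (c.ι.app j) W (preim (c.ι.app j) W) (preim_self _ _)
            (c.pt.presheaf.map (homOfLE i).op (t z)) =
          (F.obj j).presheaf.map (homOfLE (show preim (c.ι.app j) W ≤ preim (c.ι.app j) U from
            fun x hx => hVU z (i hx))).op (s j) := by
        intro z W i
        have h1 := congrArg ((F.obj j).presheaf.map
          (homOfLE (show preim (c.ι.app j) W ≤ preim (c.ι.app j) (V z) from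
            fun x hx => i hx)).op) (ht z j)
        refine (res_pullSec_apply _ _ i _).trans
          ((pullSec_res_apply _ _ _ _).symm.trans (h1.trans ?_))
        rw [← ConcreteCategory.comp_apply, ← Functor.map_comp]
        rfl
      exact (key z _ inf_le_left).trans (key z' _ inf_le_right).symm
  refine ⟨r, fun j => eq_of_locally_eq _ _ fun x hx => ?_⟩
  refine ⟨preim (c.ι.app j) (V ⟨_, hx⟩), hle _ j, hzV ⟨_, hx⟩, ?_⟩
  refine Eq.trans ?_ (ht ⟨_, hx⟩ j)
  rw [← hr ⟨_, hx⟩]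
  exact (pullSec_res_apply _ _ _ _).trans (res_pullSec_apply _ _ _ _).symm

end Basis

section Colimit

variable {J : Type} [SmallCategory J] 

/-- The sections over an open subset of a colimit of presheafed spaces are the limit of the sections
over its preimages. This is the uniqueness half of that description; the next lemma is the existence
half. -/
lemma presheafedSpace_colimit_ext (G : J ⥤ PresheafedSpace.{u, u+1, u} CommRingCat.{u})
    (U : Opens (colimit G).carrier)
    (s t : (colimit G).presheaf.obj (op U))
    (h : ∀ j, (colimit.ι G j).c.app (op U) s = (colimit.ι G j).c.app (op U) t) : s = t := by
  have : Function.Injective (PresheafedSpace.colimitPresheafObjIsoComponentwiseLimit G U).hom := 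
    ((ConcreteCategory.isIso_iff_bijective _).mp inferInstance).1
  apply this
  apply Concrete.limit_ext
  intro j
  have := h j.unop
  rw [← PresheafedSpace.colimitPresheafObjIsoComponentwiseLimit_hom_π] at this
  exact this

lemma presheafedSpace_colimit_exists (G : J ⥤ PresheafedSpace.{u, u+1, u} CommRingCat.{u})
    (U : Opens (colimit G).carrier)
    (s : ∀ j, (G.obj j).presheaf.obj (op ((Opens.map (colimit.ι G j).base).obj U)))
    (hs : ∀ {i j : J} (a : i ⟶ j), (PresheafedSpace.componentwiseDiagram G U).map a.op (s j) = s i) :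
    ∃ t : (colimit G).presheaf.obj (op U), ∀ j, (colimit.ι G j).c.app (op U) t = s j := by
  let D := PresheafedSpace.componentwiseDiagram G U
  let e := Types.isLimitEquivSections (isLimitOfPreserves (forget CommRingCat) (limit.isLimit D))
  let x : (limit D : CommRingCat.{u}) := e.symm ⟨fun j => s j.unop, fun {i j} a => hs a.unop⟩
  have hx : ∀ j, limit.π D j x = s j.unop := fun j => by
    have := congrArg (fun y => y.1 j) (e.apply_symm_apply ⟨fun j => s j.unop, fun {i j} a => hs a.unop⟩)
    exact this
  refine ⟨(PresheafedSpace.colimitPresheafObjIsoComponentwiseLimit G U).inv x, fun j => ?_⟩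
  have := hx (op j)
  rw [← PresheafedSpace.colimitPresheafObjIsoComponentwiseLimit_inv_ι_app] at this
  exact this

variable {F : J ⥤ LocallyRingedSpace.{u}} {c : Cocone F} (hc : IsColimit c)


instance : PreservesColimit F forgetToSheafedSpace :=
  (preservesSmallestColimits_of_preservesColimits forgetToSheafedSpace).1.1

instance : PreservesColimit F (forgetToSheafedSpace ⋙ SheafedSpace.forgetToPresheafedSpace) := 
  comp_preservesColimit _ _

instance : PreservesColimit F forgetToTop :=
  comp_preservesColimit forgetToSheafedSpace (SheafedSpace.forget _)

lemma presheafedSpace_c_app_of_comp_eq {X Y Z : PresheafedSpace.{u, u+1, u} CommRingCat.{u}}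
    {f : X ⟶ Y} {g : Y ⟶ Z} {l : X ⟶ Z} (h : f ≫ g = l) (U : Opens Z)
    (i : (Opens.map l.base).obj U ≤ (Opens.map f.base).obj ((Opens.map g.base).obj U))
    (t : Z.presheaf.obj (op U)) :
    l.c.app (op U) t = X.presheaf.map (homOfLE i).op (f.c.app _ (g.c.app _ t)) := by
  subst h
  exact congr($(X.presheaf.map_id _) _).symm

include hc in
lemma surj_of_isColimit (z : c.pt) : ∃ j, ∃ x : F.obj j, (c.ι.app j).base x = z :=
  Concrete.isColimit_exists_rep (F ⋙ forgetToTop) (isColimitOfPreserves forgetToTop hc) z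

include hc in
lemma isOpen_of_isColimit (U : Set c.pt) (h : ∀ j, IsOpen ((c.ι.app j).base ⁻¹' U)) : IsOpen U := 
  (TopCat.isOpen_iff_of_isColimit _ (isColimitOfPreserves forgetToTop hc) U).mpr h

-- The forgetful functor to presheafed spaces preserves this colimit, and there sections over an
-- open set form a limit. The rest is transport along the comparison isomorphism `e`, under which
-- preimages of `U` agree only propositionally.
include hc in
lemma sectionsGlue_of_isColimit (U : Opens c.pt) : SectionsGlue c U := by
  let Φ := forgetToSheafedSpace ⋙ SheafedSpace.forgetToPresheafedSpace (C := CommRingCat.{u})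
  let e : colimit (F ⋙ Φ) ≅ Φ.obj c.pt :=
    (colimit.isColimit (F ⋙ Φ)).coconePointUniqueUpToIso (isColimitOfPreserves Φ hc)
  have he : ∀ j, colimit.ι (F ⋙ Φ) j ≫ e.hom = (c.ι.app j).toHom :=
    fun j => (colimit.isColimit (F ⋙ Φ)).comp_coconePointUniqueUpToIso_hom _ j
  have heb : ∀ j (x : F.obj j), e.hom.base ((colimit.ι (F ⋙ Φ) j).base x) = (c.ι.app j).base x :=
    fun j x => congr($(he j).base x)
  have hbij : Function.Bijective (e.hom.c.app (op U)) := by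
    have := PresheafedSpace.c_isIso_of_iso e.hom
    exact (ConcreteCategory.isIso_iff_bijective _).mp inferInstance
  let W := (Opens.map e.hom.base).obj U
  have hle : ∀ j, preim (c.ι.app j) U ≤ (Opens.map (colimit.ι (F ⋙ Φ) j).base).obj W :=
    fun j x hx => (congrArg (· ∈ U) (heb j x)).mpr hx
  have hle' : ∀ j, (Opens.map (colimit.ι (F ⋙ Φ) j).base).obj W ≤ preim (c.ι.app j) U :=
    fun j x hx => (congrArg (· ∈ U) (heb j x)).mp hx
  have key : ∀ j (t : c.pt.presheaf.obj (op U)),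
      pullSec (c.ι.app j) U (preim (c.ι.app j) U) (preim_self _ _) t =
        (F.obj j).presheaf.map (homOfLE (hle j)).op
          ((colimit.ι (F ⋙ Φ) j).c.app (op W) (e.hom.c.app (op U) t)) := by
    intro j t
    rw [pullSec_preim]
    exact presheafedSpace_c_app_of_comp_eq (he j) U (hle j) t
  have hcancel : ∀ j (V V' : Opens (F.obj j)) (i : V ≤ V') (i' : V' ≤ V)
      (s : (F.obj j).presheaf.obj (op V)), 
      (F.obj j).presheaf.map (homOfLE i).op ((F.obj j).presheaf.map (homOfLE i').op s) = s := by
    intro j V V' i i' s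
    rw [← ConcreteCategory.comp_apply, ← Functor.map_comp]
    exact congr($((F.obj j).presheaf.map_id _) s)
  constructor
  · intro s t hst
    refine hbij.1 (presheafedSpace_colimit_ext (F ⋙ Φ) W _ _ fun j => ?_)
    have h := hst j
    rw [key, key] at h
    have := congrArg ((F.obj j).presheaf.map (homOfLE (hle' j)).op) h
    exact (hcancel _ _ _ _ _ _).symm.trans (this.trans (hcancel _ _ _ _ _ _))
  · intro s hs
    obtain ⟨t, ht⟩ := presheafedSpace_colimit_exists (F ⋙ Φ) W
      (fun j => (F.obj j).presheaf.map (homOfLE (hle' j)).op (s j)) (fun {i j} a => by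
        rw [← hs a]
        refine Eq.trans ?_ (pullSec_res_apply (F.map a) _ (hle' i) (s j)).symm
        exact res_pullSec_apply (F.map a) (V := (Opens.map (colimit.ι (F ⋙ Φ) i).base).obj W)
          (fun x hx => hle j (show (F.map a).base x ∈ preim (c.ι.app j) U by
            rw [mem_preim, cocone_base]; exact hle' i hx)) (hle' j) (s j))
    obtain ⟨r, rfl⟩ := hbij.2 t
    refine ⟨r, fun j => ?_⟩
    refine (key j r).trans ?_
    rw [ht]
    exact hcancel _ _ _ _ _ _

/-- For an injective span, the fibres of a colimit of locally ringed spaces are as expected. -/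
lemma fiber_of_isPushout {X Y Z : LocallyRingedSpace.{u}} {f : X ⟶ Y} {g : X ⟶ Z}
    (hf : Function.Injective f.base) (hg : Function.Injective g.base)
    {P : LocallyRingedSpace.{u}} {i : Y ⟶ P} {j : Z ⟶ P} (h : IsPushout f g i j) :
    Function.Injective i.base ∧ Function.Injective j.base ∧
      ∀ y z, i.base y = j.base z → ∃ x, f.base x = y ∧ g.base x = z := by
  -- Taking underlying sets preserves the pushout, so the claims are those for a pushout of sets
  -- along injections.
  let Φ : LocallyRingedSpace.{u} ⥤ Type u := forgetToTop ⋙ forget TopCat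
  have : PreservesColimit (span f g) Φ := comp_preservesColimit _ _
  have h := h.map Φ
  exact ⟨Types.pushoutCocone_inr_injective_of_isColimit h.flip.isColimit hg,
    Types.pushoutCocone_inr_injective_of_isColimit h.isColimit hf,
    fun y z => (Types.pushoutCocone_inl_eq_inr_iff_of_isColimit h.isColimit hf y z).mp⟩

end Colimit

end AlgebraicGeometry.LocallyRingedSpace

/-! ### Localization of gluing conditions on affine open subsets -/

namespace AlgebraicGeometry

open TopologicalSpace

section Localize

variable {X : Scheme.{u}} {U V : X.Opens} (hU : IsAffineOpen U) (f : Γ(X, U)) (i : V ≤ U)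
  (e : V = X.basicOpen f)

-- Denominators are cleared for every sufficiently large exponent, so that one exponent can be
-- chosen for all members of a finite diagram.
include hU e in
lemma exists_pow_mul_eq_res (s : Γ(X, V)) :
    ∃ n, ∀ m ≥ n, ∃ r : Γ(X, U), X.presheaf.map (homOfLE i).op r =
      X.presheaf.map (homOfLE i).op f ^ m * s := by
  let _ := (X.presheaf.map (homOfLE i).op).hom.toAlgebra
  have := hU.isLocalization_of_eq_basicOpen f (homOfLE i) e
  obtain ⟨⟨r, ⟨_, n, rfl⟩⟩, hr⟩ := IsLocalization.surj (Submonoid.powers f) s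
  refine ⟨n, fun m hm => ⟨f ^ (m - n) * r, ?_⟩⟩
  have hr : s * X.presheaf.map (homOfLE i).op (f ^ n) = X.presheaf.map (homOfLE i).op r := hr
  rw [map_mul, ← hr, map_pow, map_pow, mul_comm s, ← mul_assoc, ← pow_add, Nat.sub_add_cancel hm]

include hU e in
lemma exists_pow_mul_eq_zero (r : Γ(X, U)) (hr : X.presheaf.map (homOfLE i).op r = 0) :
    ∃ n, ∀ m ≥ n, f ^ m * r = 0 := by
  let _ := (X.presheaf.map (homOfLE i).op).hom.toAlgebra
  have := hU.isLocalization_of_eq_basicOpen f (homOfLE i) e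
  obtain ⟨⟨_, n, rfl⟩, hn⟩ := (IsLocalization.map_eq_zero_iff (Submonoid.powers f) Γ(X, V) r).mp hr
  refine ⟨n, fun m hm => ?_⟩
  rw [← Nat.sub_add_cancel hm, pow_add, mul_assoc]
  exact mul_eq_zero_of_right _ hn

include hU e in
lemma isUnit_res_of_eq_basicOpen : IsUnit (X.presheaf.map (homOfLE i).op f) := by
  let _ := (X.presheaf.map (homOfLE i).op).hom.toAlgebra
  have := hU.isLocalization_of_eq_basicOpen f (homOfLE i) e
  exact IsLocalization.Away.algebraMap_isUnit (S := Γ(X, V)) f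

end Localize

lemma exists_uniform_bound {ι : Type*} [Finite ι] {p : ι → ℕ → Prop}
    (h : ∀ i, ∃ n, ∀ m ≥ n, p i m) : ∃ n, ∀ i, p i n := by
  choose n hn using h
  obtain ⟨N, hN⟩ := (Set.finite_range n).bddAbove
  exact ⟨N, fun i => hn i N (hN ⟨i, rfl⟩)⟩

section Sections

variable {J : Type v} [Category.{w} J] {F : J ⥤ Scheme.{u}} (c : Cocone F)

lemma Scheme.cocone_preimage_le (U : c.pt.Opens) {i j : J} (a : i ⟶ j) :
    c.ι.app i ⁻¹ᵁ U ≤ F.map a ⁻¹ᵁ c.ι.app j ⁻¹ᵁ U := by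
  rw [← Scheme.Hom.comp_preimage, c.w]

lemma Scheme.cocone_appLE_app (U : c.pt.Opens) {i j : J} (a : i ⟶ j) (t : Γ(c.pt, U)) :
    (F.map a).appLE _ _ (Scheme.cocone_preimage_le c U a) ((c.ι.app j).app U t) =
      (c.ι.app i).app U t := by
  have h : ∀ {f : F.obj i ⟶ c.pt} (hf : F.map a ≫ c.ι.app j = f)
      (e : f ⁻¹ᵁ U ≤ F.map a ⁻¹ᵁ c.ι.app j ⁻¹ᵁ U),
      (c.ι.app j).app U ≫ (F.map a).appLE _ _ e = f.app U := by
    rintro _ rfl e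
    refine (Scheme.Hom.comp_appLE (F.map a) (c.ι.app j) U _ e).symm.trans ?_
    rw [Scheme.Hom.app_eq_appLE]
  exact congr($(h (c.w a) _) t)

/-- Compatible families of sections over the members of a diagram of schemes, on the preimages of
an open subset `U` of the vertex of a cocone, come from unique sections over `U`. -/
structure Scheme.SectionsGlue (U : c.pt.Opens) : Prop where
  inj : ∀ s : Γ(c.pt, U), (∀ j, (c.ι.app j).app U s = 0) → s = 0
  glue : ∀ s : ∀ j, Γ(F.obj j, c.ι.app j ⁻¹ᵁ U),
    (∀ {i j : J} (a : i ⟶ j), (F.map a).appLE _ _ (Scheme.cocone_preimage_le c U a) (s j) = s i) →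
    ∃ t : Γ(c.pt, U), ∀ j, (c.ι.app j).app U t = s j

variable {c}

lemma Scheme.SectionsGlue.toLocallyRingedSpace {U : c.pt.Opens} (h : Scheme.SectionsGlue c U) :
    LocallyRingedSpace.SectionsGlue (Scheme.forgetToLocallyRingedSpace.mapCocone c) U := by
  have key : ∀ j (t : Γ(c.pt, U)), LocallyRingedSpace.pullSec (X := (F.obj j).1) (Y := c.pt.1)
      (c.ι.app j).toLRSHom U (LocallyRingedSpace.preim (c.ι.app j).toLRSHom U)
        (LocallyRingedSpace.preim_self _ _) t = (c.ι.app j).app U t := fun j t =>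
    congr($(LocallyRingedSpace.pullSec_preim (c.ι.app j).toLRSHom U) t)
  refine ⟨fun s t hst => ?_, fun s hs => ?_⟩
  · refine sub_eq_zero.mp (h.inj (s - t) fun j => ?_)
    exact (map_sub ((c.ι.app j).app U).hom s t).trans
      (sub_eq_zero.mpr ((key j s).symm.trans ((hst j).trans (key j t))))
  · obtain ⟨t, ht⟩ := h.glue s fun a => hs a
    exact ⟨t, fun j => (key j t).trans (ht j)⟩

/-- The gluing condition says that the sections over `U` are a finite limit, and localization at `f`
preserves finite limits. Concretely, denominators are cleared uniformly, the cleared sections are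
glued over `U`, and the result is divided by a power of `f`. -/
lemma Scheme.SectionsGlue.basicOpen [Finite J] [∀ i j : J, Finite (i ⟶ j)]
    [∀ j, IsAffineHom (c.ι.app j)] {U : c.pt.Opens} (hU : IsAffineOpen U)
    (h : Scheme.SectionsGlue c U) (f : Γ(c.pt, U)) :
    Scheme.SectionsGlue c (c.pt.basicOpen f) := by
  have hV : ∀ j, IsAffineOpen (c.ι.app j ⁻¹ᵁ U) := fun j => hU.preimage (c.ι.app j)
  have hD := c.pt.basicOpen_le f
  let V : ∀ j, (F.obj j).Opens := fun j => c.ι.app j ⁻¹ᵁ c.pt.basicOpen f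
  have hVle : ∀ j, V j ≤ c.ι.app j ⁻¹ᵁ U := fun j x hx => hD hx
  have hVe : ∀ j, V j = (F.obj j).basicOpen ((c.ι.app j).app U f) :=
    fun j => Scheme.preimage_basicOpen (c.ι.app j) f
  have hres : ∀ j (r : Γ(c.pt, U)), (c.ι.app j).app (c.pt.basicOpen f)
      (c.pt.presheaf.map (homOfLE hD).op r) =
      (F.obj j).presheaf.map (homOfLE (hVle j)).op ((c.ι.app j).app U r) := fun j r =>
    congr($((c.ι.app j).naturality (homOfLE hD).op) r)
  have hfu := isUnit_res_of_eq_basicOpen hU f hD rfl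
  constructor
  · intro s hs
    obtain ⟨n, hn⟩ := exists_pow_mul_eq_res hU f hD rfl s
    obtain ⟨r, hr⟩ := hn n le_rfl
    obtain ⟨M, hM⟩ := exists_uniform_bound fun j => exists_pow_mul_eq_zero (hV j)
      ((c.ι.app j).app U f) (hVle j) (hVe j) ((c.ι.app j).app U r)
      (by rw [← hres, hr, map_mul, hs, mul_zero])
    have h0 : f ^ M * r = 0 := h.inj _ fun j => by rw [map_mul, map_pow, hM]
    have h1 := congrArg (c.pt.presheaf.map (homOfLE hD).op) h0
    rw [map_mul, map_pow, hr, map_zero, ← mul_assoc, ← pow_add] at h1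
    exact (hfu.pow _).mul_right_eq_zero.mp h1
  · intro s hs
    obtain ⟨n, hn⟩ := exists_uniform_bound fun j => exists_pow_mul_eq_res (hV j)
      ((c.ι.app j).app U f) (hVle j) (hVe j) (s j)
    choose r hr using hn
    have hFa : ∀ {i j : J} (a : i ⟶ j) (t : Γ(c.pt, U)),
        (F.map a).appLE _ _ (Scheme.cocone_preimage_le c U a) ((c.ι.app j).app U t) =
          (c.ι.app i).app U t := Scheme.cocone_appLE_app c U
    have hFres : ∀ {i j : J} (a : i ⟶ j) (t : Γ(F.obj j, c.ι.app j ⁻¹ᵁ U)),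
        (F.obj i).presheaf.map (homOfLE (hVle i)).op
          ((F.map a).appLE _ _ (Scheme.cocone_preimage_le c U a) t) =
        (F.map a).appLE _ _ (Scheme.cocone_preimage_le c _ a)
          ((F.obj j).presheaf.map (homOfLE (hVle j)).op t) := fun {i j} a t => by
      have h1 := (F.map a).appLE_map (Scheme.cocone_preimage_le c U a) (homOfLE (hVle i)).op
      have h2 := (F.map a).map_appLE (Scheme.cocone_preimage_le c _ a) (homOfLE (hVle j)).op
      exact congr($(h1.trans h2.symm) t)
    -- The cleared sections `r` are compatible only after restriction to the basic open sets. One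
    -- further power of `f`, uniform over the finitely many morphisms, kills all the discrepancies.
    obtain ⟨M, hM⟩ := exists_uniform_bound (ι := Σ i j : J, (i ⟶ j)) fun a =>
      exists_pow_mul_eq_zero (hV a.1) ((c.ι.app a.1).app U f) (hVle a.1) (hVe a.1)
      ((F.map a.2.2).appLE _ _ (Scheme.cocone_preimage_le c U a.2.2) (r a.2.1) - r a.1) (by
        rw [map_sub, hFres, hr, hr, map_mul, hs, map_pow, ← hFres, hFa, sub_self])
    obtain ⟨t, ht⟩ := h.glue (fun j => (c.ι.app j).app U f ^ M * r j) fun {i j} a => by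
      have := hM ⟨i, j, a⟩
      rw [mul_sub, sub_eq_zero] at this
      rw [map_mul, map_pow, hFa, this]
    obtain ⟨w, hw⟩ := hfu.exists_right_inv
    -- Here `n` accounts for clearing the denominators and `M` for forcing compatibility; `w` is the
    -- inverse of `f` on the basic open set.
    refine ⟨c.pt.presheaf.map (homOfLE hD).op t * w ^ (M + n), fun j => ?_⟩
    have hw' := congrArg ((c.ι.app j).app (c.pt.basicOpen f)) hw
    rw [map_mul, map_one, hres] at hw'
    rw [map_mul, map_pow, hres, ht, map_mul, map_pow, hr, ← mul_assoc, ← pow_add,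
      mul_right_comm, ← mul_pow, hw', one_pow, one_mul]

end Sections

end AlgebraicGeometry

/-! ### Spectra of fibre products of rings as pushouts -/

namespace AlgebraicGeometry

open TopologicalSpace

lemma Scheme.isGlued {J : Type v} [Category.{w} J] {F : J ⥤ Scheme.{u}} {c : Cocone F}
    (surj : ∀ z : c.pt, ∃ j, ∃ x : F.obj j, c.ι.app j x = z)
    (isOpen : ∀ U : Set c.pt, (∀ j, IsOpen (c.ι.app j ⁻¹' U)) → IsOpen U)
    (fiber : ∀ {i j : J} (x : F.obj i) (y : F.obj j), c.ι.app i x = c.ι.app j y →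
      ∃ (l : J) (a : l ⟶ i) (b : l ⟶ j) (z : F.obj l), F.map a z = x ∧ F.map b z = y)
    (sections : ∀ (U : c.pt.Opens), ∀ z ∈ U, ∃ V ≤ U, z ∈ V ∧ Scheme.SectionsGlue c V) :
    LocallyRingedSpace.IsGlued (Scheme.forgetToLocallyRingedSpace.mapCocone c) where
  surj := surj
  isOpen := isOpen
  fiber := fiber
  sections := LocallyRingedSpace.SectionsGlue.of_basis fun U z hz => by
    obtain ⟨V, hVU, hzV, hV⟩ := sections U z hz
    exact ⟨V, hVU, hzV, hV.toLocallyRingedSpace⟩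

/-- If the members of a finite diagram are affine over the vertex of a cocone, which has an affine
open cover over which sections glue, then sections glue over all small open subsets. -/
lemma Scheme.SectionsGlue.exists_le {J : Type v} [Category.{w} J] [Finite J]
    [∀ i j : J, Finite (i ⟶ j)] {F : J ⥤ Scheme.{u}} {c : Cocone F}
    [∀ j, IsAffineHom (c.ι.app j)]
    (h : ∀ z : c.pt, ∃ V : c.pt.Opens, IsAffineOpen V ∧ z ∈ V ∧ Scheme.SectionsGlue c V)
    (U : c.pt.Opens) (z : c.pt) (hz : z ∈ U) :
    ∃ V ≤ U, z ∈ V ∧ Scheme.SectionsGlue c V := by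
  obtain ⟨V, hV, hzV, hs⟩ := h z
  obtain ⟨f, hf, hzf⟩ := hV.exists_basicOpen_le ⟨z, hz⟩ hzV
  exact ⟨_, hf, hzf, hs.basicOpen hV f⟩

section AffinePushout

variable {R R₁ R₂ S : CommRingCat.{u}} {p₁ : R ⟶ R₁} {p₂ : R ⟶ R₂} {q₁ : R₁ ⟶ S} {q₂ : R₂ ⟶ S}

lemma mem_range_SpecMap_of_surjective {A B : CommRingCat.{u}} {f : A ⟶ B}
    (hf : Function.Surjective f) {x : Spec A} :
    x ∈ Set.range (Spec.map f) ↔ ∀ a, f a = 0 → a ∈ x.asIdeal := by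
  exact Set.ext_iff.mp (range_comap_of_surjective _ f.hom hf) x

/-- The hypotheses say that `R` is the fibre product of `R₁` and `R₂` over `S`. The kernels of `p₁`
and `p₂` have product zero, so `Spec R` is the union of the closed subsets `Spec R₁` and `Spec R₂`;
their sum is the kernel of `R ⟶ S`, so these subsets meet in `Spec S`. Gluing of global sections is
the fibre product property itself. -/
lemma affinePushout_isGlued (w : p₁ ≫ q₁ = p₂ ≫ q₂)
    (hinj : ∀ x, p₁ x = 0 → p₂ x = 0 → x = 0)
    (hex : ∀ a b, q₁ a = q₂ b → ∃ x, p₁ x = a ∧ p₂ x = b)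
    (h₁ : Function.Surjective q₁) (h₂ : Function.Surjective q₂) :
    LocallyRingedSpace.IsGlued (Scheme.forgetToLocallyRingedSpace.mapCocone
      (PushoutCocone.mk (Spec.map p₁) (Spec.map p₂)
        (show Spec.map q₁ ≫ Spec.map p₁ = Spec.map q₂ ≫ Spec.map p₂ by
          rw [← Spec.map_comp, ← Spec.map_comp, w]))) := by
  set c := PushoutCocone.mk (Spec.map p₁) (Spec.map p₂)
        (show Spec.map q₁ ≫ Spec.map p₁ = Spec.map q₂ ≫ Spec.map p₂ by
          rw [← Spec.map_comp, ← Spec.map_comp, w]) with hc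
  have hp₁ : Function.Surjective p₁ := fun a => by
    obtain ⟨b, hb⟩ := h₂ (q₁ a)
    obtain ⟨x, hx, -⟩ := hex a b hb.symm
    exact ⟨x, hx⟩
  have hp₂ : Function.Surjective p₂ := fun b => by
    obtain ⟨a, ha⟩ := h₁ (q₂ b)
    obtain ⟨x, -, hx⟩ := hex a b ha
    exact ⟨x, hx⟩
  have hw : ∀ x, q₁ (p₁ x) = q₂ (p₂ x) := fun x => congr($w x)
  have c₁ := IsClosedImmersion.spec_of_surjective p₁ hp₁
  have c₂ := IsClosedImmersion.spec_of_surjective p₂ hp₂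
  have c₃ := IsClosedImmersion.spec_of_surjective q₁ h₁
  have hcl : ∀ j, IsClosedImmersion (c.ι.app j) := by
    rintro (_ | _ | _)
    · exact inferInstanceAs (IsClosedImmersion (Spec.map q₁ ≫ Spec.map p₁))
    · exact c₁
    · exact c₂
  have hsurj : ∀ z : Spec R, (∃ x, Spec.map p₁ x = z) ∨ ∃ x, Spec.map p₂ x = z := by
    intro z
    change z ∈ Set.range _ ∨ z ∈ Set.range _
    rw [mem_range_SpecMap_of_surjective hp₁, mem_range_SpecMap_of_surjective hp₂]
    by_contra! h
    obtain ⟨⟨a, ha, ha'⟩, b, hb, hb'⟩ := h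
    -- A product of elements of the two kernels is killed by both projections.
    have hab : a * b = 0 := hinj _ (by rw [map_mul, ha, zero_mul]) (by rw [map_mul, hb, mul_zero])
    have : a * b ∈ z.asIdeal := by rw [hab]; exact zero_mem _
    exact (z.isPrime.mem_or_mem this).elim ha' hb'
  have hfib : ∀ x y, Spec.map p₁ x = Spec.map p₂ y →
      ∃ z, Spec.map q₁ z = x ∧ Spec.map q₂ z = y := by
    intro x y hxy
    have h1 : ∃ z, Spec.map (p₁ ≫ q₁) z = Spec.map p₁ x := by
      change _ ∈ Set.range _
      have hpq : Function.Surjective (p₁ ≫ q₁) := fun s => by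
        obtain ⟨a, rfl⟩ := h₁ s
        obtain ⟨x, rfl⟩ := hp₁ a
        exact ⟨x, rfl⟩
      rw [mem_range_SpecMap_of_surjective hpq]
      intro r hr
      -- An element `r` killed in `S` is the sum of `r - s` in the kernel of `p₁` and `s` in the
      -- kernel of `p₂`, where `s` is the element of the fibre product given by the pair `(p₁ r,
      -- 0)`.
      have hr₁ : q₁ (p₁ r) = q₂ 0 := by rw [map_zero]; exact hr
      obtain ⟨s, hs₁, hs₂⟩ := hex _ _ hr₁
      have h1 : s ∈ (Spec.map p₁ x).asIdeal := by
        rw [hxy]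
        exact (mem_range_SpecMap_of_surjective hp₂).mp ⟨y, rfl⟩ s hs₂
      have h2 : r - s ∈ (Spec.map p₁ x).asIdeal :=
        (mem_range_SpecMap_of_surjective hp₁).mp ⟨x, rfl⟩ _ (by rw [map_sub, hs₁, sub_self])
      simpa using add_mem h2 h1
    obtain ⟨z, hz⟩ := h1
    refine ⟨z, ?_, ?_⟩
    · apply (Spec.map p₁).isClosedEmbedding.injective
      rw [← hz, Spec.map_comp]; rfl
    · apply (Spec.map p₂).isClosedEmbedding.injective
      rw [← hxy, ← hz, w, Spec.map_comp]; rfl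
  refine Scheme.isGlued (c := c) ?_ ?_ ?_ ?_
  · intro z
    rcases hsurj z with ⟨x, hx⟩ | ⟨x, hx⟩
    · exact ⟨.left, x, hx⟩
    · exact ⟨.right, x, hx⟩
  · intro U hU
    have h1 : IsClosed (Spec.map p₁ ⁻¹' Uᶜ) := (hU .left).isClosed_compl
    have h2 : IsClosed (Spec.map p₂ ⁻¹' Uᶜ) := (hU .right).isClosed_compl
    have h3 : Uᶜ = Spec.map p₁ '' (Spec.map p₁ ⁻¹' Uᶜ) ∪ Spec.map p₂ '' (Spec.map p₂ ⁻¹' Uᶜ) := by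
      refine Set.Subset.antisymm (fun z hz => ?_) ?_
      · rcases hsurj z with ⟨x, rfl⟩ | ⟨x, rfl⟩
        · exact Or.inl ⟨x, hz, rfl⟩
        · exact Or.inr ⟨x, hz, rfl⟩
      · rintro z (⟨x, hx, rfl⟩ | ⟨x, hx, rfl⟩) <;> exact hx
    rw [← isClosed_compl_iff, h3]
    exact ((Spec.map p₁).isClosedEmbedding.isClosedMap _ h1).union
      ((Spec.map p₂).isClosedEmbedding.isClosedMap _ h2)
  · have e₁ : Function.Injective (Spec.map p₁) := (Spec.map p₁).isClosedEmbedding.injective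
    have e₂ : Function.Injective (Spec.map p₂) := (Spec.map p₂).isClosedEmbedding.injective
    have e₀ : Function.Injective (Spec.map q₁ ≫ Spec.map p₁) :=
      (Spec.map q₁ ≫ Spec.map p₁).isClosedEmbedding.injective
    have hl : ∀ z : Spec S, c.ι.app .zero z = Spec.map p₁ (Spec.map q₁ z) := fun z => rfl
    have hr : ∀ z : Spec S, c.ι.app .zero z = Spec.map p₂ (Spec.map q₂ z) := fun z => by
      rw [hl, ← Scheme.Hom.comp_apply, ← Scheme.Hom.comp_apply, ← Spec.map_comp, w, Spec.map_comp]
    have hid : ∀ (j : WalkingSpan) (x : (span (Spec.map q₁) (Spec.map q₂)).obj j),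
        (span (Spec.map q₁) (Spec.map q₂)).map (𝟙 j) x = x := fun j x => by
      rw [CategoryTheory.Functor.map_id]; rfl
    rintro (_ | _ | _) (_ | _ | _) x y hxy
    · obtain rfl : x = y := e₀ hxy
      exact ⟨.zero, 𝟙 _, 𝟙 _, x, hid _ _, hid _ _⟩
    · exact ⟨.zero, 𝟙 _, WalkingSpan.Hom.fst, x, hid _ _, e₁ ((hl x).symm.trans hxy)⟩
    · exact ⟨.zero, 𝟙 _, WalkingSpan.Hom.snd, x, hid _ _, e₂ ((hr x).symm.trans hxy)⟩
    · exact ⟨.zero, WalkingSpan.Hom.fst, 𝟙 _, y, e₁ ((hl y).symm.trans hxy.symm), hid _ _⟩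
    · obtain rfl : x = y := e₁ hxy
      exact ⟨.left, 𝟙 _, 𝟙 _, x, hid _ _, hid _ _⟩
    · obtain ⟨z, hz₁, hz₂⟩ := hfib x y hxy
      exact ⟨.zero, WalkingSpan.Hom.fst, WalkingSpan.Hom.snd, z, hz₁, hz₂⟩
    · exact ⟨.zero, WalkingSpan.Hom.snd, 𝟙 _, y, e₂ ((hr y).symm.trans hxy.symm), hid _ _⟩
    · obtain ⟨z, hz₁, hz₂⟩ := hfib y x hxy.symm
      exact ⟨.zero, WalkingSpan.Hom.snd, WalkingSpan.Hom.fst, z, hz₂, hz₁⟩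
    · obtain rfl : x = y := e₂ hxy
      exact ⟨.right, 𝟙 _, 𝟙 _, x, hid _ _, hid _ _⟩
  -- The vertex is affine and the legs are affine, so it is enough to glue global sections.
  · refine Scheme.SectionsGlue.exists_le (c := c) fun z =>
      ⟨⊤, isAffineOpen_top (Spec R), trivial, ?_⟩
    have hΓ : ∀ {A B : CommRingCat.{u}} (f : A ⟶ B) (s : Γ(Spec A, ⊤)),
        (Scheme.ΓSpecIso B).hom ((Spec.map f).app ⊤ s) = f ((Scheme.ΓSpecIso A).hom s) :=
      fun f s => congr($(Scheme.ΓSpecIso_naturality f) s)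
    have hΓi : ∀ A : CommRingCat.{u}, Function.Bijective (Scheme.ΓSpecIso A).hom := fun A =>
      (ConcreteCategory.isIso_iff_bijective _).mp inferInstance
    constructor
    · intro (s : Γ(Spec R, ⊤)) hs
      have h1 : (Spec.map p₁).app ⊤ s = 0 := hs .left
      have h2 : (Spec.map p₂).app ⊤ s = 0 := hs .right
      refine (hΓi R).1 (Eq.trans (hinj _ ?_ ?_) (map_zero (Scheme.ΓSpecIso R).hom.hom).symm)
      · rw [← hΓ, h1]; exact map_zero (Scheme.ΓSpecIso R₁).hom.hom
      · rw [← hΓ, h2]; exact map_zero (Scheme.ΓSpecIso R₂).hom.hom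
    · intro s hs
      let a : Γ(Spec R₁, ⊤) := s .left
      let b : Γ(Spec R₂, ⊤) := s .right
      have h1 : (Spec.map q₁).app ⊤ a = s .zero := by
        rw [Scheme.Hom.app_eq_appLE]
        exact hs WalkingSpan.Hom.fst
      have h2 : (Spec.map q₂).app ⊤ b = s .zero := by
        rw [Scheme.Hom.app_eq_appLE]
        exact hs WalkingSpan.Hom.snd
      obtain ⟨x, hx₁, hx₂⟩ := hex ((Scheme.ΓSpecIso _).hom a) ((Scheme.ΓSpecIso _).hom b)
        (by rw [← hΓ, ← hΓ, h1, h2])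
      obtain ⟨t, rfl⟩ := (hΓi R).2 x
      have hl : (c.ι.app .left).app ⊤ t = s .left := (hΓi R₁).1 ((hΓ p₁ t).trans hx₁)
      have hr : (c.ι.app .right).app ⊤ t = s .right := (hΓi R₂).1 ((hΓ p₂ t).trans hx₂)
      refine ⟨t, ?_⟩
      rintro (_ | _ | _)
      · rw [← hs WalkingSpan.Hom.fst, ← hl]
        exact (Scheme.cocone_appLE_app c ⊤ WalkingSpan.Hom.fst t).symm
      · exact hl
      · exact hr

end AffinePushout

end AlgebraicGeometry

/-! ### Points and sections of pushouts, and matching affine open subsets -/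

namespace AlgebraicGeometry

open TopologicalSpace

namespace LocallyRingedSpace

lemma pullSec_of_eq_id {X : LocallyRingedSpace.{u}} {f : X ⟶ X} (hf : f = 𝟙 X) {U : Opens X}
    (h : ∀ x ∈ U, f.base x ∈ U) (s : X.presheaf.obj (op U)) : pullSec f U U h s = s := by
  subst hf
  exact congr($(X.presheaf.map_id _) s)

section Span

variable {B X Y P : LocallyRingedSpace.{u}} {f : B ⟶ X} {g : B ⟶ Y} {i : X ⟶ P} {j : Y ⟶ P}
  (h : IsPushout f g i j)

include h

lemma isOpen_of_isPushout {U : Set P} (h₁ : IsOpen (i.base ⁻¹' U)) (h₂ : IsOpen (j.base ⁻¹' U)) :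
    IsOpen U := by
  refine isOpen_of_isColimit h.isColimit U ?_
  rintro (_ | _ | _)
  · exact h₁.preimage f.base.hom.continuous
  · exact h₁
  · exact h₂

lemma surj_of_isPushout (z : P) : (∃ x, i.base x = z) ∨ ∃ y, j.base y = z := by
  obtain ⟨(_ | _ | _), x, hx⟩ := surj_of_isColimit h.isColimit z
  · exact Or.inl ⟨f.base x, hx⟩
  · exact Or.inl ⟨x, hx⟩
  · exact Or.inr ⟨x, hx⟩

lemma section_ext_of_isPushout {U : Opens P} {s t : P.presheaf.obj (op U)}
    (h₁ : pullSec i U (preim i U) (preim_self _ _) s = pullSec i U (preim i U) (preim_self _ _) t)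
    (h₂ : pullSec j U (preim j U) (preim_self _ _) s = pullSec j U (preim j U) (preim_self _ _) t) :
    s = t := by
  refine (sectionsGlue_of_isColimit h.isColimit U).inj s t ?_
  rintro (_ | _ | _)
  · have key := fun r => pullSec_comp_apply f i U (preim i U) (preim f (preim i U))
      (preim_self _ _) (preim_self _ _) (preim_self (f ≫ i) U) r
    exact (key s).trans ((congrArg _ h₁).trans (key t).symm)
  · exact h₁
  · exact h₂

lemma exists_section_of_isPushout {U : Opens P} (a : X.presheaf.obj (op (preim i U)))
    (b : Y.presheaf.obj (op (preim j U))) (V : Opens B)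
    (hV : ∀ x ∈ V, f.base x ∈ preim i U) (hV' : ∀ x ∈ V, g.base x ∈ preim j U)
    (hV'' : ∀ x, f.base x ∈ preim i U → x ∈ V)
    (hab : pullSec f (preim i U) V hV a = pullSec g (preim j U) V hV' b) :
    ∃ s : P.presheaf.obj (op U), pullSec i U (preim i U) (preim_self _ _) s = a ∧
      pullSec j U (preim j U) (preim_self _ _) s = b := by
  obtain rfl : V = preim f (preim i U) := le_antisymm hV hV''
  let s : ∀ l : WalkingSpan, ((span f g).obj l).presheaf.obj
      (op (preim ((PushoutCocone.mk i j h.w).ι.app l) U)) := fun l => match l with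
    | .zero => pullSec f (preim i U) (preim f (preim i U)) (preim_self _ _) a
    | .left => a
    | .right => b
  obtain ⟨t, ht⟩ := (sectionsGlue_of_isColimit h.isColimit U).glue s (by
    rintro _ _ (_ | (_ | _))
    · exact pullSec_of_eq_id ((span f g).map_id _) _ (s _)
    · rfl
    · exact hab.symm)
  exact ⟨t, ht .left, ht .right⟩

end Span

end LocallyRingedSpace

section GoodPair

variable {B X Y : Scheme.{u}} (i : B ⟶ X) (j : B ⟶ Y) [IsClosedImmersion i] [IsClosedImmersion j]

/-- The preimages in `B` of affine neighbourhoods of `i b` and `j b` share a basic open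
neighbourhood of `b`. The two functions defining it lift along the closed immersions, and the basic
open sets of the lifts have the same preimage in `B`. -/
lemma exists_affine_pair (b : B) : ∃ (U : X.Opens) (V : Y.Opens), IsAffineOpen U ∧
    IsAffineOpen V ∧ i ⁻¹ᵁ U = j ⁻¹ᵁ V ∧ i b ∈ U := by
  obtain ⟨U, hU, hbU, -⟩ := exists_isAffineOpen_mem_and_subset (x := i b) (U := ⊤) trivial
  obtain ⟨V, hV, hbV, -⟩ := exists_isAffineOpen_mem_and_subset (x := j b) (U := ⊤) trivial
  obtain ⟨f, g, hfg, hb⟩ := exists_basicOpen_le_affine_inter (hU.preimage i) (hV.preimage j) b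
    ⟨hbU, hbV⟩
  obtain ⟨f, rfl⟩ := i.app_surjective U hU f
  obtain ⟨g, rfl⟩ := j.app_surjective V hV g
  rw [← Scheme.preimage_basicOpen] at hfg hb
  rw [← Scheme.preimage_basicOpen] at hfg
  exact ⟨_, _, hU.basicOpen f, hV.basicOpen g, hfg, hb⟩

lemma exists_affine_notMem_range (x : X) (hx : x ∉ Set.range i) :
    ∃ U : X.Opens, IsAffineOpen U ∧ i ⁻¹ᵁ U = ⊥ ∧ x ∈ U := by
  obtain ⟨U, hU, hxU, hle⟩ := exists_isAffineOpen_mem_and_subset (x := x)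
    (U := ⟨(Set.range i)ᶜ, i.isClosedEmbedding.isClosed_range.isOpen_compl⟩) hx
  refine ⟨U, hU, ?_, hxU⟩
  rw [eq_bot_iff]
  exact fun b hb => hle hb ⟨b, rfl⟩

end GoodPair

end AlgebraicGeometry

/-! ### Open immersions between pushouts -/

namespace AlgebraicGeometry

open TopologicalSpace

namespace LocallyRingedSpace

lemma bijective_pullSec_of_isOpenImmersion {X Y : LocallyRingedSpace.{u}} (f : X ⟶ Y)
    [hf : LocallyRingedSpace.IsOpenImmersion f] {U : Opens Y} {V : Opens X}
    (hU : ∀ y ∈ U, y ∈ Set.range f.base) (hV : ∀ x, x ∈ V ↔ f.base x ∈ U) :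
    Function.Bijective (pullSec f U V fun x hx => (hV x).mp hx) := by
  obtain rfl : V = preim f U := Opens.ext (Set.ext hV)
  rw [pullSec_preim]
  have hU' : U = hf.base_open.functor.obj (preim f U) := by
    refine Opens.ext (Set.ext fun y => ⟨fun hy => ?_, ?_⟩)
    · obtain ⟨x, rfl⟩ := hU y hy
      exact ⟨x, hy, rfl⟩
    · rintro ⟨x, hx, rfl⟩
      exact hx
  have := PresheafedSpace.IsOpenImmersion.c_iso' f.toHom (preim f U) hU'
  exact (ConcreteCategory.isIso_iff_bijective _).mp this

section IsOpenImmersion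

variable {B X Y P B' X' Y' P' : LocallyRingedSpace.{u}}
  {f : B ⟶ X} {g : B ⟶ Y} {i : X ⟶ P} {j : Y ⟶ P} (h : IsPushout f g i j)
  {f' : B' ⟶ X'} {g' : B' ⟶ Y'} {i' : X' ⟶ P'} {j' : Y' ⟶ P'} (h' : IsPushout f' g' i' j')
  {β : B' ⟶ B} {ξ : X' ⟶ X} {η : Y' ⟶ Y} {π : P' ⟶ P}
  (hf : f' ≫ ξ = β ≫ f) (hg : g' ≫ η = β ≫ g) (hi : i' ≫ π = ξ ≫ i) (hj : j' ≫ π = η ≫ j)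
  (f_inj : Function.Injective f.base) (g_inj : Function.Injective g.base)
  (hξ : ∀ b, f.base b ∈ Set.range ξ.base → b ∈ Set.range β.base)
  (hη : ∀ b, g.base b ∈ Set.range η.base → b ∈ Set.range β.base)

include h h' hf hg hi hj f_inj g_inj hξ hη in
/-- Gluing open immersions along a pushout of locally ringed spaces. -/
lemma isOpenImmersion_of_isPushout [hB : LocallyRingedSpace.IsOpenImmersion β]
    [hX : LocallyRingedSpace.IsOpenImmersion ξ] [hY : LocallyRingedSpace.IsOpenImmersion η] :
    LocallyRingedSpace.IsOpenImmersion π ∧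
      (∀ x, i.base x ∈ Set.range π.base → x ∈ Set.range ξ.base) ∧
      (∀ y, j.base y ∈ Set.range π.base → y ∈ Set.range η.base) := by
  obtain ⟨i_inj, j_inj, hex⟩ := fiber_of_isPushout f_inj g_inj h
  have ξ_inj : Function.Injective ξ.base := hX.base_open.injective
  have η_inj : Function.Injective η.base := hY.base_open.injective
  have ef : ∀ b, ξ.base (f'.base b) = f.base (β.base b) := fun b => congr($(hf).base b)
  have eg : ∀ b, η.base (g'.base b) = g.base (β.base b) := fun b => congr($(hg).base b)
  have ei : ∀ x, π.base (i'.base x) = i.base (ξ.base x) := fun x => congr($(hi).base x)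
  have ej : ∀ y, π.base (j'.base y) = j.base (η.base y) := fun y => congr($(hj).base y)
  have ew : ∀ b, i'.base (f'.base b) = j'.base (g'.base b) := fun b => congr($(h'.w).base b)
  -- By `hξ` and `hη`, a point of `B` that meets the open part on either side already comes from
  -- `B'`. This makes the squares from `X'` and `Y'` to `P` cartesian on points, which is what
  -- `hi_pre` and `hj_pre` record.
  have hmix : ∀ x y, i.base (ξ.base x) = j.base (η.base y) →
      ∃ b, f'.base b = x ∧ g'.base b = y := by
    intro x y hxy
    obtain ⟨b, hb₁, hb₂⟩ := hex _ _ hxy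
    obtain ⟨b, rfl⟩ := hξ b (hb₁ ▸ ⟨x, rfl⟩)
    exact ⟨b, ξ_inj ((ef b).trans hb₁), η_inj ((eg b).trans hb₂)⟩
  have hmix₁ : ∀ x y, i.base x = j.base (η.base y) → ∃ b, ξ.base (f'.base b) = x ∧ g'.base b = y := by
    intro x y hxy
    obtain ⟨b, hb₁, hb₂⟩ := hex _ _ hxy
    obtain ⟨b, rfl⟩ := hη b (hb₂ ▸ ⟨y, rfl⟩)
    exact ⟨b, (ef b).trans hb₁, η_inj ((eg b).trans hb₂)⟩
  have hmix₂ : ∀ x y, i.base (ξ.base x) = j.base y → ∃ b, f'.base b = x ∧ η.base (g'.base b) = y := by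
    intro x y hxy
    obtain ⟨b, hb₁, hb₂⟩ := hex _ _ hxy
    obtain ⟨b, rfl⟩ := hξ b (hb₁ ▸ ⟨x, rfl⟩)
    exact ⟨b, ξ_inj ((ef b).trans hb₁), (eg b).trans hb₂⟩
  have π_inj : Function.Injective π.base := by
    intro z z' hz
    rcases surj_of_isPushout h' z with ⟨x, rfl⟩ | ⟨y, rfl⟩ <;>
      rcases surj_of_isPushout h' z' with ⟨x', rfl⟩ | ⟨y', rfl⟩
    · exact congrArg _ (ξ_inj (i_inj ((ei x).symm.trans (hz.trans (ei x')))))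
    · obtain ⟨b, rfl, rfl⟩ := hmix x y' ((ei x).symm.trans (hz.trans (ej y')))
      exact ew b
    · obtain ⟨b, rfl, rfl⟩ := hmix x' y ((ei x').symm.trans (hz.symm.trans (ej y)))
      exact (ew b).symm
    · exact congrArg _ (η_inj (j_inj ((ej y).symm.trans (hz.trans (ej y')))))
  have hi_pre : ∀ (x : X) (z : P'), i.base x = π.base z → ∃ x', ξ.base x' = x ∧ i'.base x' = z := by
    intro x z hz
    rcases surj_of_isPushout h' z with ⟨x', rfl⟩ | ⟨y, rfl⟩
    · exact ⟨x', (i_inj (hz.trans (ei x'))).symm, rfl⟩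
    · obtain ⟨b, hb, rfl⟩ := hmix₁ x y (hz.trans (ej y))
      exact ⟨_, hb, ew b⟩
  have hj_pre : ∀ (y : Y) (z : P'), j.base y = π.base z → ∃ y', η.base y' = y ∧ j'.base y' = z := by
    intro y z hz
    rcases surj_of_isPushout h' z with ⟨x, rfl⟩ | ⟨y', rfl⟩
    · obtain ⟨b, rfl, hb⟩ := hmix₂ x y ((ei x).symm.trans hz.symm)
      exact ⟨_, hb, (ew b).symm⟩
    · exact ⟨y', (j_inj (hz.trans (ej y'))).symm, rfl⟩
  -- Openness in a pushout is tested on `X` and `Y`, where the preimage of `π '' O` is an image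
  -- under the open immersion `ξ` or `η`.
  have π_open : IsOpenMap π.base := by
    intro O hO
    refine isOpen_of_isPushout h ?_ ?_
    · have : i.base ⁻¹' (π.base '' O) = ξ.base '' (i'.base ⁻¹' O) := by
        refine Set.Subset.antisymm ?_ ?_
        · rintro x ⟨z, hz, hzx⟩
          obtain ⟨x', rfl, rfl⟩ := hi_pre x z hzx.symm
          exact ⟨x', hz, rfl⟩
        · rintro _ ⟨x, hx, rfl⟩
          exact ⟨_, hx, ei x⟩
      rw [this]
      exact hX.base_open.isOpenMap _ (hO.preimage i'.base.hom.continuous)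
    · have : j.base ⁻¹' (π.base '' O) = η.base '' (j'.base ⁻¹' O) := by
        refine Set.Subset.antisymm ?_ ?_
        · rintro y ⟨z, hz, hzy⟩
          obtain ⟨y', rfl, rfl⟩ := hj_pre y z hzy.symm
          exact ⟨y', hz, rfl⟩
        · rintro _ ⟨y, hy, rfl⟩
          exact ⟨_, hy, ej y⟩
      rw [this]
      exact hY.base_open.isOpenMap _ (hO.preimage j'.base.hom.continuous)
  have π_emb : Topology.IsOpenEmbedding π.base :=
    .of_continuous_injective_isOpenMap π.base.hom.continuous π_inj π_open
  refine ⟨{ base_open := π_emb, c_iso := fun O => ?_ }, ?_, ?_⟩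
  · rw [ConcreteCategory.isIso_iff_bijective]
    set U : Opens P := π_emb.functor.obj O with hU_def
    have hU : ∀ z ∈ U, z ∈ Set.range π.base := by
      rintro _ ⟨z, -, rfl⟩
      exact ⟨z, rfl⟩
    change Function.Bijective (π.c.app (op U))
    rw [← pullSec_preim]
    -- Sections of a pushout are pairs of sections on `X` and `Y` that agree on `B`. Each of these
    -- three rings of sections is unchanged on passing to the primed span, by `cξ`, `cη` and `cβ`.
    have cξ : Function.Bijective (pullSec ξ (preim i U) (preim i' (preim π U))
        (fun x hx => by rw [mem_preim, ← ei]; exact hx)) := by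
      refine bijective_pullSec_of_isOpenImmersion ξ (fun x hx => ?_) fun x => ?_
      · obtain ⟨z, hz⟩ := hU _ hx
        obtain ⟨x', rfl, -⟩ := hi_pre x z hz.symm
        exact ⟨x', rfl⟩
      · exact iff_of_eq (congrArg (· ∈ U) (ei x))
    have cη : Function.Bijective (pullSec η (preim j U) (preim j' (preim π U))
        (fun x hx => by rw [mem_preim, ← ej]; exact hx)) := by
      refine bijective_pullSec_of_isOpenImmersion η (fun y hy => ?_) fun y => ?_
      · obtain ⟨z, hz⟩ := hU _ hy
        obtain ⟨y', rfl, -⟩ := hj_pre y z hz.symm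
        exact ⟨y', rfl⟩
      · exact iff_of_eq (congrArg (· ∈ U) (ej y))
    have mβ : ∀ b : B', f'.base b ∈ preim i' (preim π U) ↔ f.base (β.base b) ∈ preim i U := by
      intro b
      rw [mem_preim, mem_preim, ei, ef, mem_preim]
    have cβ : Function.Bijective (pullSec β (preim f (preim i U))
        (preim f' (preim i' (preim π U))) (fun b hb => (mβ b).mp hb)) := by
      refine bijective_pullSec_of_isOpenImmersion β (fun b hb => ?_) mβ
      obtain ⟨z, hz⟩ := hU _ hb
      obtain ⟨x', hx', -⟩ := hi_pre _ z hz.symm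
      exact hξ b ⟨x', hx'⟩
    have k₁ : ∀ s : P.presheaf.obj (op U), pullSec ξ (preim i U) (preim i' (preim π U))
        (fun x hx => by rw [mem_preim, ← ei]; exact hx) (pullSec i U (preim i U) (preim_self _ _) s)
        = pullSec i' (preim π U) (preim i' (preim π U)) (preim_self _ _)
          (pullSec π U (preim π U) (preim_self _ _) s) := fun s =>
      (pullSec_comp_apply ξ i U _ _ (preim_self _ _) _
        (fun x hx => (congrArg (· ∈ U) (ei x)).mp hx) s).symm.trans
      ((congr($(pullSec_congr hi.symm U _ _) s)).trans
        (pullSec_comp_apply i' π U _ _ (preim_self _ _) _ _ s))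
    have k₂ : ∀ s : P.presheaf.obj (op U), pullSec η (preim j U) (preim j' (preim π U))
        (fun x hx => by rw [mem_preim, ← ej]; exact hx) (pullSec j U (preim j U) (preim_self _ _) s)
        = pullSec j' (preim π U) (preim j' (preim π U)) (preim_self _ _)
          (pullSec π U (preim π U) (preim_self _ _) s) := fun s =>
      (pullSec_comp_apply η j U _ _ (preim_self _ _) _
        (fun x hx => (congrArg (· ∈ U) (ej x)).mp hx) s).symm.trans
      ((congr($(pullSec_congr hj.symm U _ _) s)).trans
        (pullSec_comp_apply j' π U _ _ (preim_self _ _) _ _ s))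
    constructor
    · intro s t hst
      refine section_ext_of_isPushout h (cξ.1 ?_) (cη.1 ?_)
      · exact (k₁ s).trans ((congrArg _ hst).trans (k₁ t).symm)
      · exact (k₂ s).trans ((congrArg _ hst).trans (k₂ t).symm)
    · intro t
      obtain ⟨a, ha⟩ := cξ.2 (pullSec i' (preim π U) (preim i' (preim π U)) (preim_self _ _) t)
      obtain ⟨b, hb⟩ := cη.2 (pullSec j' (preim π U) (preim j' (preim π U)) (preim_self _ _) t)
      have hgf : ∀ b ∈ preim f (preim i U), g.base b ∈ preim j U := fun b hb => by
        have := congr($(h.w).base b)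
        exact (congrArg (· ∈ U) this).mp hb
      have hgf' : ∀ b ∈ preim f' (preim i' (preim π U)), g'.base b ∈ preim j' (preim π U) :=
        fun b hb => (congrArg (· ∈ preim π U) (ew b)).mp hb
      obtain ⟨s, hs₁, hs₂⟩ := exists_section_of_isPushout h a b (preim f (preim i U))
        (preim_self _ _) hgf (fun _ hx => hx) (by
          -- Agreement of `a` and `b` on `B` may be checked on `B'`, where both become pullbacks of
          -- `t`.
          apply cβ.1
          refine (pullSec_comp_apply β f _ _ _ (preim_self _ _) _
            (fun b hb => (mβ b).mp hb) a).symm.trans ?_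
          refine (congr($(pullSec_congr hf.symm _ _ _) a)).trans ?_
          refine (pullSec_comp_apply f' ξ _ (preim i' (preim π U)) _ 
            (fun x hx => (congrArg (· ∈ U) (ei x)).mp hx) (preim_self _ _) _ a).trans ?_
          rw [ha]
          refine Eq.trans ?_ (pullSec_comp_apply β g _ _ _ hgf _
            (fun b hb => hgf _ ((mβ b).mp hb)) b)
          refine Eq.trans ?_ (congr($(pullSec_congr hg _ _ fun x hx =>
            (congrArg (· ∈ U) (ej (g'.base x))).mp (hgf' x hx)) b))
          refine Eq.trans ?_ (pullSec_comp_apply g' η _ (preim j' (preim π U)) _ 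
            (fun x hx => (congrArg (· ∈ U) (ej x)).mp hx) hgf' _ b).symm
          rw [hb]
          refine (pullSec_comp_apply f' i' _ _ _ (preim_self _ _) _ (preim_self _ _) t).symm.trans ?_
          refine (congr($(pullSec_congr h'.w _ _ _) t)).trans ?_
          exact pullSec_comp_apply g' j' _ _ _ (preim_self _ _) hgf' _ t)
      refine ⟨s, section_ext_of_isPushout h' ?_ ?_⟩
      · rw [← k₁, hs₁, ha]
      · rw [← k₂, hs₂, hb]
  · rintro x ⟨z, hz⟩
    obtain ⟨x', rfl, -⟩ := hi_pre x z hz.symm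
    exact ⟨x', rfl⟩
  · rintro y ⟨z, hz⟩
    obtain ⟨y', rfl, -⟩ := hj_pre y z hz.symm
    exact ⟨y', rfl⟩

end IsOpenImmersion

end LocallyRingedSpace

end AlgebraicGeometry

/-! ### Pushouts of schemes along closed immersions -/

namespace AlgebraicGeometry

open TopologicalSpace

/-- The image of a closed subset `Z` of `X` is closed because its preimage in `X` is `Z`, by
injectivity, and its preimage in `Y` is `g (f⁻¹ Z)`, which is closed as `g` is a closed map. -/
lemma LocallyRingedSpace.isClosedEmbedding_of_isPushout {B X Y P : LocallyRingedSpace.{u}}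
    {f : B ⟶ X} {g : B ⟶ Y} {i : X ⟶ P} {j : Y ⟶ P} (h : IsPushout f g i j)
    (hf : Topology.IsClosedEmbedding f.base) (hg : Topology.IsClosedEmbedding g.base) :
    Topology.IsClosedEmbedding i.base := by
  obtain ⟨h₁, h₂, hex⟩ := fiber_of_isPushout hf.injective hg.injective h
  have hw : ∀ b, i.base (f.base b) = j.base (g.base b) := fun b => congr($(h.w).base b)
  refine .of_continuous_injective_isClosedMap i.base.hom.continuous h₁ fun Z hZ => ?_
  rw [← isOpen_compl_iff]
  refine LocallyRingedSpace.isOpen_of_isPushout h ?_ ?_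
  · rw [Set.preimage_compl, Set.preimage_image_eq _ h₁]
    exact hZ.isOpen_compl
  · have : j.base ⁻¹' (i.base '' Z)ᶜ = (g.base '' (f.base ⁻¹' Z))ᶜ := by
      rw [Set.preimage_compl]
      congr 1
      ext y
      constructor
      · rintro ⟨x, hx, hxy⟩
        obtain ⟨b, rfl, rfl⟩ := hex x y hxy
        exact ⟨b, hx, rfl⟩
      · rintro ⟨b, hb, rfl⟩
        exact ⟨_, hb, hw b⟩
    rw [this]
    exact (hg.isClosedMap _ (hZ.preimage f.base.hom.continuous)).isOpen_compl

section Pushout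

variable {B X Y : Scheme.{u}} (i : B ⟶ X) (j : B ⟶ Y) [IsClosedImmersion i] [IsClosedImmersion j]

lemma exists_affine_pair_left (x : X) : ∃ (U : X.Opens) (V : Y.Opens), IsAffineOpen U ∧
    IsAffineOpen V ∧ i ⁻¹ᵁ U = j ⁻¹ᵁ V ∧ x ∈ U := by
  by_cases hx : x ∈ Set.range i
  · obtain ⟨b, rfl⟩ := hx
    exact exists_affine_pair i j b
  · obtain ⟨U, hU, hbot, hxU⟩ := exists_affine_notMem_range i x hx
    -- Away from `B` the chart involves only `X`, and the empty affine open subset serves on the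
    -- other side.
    exact ⟨U, ⊥, hU, isAffineOpen_bot Y, hbot, hxU⟩

lemma isPushout_of_isGlued {B X Y P : Scheme.{u}} {f : B ⟶ X} {g : B ⟶ Y} {i : X ⟶ P} {j : Y ⟶ P}
    (w : f ≫ i = g ≫ j)
    (h : LocallyRingedSpace.IsGlued
      (Scheme.forgetToLocallyRingedSpace.mapCocone (PushoutCocone.mk i j w))) :
    IsPushout (Scheme.forgetToLocallyRingedSpace.map f) (Scheme.forgetToLocallyRingedSpace.map g)
      (Scheme.forgetToLocallyRingedSpace.map i) (Scheme.forgetToLocallyRingedSpace.map j) :=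
  .of_isColimit (isColimitMapCoconePushoutCoconeEquiv Scheme.forgetToLocallyRingedSpace w
    h.isColimit)

variable {i j}

/-- The chart is the spectrum of the fibre product of `Γ(X, U)` and `Γ(Y, V)` over the sections of
`B`. By `affinePushout_isGlued` it is the pushout of the affine pieces in locally ringed spaces, and
`isOpenImmersion_of_isPushout` embeds it as an open subspace of `P`. -/
lemma exists_chart_of_isPushout {P : LocallyRingedSpace.{u}} {inl : X.toLocallyRingedSpace ⟶ P}
    {inr : Y.toLocallyRingedSpace ⟶ P}
    (h : IsPushout (Scheme.forgetToLocallyRingedSpace.map i)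
      (Scheme.forgetToLocallyRingedSpace.map j) inl inr)
    {U : X.Opens} {V : Y.Opens} (hU : IsAffineOpen U) (hV : IsAffineOpen V)
    (e : i ⁻¹ᵁ U = j ⁻¹ᵁ V) :
    ∃ (R R₁ R₂ : CommRingCat.{u}) (p₁ : R ⟶ R₁) (p₂ : R ⟶ R₂) (ξ : Spec R₁ ⟶ X) (η : Spec R₂ ⟶ Y)
      (π : (Spec R).toLocallyRingedSpace ⟶ P),
      Function.Surjective p₁ ∧ Function.Surjective p₂ ∧ IsOpenImmersion ξ ∧ IsOpenImmersion η ∧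
      LocallyRingedSpace.IsOpenImmersion π ∧ Set.range ξ = U ∧ Set.range η = V ∧
      (Spec.map p₁).toLRSHom ≫ π = ξ.toLRSHom ≫ inl ∧
      (Spec.map p₂).toLRSHom ≫ π = η.toLRSHom ≫ inr := by
  have hW := hU.preimage i
  let q₁ : Γ(X, U) ⟶ Γ(B, i ⁻¹ᵁ U) := i.appLE U _ le_rfl
  let q₂ : Γ(Y, V) ⟶ Γ(B, i ⁻¹ᵁ U) := j.appLE V _ e.le
  have h₁ : Function.Surjective q₁ := by
    have := i.app_surjective U hU
    rwa [Scheme.Hom.app_eq_appLE] at this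
  have h₂ : Function.Surjective q₂ := by
    have := j.app_surjective V hV
    rw [Scheme.Hom.app_eq_appLE] at this
    have key : ∀ (W : B.Opens) (hW : j ⁻¹ᵁ V = W), Function.Surjective (j.appLE V W hW.ge) := by
      rintro W rfl
      exact this
    exact key _ e.symm
  let A := RingHom.eqLocus (q₁.hom.comp (RingHom.fst Γ(X, U) Γ(Y, V)))
    (q₂.hom.comp (RingHom.snd Γ(X, U) Γ(Y, V)))
  let R : CommRingCat.{u} := .of A
  let p₁ : R ⟶ Γ(X, U) := CommRingCat.ofHom ((RingHom.fst _ _).comp A.subtype)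
  let p₂ : R ⟶ Γ(Y, V) := CommRingCat.ofHom ((RingHom.snd _ _).comp A.subtype)
  have w : p₁ ≫ q₁ = p₂ ≫ q₂ := by
    ext x
    exact x.2
  have hex : ∀ a b, q₁ a = q₂ b → ∃ x, p₁ x = a ∧ p₂ x = b := fun a b hab =>
    ⟨⟨(a, b), hab⟩, rfl, rfl⟩
  have hp₁ : Function.Surjective p₁ := fun a => by
    obtain ⟨b, hb⟩ := h₂ (q₁ a)
    obtain ⟨x, hx, -⟩ := hex a b hb.symm
    exact ⟨x, hx⟩
  have hp₂ : Function.Surjective p₂ := fun b => by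
    obtain ⟨a, ha⟩ := h₁ (q₂ b)
    obtain ⟨x, -, hx⟩ := hex a b ha
    exact ⟨x, hx⟩
  have hglue := affinePushout_isGlued w (fun x hx hx' => Subtype.ext (Prod.ext hx hx')) hex h₁ h₂
  have h' := isPushout_of_isGlued _ hglue
  have sq₁ : Spec.map q₁ ≫ hU.fromSpec = hW.fromSpec ≫ i :=
    hU.SpecMap_appLE_fromSpec i hW le_rfl
  have sq₂ : Spec.map q₂ ≫ hV.fromSpec = hW.fromSpec ≫ j :=
    hV.SpecMap_appLE_fromSpec j hW e.le
  have sq₁' := congrArg Scheme.Hom.toLRSHom sq₁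
  have sq₂' := congrArg Scheme.Hom.toLRSHom sq₂
  let π := h'.desc (hU.fromSpec.toLRSHom ≫ inl) (hV.fromSpec.toLRSHom ≫ inr) (by
    refine (Category.assoc _ _ _).symm.trans ?_
    refine Eq.trans ?_ (Category.assoc _ _ _)
    refine (congrArg (· ≫ inl) sq₁').trans (Eq.trans ?_ (congrArg (· ≫ inr) sq₂').symm)
    exact (Category.assoc _ _ _).trans ((congrArg (hW.fromSpec.toLRSHom ≫ ·) h.w).trans
      (Category.assoc _ _ _).symm))
  have hl : (Spec.map p₁).toLRSHom ≫ π = hU.fromSpec.toLRSHom ≫ inl := h'.inl_desc _ _ _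
  have hr : (Spec.map p₂).toLRSHom ≫ π = hV.fromSpec.toLRSHom ≫ inr := h'.inr_desc _ _ _
  have i₁ : LocallyRingedSpace.IsOpenImmersion hU.fromSpec.toLRSHom := hU.isOpenImmersion_fromSpec
  have i₂ : LocallyRingedSpace.IsOpenImmersion hV.fromSpec.toLRSHom := hV.isOpenImmersion_fromSpec
  have i₃ : LocallyRingedSpace.IsOpenImmersion hW.fromSpec.toLRSHom := hW.isOpenImmersion_fromSpec
  have key := LocallyRingedSpace.isOpenImmersion_of_isPushout (hB := i₃) (hX := i₁) (hY := i₂) h h' sq₁' sq₂' hl hr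
    i.isClosedEmbedding.injective j.isClosedEmbedding.injective
    (fun b hb => by
      have hb : i b ∈ Set.range hU.fromSpec := hb
      rw [hU.range_fromSpec] at hb
      change b ∈ Set.range hW.fromSpec
      rw [hW.range_fromSpec]
      exact hb)
    (fun b hb => by
      have hb : j b ∈ Set.range hV.fromSpec := hb
      rw [hV.range_fromSpec] at hb
      change b ∈ Set.range hW.fromSpec
      rw [hW.range_fromSpec, e]
      exact hb)
  exact ⟨R, _, _, p₁, p₂, hU.fromSpec, hV.fromSpec, π, hp₁, hp₂, inferInstance, inferInstance,
    key.1, hU.range_fromSpec, hV.range_fromSpec, hl, hr⟩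

variable (i j)

/-- A closed immersion, from a covering by charts. -/
lemma isClosedImmersion_of_charts {X P : Scheme.{u}} {f : X ⟶ P} (hf : Topology.IsClosedEmbedding f)
    (h : ∀ x, ∃ (X' P' : Scheme.{u}) (f' : X' ⟶ P') (ξ : X' ⟶ X) (π : P' ⟶ P),
      IsClosedImmersion f' ∧ IsOpenImmersion ξ ∧ IsOpenImmersion π ∧ x ∈ Set.range ξ ∧
        f' ≫ π = ξ ≫ f) : IsClosedImmersion f := by
  suffices h : SurjectiveOnStalks f from
    IsClosedImmersion.iff_isPreimmersion.mpr ⟨⟨hf.isEmbedding⟩, hf.isClosed_range⟩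
  refine ⟨fun x => ?_⟩
  obtain ⟨X', P', f', ξ, π, h₁, h₂, h₃, ⟨x, rfl⟩, w⟩ := h x
  have h4 : SurjectiveOnStalks (f' ≫ π) := inferInstance
  rw [w] at h4
  have h5 := h4.stalkMap_surjective x
  rw [Scheme.Hom.stalkMap_comp] at h5
  have h6 : Function.Bijective (ξ.stalkMap x) :=
    (ConcreteCategory.isIso_iff_bijective _).mp inferInstance
  intro y
  obtain ⟨z, hz⟩ := h5 (ξ.stalkMap x y)
  exact ⟨z, h6.1 hz⟩

/-- The pushout in locally ringed spaces is covered by the affine charts of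
`exists_chart_of_isPushout`, hence is a scheme, and the forgetful functor reflects pushout squares.
In a chart each leg is the spectrum of a projection from a fibre product, which is surjective. -/
theorem exists_isPushout_of_isClosedImmersion : ∃ (P : Scheme.{u}) (inl : X ⟶ P) (inr : Y ⟶ P),
    IsPushout i j inl inr ∧ IsClosedImmersion inl ∧ IsClosedImmersion inr := by
  let F := Scheme.forgetToLocallyRingedSpace
  obtain ⟨L, inl, inr, h⟩ : ∃ (L : LocallyRingedSpace.{u}) (inl : X.toLocallyRingedSpace ⟶ L)
    (inr : Y.toLocallyRingedSpace ⟶ L), IsPushout (F.map i) (F.map j) inl inr :=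
    ⟨_, _, _, IsPushout.of_hasPushout (F.map i) (F.map j)⟩
  have hemb : Topology.IsClosedEmbedding inl.base ∧ Topology.IsClosedEmbedding inr.base := by
    exact ⟨LocallyRingedSpace.isClosedEmbedding_of_isPushout h i.isClosedEmbedding
      j.isClosedEmbedding, LocallyRingedSpace.isClosedEmbedding_of_isPushout h.flip
      j.isClosedEmbedding i.isClosedEmbedding⟩
  let P : Scheme.{u} := LocallyRingedSpace.IsOpenImmersion.scheme L (fun z => by
    rcases LocallyRingedSpace.surj_of_isPushout h z with ⟨x, rfl⟩ | ⟨y, rfl⟩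
    · obtain ⟨U, V, hU, hV, e, hx⟩ := exists_affine_pair_left i j x
      obtain ⟨R, R₁, R₂, p₁, p₂, ξ, η, π, -, -, -, -, hπ, hξ, -, w, -⟩ :=
        exists_chart_of_isPushout h hU hV e
      obtain ⟨x, rfl⟩ : x ∈ Set.range ξ := by rw [hξ]; exact hx
      exact ⟨R, π, ⟨Spec.map p₁ x, congr($(w).base x)⟩, hπ⟩
    · obtain ⟨V, U, hV, hU, e, hy⟩ := exists_affine_pair_left j i y
      obtain ⟨R, R₁, R₂, p₁, p₂, ξ, η, π, -, -, -, -, hπ, -, hη, -, w⟩ :=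
        exists_chart_of_isPushout h hU hV e.symm
      obtain ⟨y, rfl⟩ : y ∈ Set.range η := by rw [hη]; exact hy
      exact ⟨R, π, ⟨Spec.map p₂ y, congr($(w).base y)⟩, hπ⟩)
  let inl' : X ⟶ P := ⟨inl⟩
  let inr' : Y ⟶ P := ⟨inr⟩
  have w' : i ≫ inl' = j ≫ inr' := F.map_injective h.w
  have h' : IsPushout (F.map i) (F.map j) (F.map inl') (F.map inr') := h
  refine ⟨P, inl', inr', IsPushout.of_map F w' h', ?_, ?_⟩
  · refine isClosedImmersion_of_charts hemb.1 fun x => ?_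
    obtain ⟨U, V, hU, hV, e, hx⟩ := exists_affine_pair_left i j x
    obtain ⟨R, R₁, R₂, p₁, p₂, ξ, η, π, hp₁, -, hξ', -, hπ, hξ, -, w, -⟩ :=
        exists_chart_of_isPushout h hU hV e
    exact ⟨Spec R₁, Spec R, Spec.map p₁, ξ, ⟨π⟩, IsClosedImmersion.spec_of_surjective p₁ hp₁, hξ',
      hπ, by rw [hξ]; exact hx, F.map_injective w⟩
  · refine isClosedImmersion_of_charts hemb.2 fun y => ?_
    obtain ⟨V, U, hV, hU, e, hy⟩ := exists_affine_pair_left j i y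
    obtain ⟨R, R₁, R₂, p₁, p₂, ξ, η, π, -, hp₂, -, hη', hπ, -, hη, -, w⟩ :=
        exists_chart_of_isPushout h hU hV e.symm
    exact ⟨Spec R₂, Spec R, Spec.map p₂, η, ⟨π⟩, IsClosedImmersion.spec_of_surjective p₂ hp₂, hη',
      hπ, by rw [hη]; exact hy, F.map_injective w⟩

end Pushout

end AlgebraicGeometry

/-! ### Orbit closures and their intersection with the affine charts -/

namespace ToricFan

variable {A B C : ToricFan.{u}}

instance : Finite A.Cone := A.finite_cones.to_subtype

section Charts

variable (k : Type u) [CommRing k]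

instance (σ : A.Cone) : IsOpenImmersion (A.toricChart k σ) :=
  inferInstanceAs (IsOpenImmersion (colimit.ι (A.charts k) σ))

lemma exists_toricChart_eq (z : A.toricVariety k) : ∃ σ x, A.toricChart k σ x = z :=
  Scheme.IsLocallyDirected.ι_jointly_surjective (A.charts k) z

lemma exists_of_toricChart_eq {σ τ : A.Cone} {x : (A.charts k).obj σ} {y : (A.charts k).obj τ}
    (h : A.toricChart k σ x = A.toricChart k τ y) :
    ∃ (υ : A.Cone) (hσ : υ ≤ σ) (_ : υ ≤ τ), x ∈ Set.range (coneChartMap k hσ) := by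
  obtain ⟨υ, f, g, z, hz, -⟩ := (Scheme.IsLocallyDirected.ι_eq_ι_iff (A.charts k)).mp h
  exact ⟨υ, leOfHom f, leOfHom g, z, hz⟩

lemma toricChart_of_le {σ τ : A.Cone} (h : σ ≤ τ) (x : (A.charts k).obj σ) :
    A.toricChart k τ (coneChartMap k h x) = A.toricChart k σ x :=
  congr($(colimit.w (A.charts k) (homOfLE h)) x)

lemma range_toricChart_mono {σ τ : A.Cone} (h : σ ≤ τ) :
    Set.range (A.toricChart k σ) ⊆ Set.range (A.toricChart k τ) := by
  rintro _ ⟨x, rfl⟩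
  exact ⟨_, toricChart_of_le k h x⟩

end Charts

namespace Hom

variable {k : Type u} [CommRing k] (h : Hom A B)

/-- The image in `Σ / σ` of a cone containing `σ`. -/
def mapCone {τ : A.Cone} (hσ : h.cone ≤ τ.1) : B.Cone :=
  ⟨τ.1.map h.realMap, (h.cones_eq _).mpr ⟨τ.1, τ.2, hσ, rfl⟩⟩

/-- On coefficients, the orbit map is restriction to the face of covectors that vanish on the cone
of `h`. -/
lemma orbitRingMap_apply {τ : PointedCone ℝ A.space} {ρ : PointedCone ℝ B.space}
    (hσ : h.cone ≤ τ) (hρ : τ.map h.realMap = ρ) (a : ConeRing k τ) (n : dualMonoid ρ) :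
    (h.orbitRingMap k hσ hρ a).coeff n = a.coeff (h.pullbackDual hρ n) := by
  classical
  induction a using AddMonoidAlgebra.induction_linear with
  | zero => rw [map_zero]; rfl
  | add a b ha hb =>
    rw [map_add]
    exact congrArg₂ (· + ·) ha hb
  | single m r =>
    by_cases hm : ∀ x ∈ h.cone, realPairing m.1 x = 0
    · obtain ⟨n', rfl⟩ := (h.mem_range_pullbackDual hρ m).mpr hm
      rw [orbitRingMap_single, AddMonoidAlgebra.coeff_single, AddMonoidAlgebra.coeff_single,
        Finsupp.single_apply, Finsupp.single_apply]
      simp only [(h.pullbackDual_injective hρ).eq_iff]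
    · rw [orbitRingMap_single_of_notMem h hσ hρ hm, AddMonoidAlgebra.coeff_single,
        Finsupp.single_apply, if_neg]
      · rfl
      · rintro rfl
        exact hm ((h.mem_range_pullbackDual hρ _).mp ⟨n, rfl⟩)

lemma orbitRingMap_surjective {τ : PointedCone ℝ A.space} {ρ : PointedCone ℝ B.space}
    (hσ : h.cone ≤ τ) (hρ : τ.map h.realMap = ρ) :
    Function.Surjective (h.orbitRingMap k hσ hρ) := by
  intro b
  induction b using AddMonoidAlgebra.induction_linear with
  | zero => exact ⟨0, map_zero _⟩
  | add b c hb hc =>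
    obtain ⟨b, rfl⟩ := hb
    obtain ⟨c, rfl⟩ := hc
    exact ⟨b + c, map_add _ _ _⟩
  | single n r => exact ⟨_, h.orbitRingMap_single hσ hρ n r⟩

lemma isClosedImmersion_orbitChartMap {τ : A.Cone} {ρ : B.Cone} (hσ : h.cone ≤ τ.1)
    (hρ : τ.1.map h.realMap = ρ.1) : IsClosedImmersion (h.orbitChartMap k hσ hρ) :=
  IsClosedImmersion.spec_of_surjective _ (h.orbitRingMap_surjective hσ hρ)

/-- The kernel of the orbit map is generated by the monomials `χ^m` with `m` not vanishing on the
cone, so a prime containing these lies on the orbit closure. -/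
lemma mem_range_orbitChartMap {τ : A.Cone} {ρ : B.Cone} (hσ : h.cone ≤ τ.1)
    (hρ : τ.1.map h.realMap = ρ.1) (p : (A.charts k).obj τ)
    (hp : ∀ m : dualMonoid τ.1, (¬ ∀ x ∈ h.cone, realPairing m.1 x = 0) →
      (AddMonoidAlgebra.single m 1 : ConeRing k τ.1) ∈ p.asIdeal) :
    p ∈ Set.range (h.orbitChartMap k hσ hρ) := by
  refine (mem_range_SpecMap_of_surjective
    (f := CommRingCat.ofHom (h.orbitRingMap k hσ hρ)) (h.orbitRingMap_surjective hσ hρ)).mpr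
    fun (a : ConeRing k τ.1) (ha : h.orbitRingMap k hσ hρ a = 0) => ?_
  have hsum : a = a.coeff.sum fun m r => AddMonoidAlgebra.single m r := by
    apply AddMonoidAlgebra.coeff_injective
    rw [AddMonoidAlgebra.coeff_finsuppSum]
    exact (Finsupp.sum_single a.coeff).symm
  change a ∈ p.asIdeal
  rw [hsum]
  refine Submodule.sum_mem _ fun m hm => ?_
  have h1 : AddMonoidAlgebra.single m (a.coeff m) =
      AddMonoidAlgebra.single 0 (a.coeff m) * (AddMonoidAlgebra.single m 1 : ConeRing k τ.1) := by
    rw [AddMonoidAlgebra.single_mul_single, zero_add, mul_one]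
  refine (congrArg (· ∈ p.asIdeal) h1).mpr ?_
  refine Ideal.mul_mem_left _ _ (hp m fun hm' => ?_)
  obtain ⟨n, rfl⟩ := (h.mem_range_pullbackDual hρ m).mpr hm'
  rw [Finsupp.mem_support_iff] at hm
  apply hm
  rw [← h.orbitRingMap_apply hσ hρ, ha]
  rfl

/-- The preimage of the chart `U_τ` under `T(Σ/σ) ⟶ T(Σ)`. -/
lemma mem_range_toricChart_of_toricMap {τ : A.Cone} {z : B.toricVariety k}
    (hz : h.toricMap k z ∈ Set.range (A.toricChart k τ)) :
    ∃ hσ : h.cone ≤ τ.1, z ∈ Set.range (B.toricChart k (h.mapCone hσ)) := by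
  obtain ⟨ρ', y, rfl⟩ := B.exists_toricChart_eq k z
  obtain ⟨x, hx⟩ := hz
  have hσ' := h.cone_le_lift ρ'
  have hρ' := h.map_lift ρ'
  set τ' := h.lift ρ'
  have h1 : h.toricMap k (B.toricChart k ρ' y) =
      A.toricChart k τ' (h.orbitChartMap k hσ' hρ' y) :=
    congr($(h.toricChart_comp_toricMap k hσ' hρ') y)
  -- The point lies in the charts of `τ'` and `τ`, hence in that of a common smaller cone `υ`, a
  -- face of `τ'` cut out by some `m`. So `χ^m` is nonzero at the point.
  obtain ⟨υ, hυ', hυ, hmem⟩ := exists_of_toricChart_eq k (h1.symm.trans hx.symm)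
  obtain ⟨m, hm⟩ := A.isRationalFace_of_le τ'.2 υ.2 hυ'
  let I : Ideal (ConeRing k ρ'.1) := y.asIdeal
  replace hmem := (mem_range_coneChartMap k (A.rational _ τ'.2) hυ' hm _).mp hmem
  replace hmem : h.orbitRingMap k hσ' hρ' (AddMonoidAlgebra.single (⟨m, hm.1⟩ : dualMonoid τ'.1) 1)
      ∉ I := hmem
  -- The function `χ^m` restricts to zero on the orbit closure unless `m` vanishes on the cone of
  -- `h`. Hence that cone lies in `υ`.
  have hm0 : ∀ x ∈ h.cone, realPairing m x = 0 := by
    by_contra hm0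
    rw [h.orbitRingMap_single_of_notMem hσ' hρ' (m := ⟨m, hm.1⟩) hm0] at hmem
    exact hmem I.zero_mem
  have hσυ : h.cone ≤ υ.1 := fun x hx => (hm.2 x).mpr ⟨hσ' hx, hm0 x hx⟩
  have hστ : h.cone ≤ τ.1 := hσυ.trans hυ
  refine ⟨hστ, ?_⟩
  obtain ⟨n, hn⟩ : ∃ n, h.pullbackDual hρ' n = (⟨m, hm.1⟩ : dualMonoid τ'.1) :=
    (h.mem_range_pullbackDual hρ' _).mpr hm0
  rw [← hn, h.orbitRingMap_single] at hmem
  have hn' : n.1 ∘ₗ h.map = m := congrArg Subtype.val hn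
  have hle : h.mapCone hσυ ≤ ρ' := by
    change υ.1.map h.realMap ≤ ρ'.1
    rw [← hρ']
    exact Submodule.map_mono hυ'
  -- The covector `n` induced by `m` on the quotient cuts out the image of `υ`, so the point lies in
  -- the chart of that image.
  have hcut : CutsOut n.1 (h.mapCone hσυ).1 ρ'.1 := by
    refine ⟨n.2, fun x => ⟨fun hx => ?_, ?_⟩⟩
    · refine ⟨hle hx, ?_⟩
      obtain ⟨t, ht, rfl⟩ := PointedCone.mem_map.mp hx
      rw [← realPairing_comp, hn']
      exact ((hm.2 t).mp ht).2
    · rintro ⟨hx, hx0⟩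
      rw [← hρ'] at hx
      obtain ⟨t, ht, rfl⟩ := PointedCone.mem_map.mp hx
      rw [← realPairing_comp, hn'] at hx0
      exact PointedCone.mem_map.mpr ⟨t, (hm.2 t).mpr ⟨ht, hx0⟩, rfl⟩
  obtain ⟨y, rfl⟩ := (mem_range_coneChartMap k (B.rational _ ρ'.2) hle hcut y).mpr hmem
  refine range_toricChart_mono k (σ := h.mapCone hσυ) (τ := h.mapCone hστ) ?_
    ⟨y, (toricChart_of_le k hle y).symm⟩
  exact Submodule.map_mono (p := υ.1) (p' := τ.1) hυ

lemma toricMap_toricChart {τ : A.Cone} (hσ : h.cone ≤ τ.1) (y : (B.charts k).obj (h.mapCone hσ)) :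
    h.toricMap k (B.toricChart k (h.mapCone hσ) y) =
      A.toricChart k τ (h.orbitChartMap k hσ rfl y) :=
  congr($(h.toricChart_comp_toricMap k (ρ := h.mapCone hσ) hσ rfl) y)

lemma preimage_opensRange_toricChart {τ : A.Cone} (hσ : h.cone ≤ τ.1) :
    h.toricMap k ⁻¹ᵁ (A.toricChart k τ).opensRange =
      (B.toricChart k (h.mapCone hσ)).opensRange := by
  ext z
  constructor
  · intro hz
    exact (h.mem_range_toricChart_of_toricMap hz).2
  · rintro ⟨y, rfl⟩
    exact ⟨_, (h.toricMap_toricChart hσ y).symm⟩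

lemma preimage_opensRange_toricChart_of_not_le {τ : A.Cone} (hσ : ¬ h.cone ≤ τ.1) :
    h.toricMap k ⁻¹ᵁ (A.toricChart k τ).opensRange = ⊥ := by
  rw [eq_bot_iff]
  intro z hz
  exact hσ (h.mem_range_toricChart_of_toricMap hz).1

variable (k) in
lemma toricMap_injective : Function.Injective (h.toricMap k) := by
  intro z z' hzz
  obtain ⟨τ, x, hx⟩ := A.exists_toricChart_eq k (h.toricMap k z)
  obtain ⟨hσ, y, rfl⟩ := h.mem_range_toricChart_of_toricMap ⟨x, hx⟩
  obtain ⟨_, y', rfl⟩ := h.mem_range_toricChart_of_toricMap (z := z') ⟨x, hx.trans hzz⟩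
  rw [toricMap_toricChart, toricMap_toricChart] at hzz
  have := h.isClosedImmersion_orbitChartMap (k := k) (ρ := h.mapCone hσ) hσ rfl
  have h1 := (A.toricChart k τ).isOpenEmbedding.injective hzz
  have h2 := (h.orbitChartMap k (ρ := h.mapCone hσ) hσ rfl).isClosedEmbedding.injective h1
  rw [h2]

/-- Over the chart of `τ` the orbit closure is either empty or a single chart, embedded by the
spectrum of a surjection. Closedness of images is checked on these charts of the target,
surjectivity on stalks on charts of the source. -/
instance isClosedImmersion_toricMap : IsClosedImmersion (h.toricMap k) := by
  refine isClosedImmersion_of_charts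
    (.of_continuous_injective_isClosedMap (h.toricMap k).continuous (h.toricMap_injective k) ?_) ?_
  · intro Z hZ
    rw [← isOpen_compl_iff, isOpen_iff_forall_mem_open]
    intro z hz
    obtain ⟨τ, x, rfl⟩ := A.exists_toricChart_eq k z
    have hcl : IsClosed (A.toricChart k τ ⁻¹' (h.toricMap k '' Z)) := by
      by_cases hσ : h.cone ≤ τ.1
      · have := h.isClosedImmersion_orbitChartMap (k := k) (ρ := h.mapCone hσ) hσ rfl
        have heq : A.toricChart k τ ⁻¹' (h.toricMap k '' Z) =
            h.orbitChartMap k (ρ := h.mapCone hσ) hσ rfl ''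
              (B.toricChart k (h.mapCone hσ) ⁻¹' Z) := by
          ext x
          constructor
          · rintro ⟨w, hw, hwx⟩
            obtain ⟨_, y, rfl⟩ := h.mem_range_toricChart_of_toricMap ⟨x, hwx.symm⟩
            rw [toricMap_toricChart] at hwx
            exact ⟨y, hw, (A.toricChart k τ).isOpenEmbedding.injective hwx⟩
          · rintro ⟨y, hy, rfl⟩
            exact ⟨_, hy, h.toricMap_toricChart hσ y⟩
        rw [heq]
        exact (h.orbitChartMap k (ρ := h.mapCone hσ) hσ rfl).isClosedEmbedding.isClosedMap _
          (hZ.preimage (B.toricChart k (h.mapCone hσ)).continuous)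
      · have heq : A.toricChart k τ ⁻¹' (h.toricMap k '' Z) = ∅ := by
          rw [Set.eq_empty_iff_forall_notMem]
          rintro x ⟨w, -, hwx⟩
          exact hσ (h.mem_range_toricChart_of_toricMap ⟨x, hwx.symm⟩).1
        rw [heq]
        exact isClosed_empty
    refine ⟨_, ?_, (A.toricChart k τ).isOpenEmbedding.isOpenMap _ hcl.isOpen_compl, x, hz, rfl⟩
    rintro _ ⟨y, hy, rfl⟩
    exact hy
  · intro z
    obtain ⟨ρ, y, rfl⟩ := B.exists_toricChart_eq k z
    exact ⟨_, _, h.orbitChartMap k (h.cone_le_lift ρ) (h.map_lift ρ), B.toricChart k ρ,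
      A.toricChart k (h.lift ρ), h.isClosedImmersion_orbitChartMap _ _, inferInstance,
      inferInstance, ⟨y, rfl⟩, (h.toricChart_comp_toricMap k _ _).symm⟩

end Hom

/-- The torus orbit containing a given point. -/
lemma exists_mem_range_toricMap_iff {k : Type u} [CommRing k] (z : A.toricVariety k) :
    ∃ τ : A.Cone, z ∈ Set.range (A.toricChart k τ) ∧
      ∀ (B : ToricFan.{u}) (h : Hom A B), z ∈ Set.range (h.toricMap k) ↔ h.cone ≤ τ.1 := by
  obtain ⟨σ, x, hx⟩ := A.exists_toricChart_eq k z
  -- The orbit of `z` belongs to a minimal cone whose chart contains `z`.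
  obtain ⟨τ, hτ, hmin⟩ := (Set.toFinite {τ : A.Cone | z ∈ Set.range (A.toricChart k τ)}).exists_minimal
    ⟨σ, x, hx⟩
  refine ⟨τ, hτ, fun B h => ⟨?_, fun hσ => ?_⟩⟩
  · rintro ⟨w, rfl⟩
    exact (h.mem_range_toricChart_of_toricMap hτ).1
  · obtain ⟨p, rfl⟩ := hτ
    obtain ⟨y, rfl⟩ := h.mem_range_orbitChartMap (ρ := h.mapCone hσ) hσ rfl p fun m hm => by
      have hface : ∃ υ : PointedCone ℝ A.space, CutsOut m.1 υ τ.1 := by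
        refine ⟨τ.1 ⊓ PointedCone.comap (-realPairing m.1) (PointedCone.positive ℝ ℝ), m.2,
          fun x => ⟨fun hx => ⟨hx.1, ?_⟩, fun hx => ⟨hx.1, ?_⟩⟩⟩
        · have h1 := m.2 x hx.1
          have h2 : 0 ≤ -realPairing m.1 x := hx.2
          linarith
        · change 0 ≤ -realPairing m.1 x
          rw [hx.2, neg_zero]
      obtain ⟨υ, hυ⟩ := hface
      have hle : υ ≤ τ.1 := fun x hx => ((hυ.2 x).mp hx).1
      have hυ' : υ ∈ A.cones := A.face_mem τ.1 τ.2 υ ⟨_, hυ⟩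
      -- If `χ^m` were nonzero at the point, then the point would lie in the chart of the face of
      -- `τ` where `m` vanishes. By minimality this face is all of `τ`, so `m` would vanish on the
      -- cone of `h`.
      by_contra hp
      obtain ⟨q, hq⟩ := (mem_range_coneChartMap k (A.rational _ τ.2) hle hυ p).mpr hp
      have := hmin (y := ⟨υ, hυ'⟩) ⟨q, by
        rw [← hq]; exact (toricChart_of_le k (σ := ⟨υ, hυ'⟩) (τ := τ) hle q).symm⟩ hle
      exact hm fun x hx => ((hυ.2 x).mp (this (hσ hx))).2
    exact ⟨_, h.toricMap_toricChart hσ y⟩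

end ToricFan

/-! ### Sections over an affine chart as elements of its ring -/

namespace AlgebraicGeometry.Scheme

section Eval

variable {R S : CommRingCat.{u}} {X Y : Scheme.{u}}

/-- The pullback of sections along a morphism from an affine scheme. -/
def evalSpec (χ : Spec R ⟶ X) (U : X.Opens) (h : ⊤ ≤ χ ⁻¹ᵁ U) : Γ(X, U) ⟶ R :=
  χ.appLE U ⊤ h ≫ (ΓSpecIso R).hom

lemma bijective_evalSpec (χ : Spec R ⟶ X) [hχ : IsOpenImmersion χ] (U : X.Opens) (h : ⊤ ≤ χ ⁻¹ᵁ U)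
    (hU : U = χ.opensRange) : Function.Bijective (evalSpec χ U h) := by
  rw [← ConcreteCategory.isIso_iff_bijective]
  have h1 := χ.isIso_app U hU.le
  have h2 : IsIso (χ.appLE U ⊤ h) := by
    have : IsIso (χ.app U) := h1
    rw [Scheme.Hom.appLE]
    have : χ ⁻¹ᵁ U = ⊤ := top_le_iff.mp h
    have h3 : IsIso (homOfLE h) := ⟨homOfLE le_top, rfl, rfl⟩
    infer_instance
  rw [evalSpec]
  infer_instance

lemma evalSpec_appLE {χ : Spec R ⟶ X} {χ' : Spec S ⟶ Y} {φ : R ⟶ S} {f : Y ⟶ X}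
    (w : χ' ≫ f = Spec.map φ ≫ χ) (U : X.Opens) (V : Y.Opens) (hU : ⊤ ≤ χ ⁻¹ᵁ U)
    (hV : ⊤ ≤ χ' ⁻¹ᵁ V) (hf : V ≤ f ⁻¹ᵁ U) (s : Γ(X, U)) :
    evalSpec χ' V hV (f.appLE U V hf s) = φ (evalSpec χ U hU s) := by
  have h1 : f.appLE U V hf ≫ χ'.appLE V ⊤ hV = χ.appLE U ⊤ hU ≫ (Spec.map φ).appLE ⊤ ⊤ le_top := by
    have hl : ∀ (g : Spec S ⟶ X) (_ : χ' ≫ f = g) (e : ⊤ ≤ g ⁻¹ᵁ U),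
        f.appLE U V hf ≫ χ'.appLE V ⊤ hV = g.appLE U ⊤ e := by
      rintro _ rfl e
      exact Scheme.Hom.appLE_comp_appLE χ' f U V ⊤ hf hV
    exact (hl _ w (by rw [← w]; exact fun x hx => hf (hV hx))).trans
      (Scheme.Hom.appLE_comp_appLE (Spec.map φ) χ U ⊤ ⊤ hU le_top).symm
  have h2 : f.appLE U V hf ≫ evalSpec χ' V hV = evalSpec χ U hU ≫ φ := by
    rw [evalSpec, reassoc_of% h1, evalSpec, Category.assoc, ← Scheme.ΓSpecIso_naturality]
    exact congrArg (fun g => χ.appLE U ⊤ hU ≫ g ≫ (ΓSpecIso S).hom)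
      (Scheme.Hom.app_eq_appLE (Spec.map φ) (U := ⊤)).symm
  exact congr($h2 s)

end Eval

end AlgebraicGeometry.Scheme

/-! ### Reducedness of toric varieties and gluing of functions on orbit closures -/

namespace ToricFan

variable {A : ToricFan.{u}}

/-- A lattice basis embeds the dual monoid in a finite power of `ℤ`. This property makes the monoid
algebra over a field a domain, whence toric varieties are reduced. -/
instance (σ : PointedCone ℝ A.space) : TwoUniqueSums (dualMonoid σ) :=
  let b := Module.Free.chooseBasis ℤ A.lattice
  let φ : dualMonoid σ →+ (Module.Free.ChooseBasisIndex ℤ A.lattice → ℤ) :=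
    { toFun := fun m i => m.1 (b i)
      map_zero' := rfl
      map_add' := fun _ _ => rfl }
  .of_injective_addHom φ.toAddHom (fun _ _ h => Subtype.ext (b.ext fun i => congrFun h i))
    inferInstance

instance (k : Type u) [Field k] : IsReduced (A.toricVariety k) := by
  have : ∀ z : A.toricVariety k, _root_.IsReduced ((A.toricVariety k).presheaf.stalk z) := fun z => by
    obtain ⟨σ, x, rfl⟩ := A.exists_toricChart_eq k z
    have : IsReduced ((A.charts k).obj σ) := by
      have : IsDomain (ConeRing k σ.1) := NoZeroDivisors.to_isDomain _
      change IsReduced (Spec (CommRingCat.of (ConeRing k σ.1)))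
      infer_instance
    have h6 : Function.Bijective ((A.toricChart k σ).stalkMap x) :=
      (ConcreteCategory.isIso_iff_bijective _).mp inferInstance
    exact isReduced_of_injective ((A.toricChart k σ).stalkMap x).hom h6.1
  exact isReduced_of_isReduced_stalk _

section Boundary

/-- The nonzero cones of a fan. -/
abbrev NonzeroCone (A : ToricFan.{u}) : Type u := {σ : A.Cone // σ.1 ≠ ⊥}

variable {D : A.NonzeroCone ⥤ ToricFan.{u}} {h : ∀ σ, A ⟶ D.obj σ}
  (hc : ∀ σ, Hom.cone (h σ) = σ.1.1) (hw : ∀ {σ τ} (f : σ ⟶ τ), h σ ≫ D.map f = h τ)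

-- Gluing is done monomial by monomial. The monomial `χ^m` survives on the orbit closure of `σ`
-- exactly if `σ` lies in the face `υ` of `τ` on which `m` vanishes. If `υ` is nonzero, then
-- compatibility along `σ ≤ υ` forces all available coefficients of `χ^m` to equal the one on the
-- orbit closure of `υ`.
include hc hw in
lemma exists_orbitRingMap_eq {k : Type u} [CommRing k] (τ : A.Cone)
    (hle : ∀ {σ : A.NonzeroCone}, σ.1 ≤ τ → Hom.cone (h σ) ≤ τ.1)
    (t : ∀ σ : A.NonzeroCone, σ.1 ≤ τ → ConeRing k (τ.1.map (Hom.realMap (h σ))))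
    (ht : ∀ {σ σ' : A.NonzeroCone} (f : σ ⟶ σ') (hσ : σ.1 ≤ τ) (hσ' : σ'.1 ≤ τ)
      (ha : Hom.cone (D.map f) ≤ τ.1.map (Hom.realMap (h σ)))
      (hb : (τ.1.map (Hom.realMap (h σ))).map (Hom.realMap (D.map f)) =
        τ.1.map (Hom.realMap (h σ'))),
      Hom.orbitRingMap (D.map f) k ha hb (t σ hσ) = t σ' hσ') :
    ∃ r : ConeRing k τ.1, ∀ (σ : A.NonzeroCone) (hσ : σ.1 ≤ τ),
      Hom.orbitRingMap (h σ) k (hle hσ) rfl r = t σ hσ := by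
  -- The second clause, that a nonzero coefficient is witnessed on some orbit closure, makes the
  -- support of the glued function finite.
  have key : ∀ m : dualMonoid τ.1, ∃ c : k,
      (∀ (σ : A.NonzeroCone) (hσ : σ.1 ≤ τ) (n : dualMonoid (τ.1.map (Hom.realMap (h σ)))),
        Hom.pullbackDual (h σ) rfl n = m → (t σ hσ).coeff n = c) ∧
      (c ≠ 0 → ∃ (σ : A.NonzeroCone) (hσ : σ.1 ≤ τ)
        (n : dualMonoid (τ.1.map (Hom.realMap (h σ)))),
        (t σ hσ).coeff n ≠ 0 ∧ Hom.pullbackDual (h σ) rfl n = m) := by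
    intro m
    by_cases hm : ∃ (σ : A.NonzeroCone) (hσ : σ.1 ≤ τ)
        (n : dualMonoid (τ.1.map (Hom.realMap (h σ)))), Hom.pullbackDual (h σ) rfl n = m
    swap
    -- Such a monomial vanishes on every orbit closure considered. Its coefficient is unconstrained
    -- and is set to zero.
    · exact ⟨0, fun σ hσ n hn => absurd ⟨σ, hσ, n, hn⟩ hm, fun h0 => absurd rfl h0⟩
    obtain ⟨υ, hυ⟩ : ∃ υ : PointedCone ℝ A.space, CutsOut m.1 υ τ.1 := by
      refine ⟨τ.1 ⊓ PointedCone.comap (-realPairing m.1) (PointedCone.positive ℝ ℝ), m.2,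
        fun x => ⟨fun hx => ⟨hx.1, ?_⟩, fun hx => ⟨hx.1, ?_⟩⟩⟩
      · have h1 := m.2 x hx.1
        have h2 : 0 ≤ -realPairing m.1 x := hx.2
        linarith
      · change 0 ≤ -realPairing m.1 x
        rw [hx.2, neg_zero]
    have hυ' : υ ∈ A.cones := A.face_mem τ.1 τ.2 υ ⟨_, hυ⟩
    have hυτ : υ ≤ τ.1 := fun x hx => ((hυ.2 x).mp hx).1
    have hσυ : ∀ (σ : A.NonzeroCone) (_ : σ.1 ≤ τ)
        (n : dualMonoid (τ.1.map (Hom.realMap (h σ)))),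
        Hom.pullbackDual (h σ) rfl n = m → σ.1.1 ≤ υ := by
      intro σ hσ n hn x hx
      refine (hυ.2 x).mpr ⟨hσ hx, ?_⟩
      exact (Hom.mem_range_pullbackDual (h σ) rfl m).mp ⟨n, hn⟩ x (by rw [hc]; exact hx)
    obtain ⟨σ₀, hσ₀, n₀, hn₀⟩ := hm
    have hbot : υ ≠ ⊥ := by
      rintro rfl
      exact σ₀.2 (le_bot_iff.mp (hσυ σ₀ hσ₀ n₀ hn₀))
    let u : A.NonzeroCone := ⟨⟨υ, hυ'⟩, hbot⟩
    have hu : u.1 ≤ τ := hυτ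
    obtain ⟨l, hl⟩ := (Hom.mem_range_pullbackDual (h u) rfl m).mpr fun x hx => by
      rw [hc] at hx
      exact ((hυ.2 x).mp hx).2
    refine ⟨(t u hu).coeff l, fun σ hσ n hn => ?_, fun h0 => ⟨u, hu, l, h0, hl⟩⟩
    let f : σ ⟶ u := homOfLE (hσυ σ hσ n hn)
    have hcone := (Hom.map_comp_cone_eq (h σ) (D.map f)).symm
    have e1 : (Hom.comp (h σ) (D.map f)) = h u := hw f
    have e2 : Hom.map (h u) = Hom.map (D.map f) ∘ₗ Hom.map (h σ) := by rw [← e1]; rfl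
    have hb : (τ.1.map (Hom.realMap (h σ))).map (Hom.realMap (D.map f)) =
        τ.1.map (Hom.realMap (h u)) := by
      rw [← e1]
      exact (Hom.map_comp_cone (D.map f) (h σ) τ.1).symm
    have ha : Hom.cone (D.map f) ≤ τ.1.map (Hom.realMap (h σ)) := by
      rw [hcone, e1, hc]
      exact Submodule.map_mono hυτ
    rw [← ht f hσ hu ha hb, Hom.orbitRingMap_apply]
    congr 1
    refine Hom.pullbackDual_injective (h σ) rfl ?_
    rw [hn, ← hl]
    refine Subtype.ext ?_
    change l.1 ∘ₗ Hom.map (h u) = (l.1 ∘ₗ Hom.map (D.map f)) ∘ₗ Hom.map (h σ)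
    exact congrArg (l.1 ∘ₗ ·) e2
  choose c hc₁ hc₂ using key
  have hfin : (Function.support c).Finite := by
    refine Set.Finite.subset (s := ⋃ (σ : A.NonzeroCone) (hσ : σ.1 ≤ τ),
      Hom.pullbackDual (h σ) rfl '' (t σ hσ).coeff.support)
      (Set.finite_iUnion fun σ => Set.finite_iUnion fun hσ => (Finset.finite_toSet _).image _) ?_
    intro m hm
    obtain ⟨σ, hσ, n, hn, hnm⟩ := hc₂ m hm
    exact Set.mem_iUnion₂.mpr ⟨σ, hσ, n, Finsupp.mem_support_iff.mpr hn, hnm⟩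
  refine ⟨.ofCoeff (Finsupp.ofSupportFinite c hfin), fun σ hσ => ?_⟩
  apply AddMonoidAlgebra.coeff_injective
  ext n
  rw [Hom.orbitRingMap_apply]
  exact (hc₁ _ σ hσ n rfl).symm

end Boundary

end ToricFan

/-! ### Finite unions of reduced closed subschemes as colimits -/

namespace AlgebraicGeometry

lemma Scheme.app_appLE_of_comp_eq {X Y Z : Scheme.{u}} {f : X ⟶ Y} {g : Y ⟶ Z} {l : X ⟶ Z}
    (w : f ≫ g = l) (U : Z.Opens) (V : X.Opens) (e : V ≤ f ⁻¹ᵁ g ⁻¹ᵁ U) (e' : V ≤ l ⁻¹ᵁ U)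
    (s : Γ(Z, U)) : f.appLE (g ⁻¹ᵁ U) V e (g.app U s) = l.appLE U V e' s := by
  subst w
  exact congr($((Scheme.Hom.comp_appLE f g U V e').symm) s)

lemma Scheme.app_app_of_comp_eq {X Y Z : Scheme.{u}} {f : X ⟶ Y} {g : Y ⟶ Z} {l : X ⟶ Z}
    (w : f ≫ g = l) (U : Z.Opens) (s : Γ(Z, U)) :
    f.app (g ⁻¹ᵁ U) (g.app U s) = l.appLE U (f ⁻¹ᵁ g ⁻¹ᵁ U) (by rw [← w]; rfl) s := by
  rw [Scheme.Hom.app_eq_appLE]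
  exact Scheme.app_appLE_of_comp_eq w U _ _ _ s

/-- Sections of a glued cocone are determined by their pullbacks to the members of the diagram, and
nilpotent sections pull back to zero there. -/
lemma Scheme.isReduced_of_isGlued {J : Type v} [Category.{w} J] {F : J ⥤ Scheme.{u}}
    {c : Cocone F}
    (hc : LocallyRingedSpace.IsGlued (Scheme.forgetToLocallyRingedSpace.mapCocone c))
    (h : ∀ j, IsReduced (F.obj j)) : IsReduced c.pt := by
  have key : ∀ j (W : c.pt.Opens) (t : Γ(c.pt, W)), LocallyRingedSpace.pullSec
      (X := (F.obj j).1) (Y := c.pt.1)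
      (c.ι.app j).toLRSHom W (LocallyRingedSpace.preim (c.ι.app j).toLRSHom W)
        (LocallyRingedSpace.preim_self _ _) t = (c.ι.app j).app W t := fun j W t =>
    congr($(LocallyRingedSpace.pullSec_preim (c.ι.app j).toLRSHom W) t)
  refine ⟨fun W => ⟨fun s hs => ?_⟩⟩
  refine (hc.sections W).inj s 0 fun j => ?_
  have h1 : IsNilpotent ((c.ι.app j).app W s) := hs.map ((c.ι.app j).app W).hom
  exact (key j W s).trans ((h1.eq_zero.trans (map_zero ((c.ι.app j).app W).hom).symm).trans
    (key j W 0).symm)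

/-- The union of finitely many reduced closed subschemes, as a colimit. -/
theorem exists_isColimit_of_isClosedImmersion {J : Type v} [Category.{w} J] [Finite J]
    [∀ i j : J, Finite (i ⟶ j)] {F : J ⥤ Scheme.{u}} (c : Cocone F)
    [∀ j, IsClosedImmersion (c.ι.app j)] [∀ j, IsReduced (F.obj j)]
    (fiber : ∀ {i j : J} (x : F.obj i) (y : F.obj j), c.ι.app i x = c.ι.app j y →
      ∃ (l : J) (a : l ⟶ i) (b : l ⟶ j) (z : F.obj l), F.map a z = x ∧ F.map b z = y)
    (sections : ∀ z : c.pt, ∃ U : c.pt.Opens, IsAffineOpen U ∧ z ∈ U ∧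
      ∀ s : ∀ j, Γ(F.obj j, c.ι.app j ⁻¹ᵁ U),
        (∀ {i j : J} (a : i ⟶ j),
          (F.map a).appLE _ _ (Scheme.cocone_preimage_le c U a) (s j) = s i) →
        ∃ t : Γ(c.pt, U), ∀ j, (c.ι.app j).app U t = s j) :
    ∃ (b : Cocone F) (ι : b.pt ⟶ c.pt), Nonempty (IsColimit b) ∧ IsClosedImmersion ι ∧
      IsReduced b.pt ∧ (∀ j, b.ι.app j ≫ ι = c.ι.app j) ∧
      Set.range ι = ⋃ j, Set.range (c.ι.app j) := by
  -- The union is the closed subscheme of the intersection of the kernels, so a function on it is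
  -- zero if and only if it is zero on every member. This is the injectivity half of gluing.
  let I : c.pt.IdealSheafData := ⨅ j, (c.ι.app j).ker
  obtain ⟨B, ι, hι, hI⟩ : ∃ (B : Scheme.{u}) (ι : B ⟶ c.pt), IsClosedImmersion ι ∧ ι.ker = I :=
    ⟨_, I.subschemeι, inferInstance, Scheme.IdealSheafData.ker_subschemeι _⟩
  have hker : ∀ j, ι.ker ≤ (c.ι.app j).ker := fun j => by
    rw [hI]
    exact iInf_le _ j
  obtain ⟨δ, hδ⟩ : ∃ δ : ∀ j, F.obj j ⟶ B, ∀ j, δ j ≫ ι = c.ι.app j :=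
    ⟨fun j => IsClosedImmersion.lift ι (c.ι.app j) (hker j),
      fun j => IsClosedImmersion.lift_fac _ _ _⟩
  let b : Cocone F :=
    { pt := B
      ι :=
        { app := δ
          naturality := fun i j a => by
            rw [← cancel_mono ι, Category.assoc, hδ, c.w, Functor.const_obj_map]
            exact ((congrArg (· ≫ ι) (Category.comp_id (δ i))).trans (hδ i)).symm } }
  have hδcl : ∀ j, IsClosedImmersion (δ j) := fun j => by
    have : IsClosedImmersion (δ j ≫ ι) := by rw [hδ]; infer_instance
    exact IsClosedImmersion.of_comp (δ j) ι
  have hιinj : Function.Injective ι := ι.isClosedEmbedding.injective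
  have hpt : ∀ j (x : F.obj j), ι (δ j x) = c.ι.app j x := fun j x => congr($(hδ j) x)
  have hpre : ∀ j (U : c.pt.Opens), δ j ⁻¹ᵁ ι ⁻¹ᵁ U = c.ι.app j ⁻¹ᵁ U := fun j U => by
    rw [← Scheme.Hom.comp_preimage, hδ]
  have hsec : ∀ (U : c.pt.Opens) (_ : IsAffineOpen U) (s : Γ(c.pt, U)),
      (∀ j, (c.ι.app j).app U s = 0) → ι.app U s = 0 := by
    intro U hU s hs
    have h1 : s ∈ I.ideal ⟨U, hU⟩ := by
      rw [Scheme.IdealSheafData.ideal_iInf, iInf_apply, Ideal.mem_iInf]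
      intro j
      rw [Scheme.Hom.ker_apply]
      exact hs j
    rw [← hI, Scheme.Hom.ker_apply] at h1
    exact h1
  have hsurj : ∀ z : B, ∃ j x, δ j x = z := by
    intro z
    by_cases hz : ι z ∈ ⋃ j, Set.range (c.ι.app j)
    · obtain ⟨j, x, hx⟩ := Set.mem_iUnion.mp hz
      exact ⟨j, x, hιinj ((hpt j x).trans hx)⟩
    · exfalso
      have hclj : ∀ j, IsClosed (Set.range (c.ι.app j) : Set c.pt) := fun j =>
        (c.ι.app j).isClosedEmbedding.isClosed_range
      have hcl : IsClosed (⋃ j, Set.range (c.ι.app j) : Set c.pt) := isClosed_iUnion_of_finite hclj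
      obtain ⟨U, hU, hzU, hle⟩ := exists_isAffineOpen_mem_and_subset (x := ι z)
        (U := ⟨_, hcl.isOpen_compl⟩) hz
      -- On an affine open set that misses every member, `1` lies in all the kernels, so the closed
      -- subscheme has no points there.
      have h0 : ι.app U 1 = 0 := by
        refine hsec U hU 1 fun j => ?_
        have h1 : c.ι.app j ⁻¹ᵁ U = ⊥ := by
          rw [eq_bot_iff]
          exact fun x hx => hle hx (Set.mem_iUnion.mpr ⟨j, x, rfl⟩)
        have : Subsingleton Γ(F.obj j, c.ι.app j ⁻¹ᵁ U) := by
          rw [h1]; infer_instance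
        exact Subsingleton.elim _ _
      have h2 : B.basicOpen (ι.app U 1) = ι ⁻¹ᵁ U := B.basicOpen_of_isUnit (by
        rw [show ι.app U 1 = 1 from map_one _]; exact isUnit_one)
      rw [h0, Scheme.basicOpen_zero] at h2
      have h3 : z ∈ ι ⁻¹ᵁ U := hzU
      rw [← h2] at h3
      exact h3
  have hbaff : ∀ j, IsAffineHom (b.ι.app j) := fun j => by
    have := hδcl j
    exact inferInstanceAs (IsAffineHom (δ j))
  have hglued : LocallyRingedSpace.IsGlued (Scheme.forgetToLocallyRingedSpace.mapCocone b) := by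
    refine Scheme.isGlued hsurj ?_ ?_ ?_
    · intro U hU
      have h3 : Uᶜ = ⋃ j, δ j '' (δ j ⁻¹' Uᶜ) := by
        refine Set.Subset.antisymm (fun z hz => ?_) ?_
        · obtain ⟨j, x, rfl⟩ := hsurj z
          exact Set.mem_iUnion.mpr ⟨j, x, hz, rfl⟩
        · refine Set.iUnion_subset fun j => ?_
          rintro z ⟨x, hx, rfl⟩
          exact hx
      rw [← isClosed_compl_iff, h3]
      exact isClosed_iUnion_of_finite fun j =>
        (δ j).isClosedEmbedding.isClosedMap _ (hU j).isClosed_compl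
    · intro i j x y hxy
      exact fiber x y ((hpt i x).symm.trans ((congrArg ι hxy).trans (hpt j y)))
    · refine Scheme.SectionsGlue.exists_le fun z => ?_
      obtain ⟨U, hU, hzU, hglue⟩ := sections (ι z)
      refine ⟨ι ⁻¹ᵁ U, hU.preimage ι, hzU, ?_, ?_⟩
      · intro s hs
        obtain ⟨r, rfl⟩ := ι.app_surjective U hU s
        refine hsec U hU r fun j => ?_
        have h1 : (δ j).app _ (ι.app _ r) = 0 := hs j
        rw [Scheme.app_app_of_comp_eq (hδ j)] at h1
        have key : ∀ (V : (F.obj j).Opens) (e : V = c.ι.app j ⁻¹ᵁ U),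
            (c.ι.app j).appLE _ V e.le r = 0 → (c.ι.app j).app U r = 0 := by
          rintro _ rfl h2
          rw [Scheme.Hom.app_eq_appLE]
          exact h2
        exact key _ (hpre j _) h1
      · intro s hs
        -- The preimages of `U` through `B` and directly from the vertex of `c` agree only
        -- propositionally; generalizing over `V` allows the substitution.
        have key : ∀ (V : ∀ j, (F.obj j).Opens) (hV : ∀ j, V j = c.ι.app j ⁻¹ᵁ U)
            (e : ∀ {i j : J} (a : i ⟶ j), V i ≤ F.map a ⁻¹ᵁ V j) (s : ∀ j, Γ(F.obj j, V j)),
            (∀ {i j : J} (a : i ⟶ j), (F.map a).appLE _ _ (e a) (s j) = s i) →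
            ∃ t : Γ(c.pt, U), ∀ j, (c.ι.app j).appLE U (V j) (hV j).le t = s j := by
          intro V hV
          obtain rfl : V = fun j => c.ι.app j ⁻¹ᵁ U := funext hV
          intro e s hs
          obtain ⟨t, ht⟩ := hglue s hs
          refine ⟨t, fun j => ?_⟩
          rw [← ht j, Scheme.Hom.app_eq_appLE]
        obtain ⟨t, ht⟩ := key _ (fun j => hpre j U)
          (fun a => Scheme.cocone_preimage_le b _ a) s hs
        exact ⟨ι.app _ t, fun j => (Scheme.app_app_of_comp_eq (hδ j) _ t).trans (ht j)⟩
  refine ⟨b, ι, ⟨isColimitOfReflects Scheme.forgetToLocallyRingedSpace hglued.isColimit⟩,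
    hι, Scheme.isReduced_of_isGlued hglued inferInstance, hδ, ?_⟩
  refine Set.Subset.antisymm ?_ ?_
  · rintro _ ⟨z, rfl⟩
    obtain ⟨j, x, rfl⟩ := hsurj z
    exact Set.mem_iUnion.mpr ⟨j, x, (hpt j x).symm⟩
  · refine Set.iUnion_subset fun j => ?_
    rintro _ ⟨x, rfl⟩
    exact ⟨_, hpt j x⟩

end AlgebraicGeometry

/-! ### The toric boundary as the colimit of the proper orbit closures -/

namespace ToricFan

variable {A : ToricFan.{u}} {D : A.NonzeroCone ⥤ ToricFan.{u}} {h : ∀ σ, A ⟶ D.obj σ}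
  (hc : ∀ σ, Hom.cone (h σ) = σ.1.1) (hw : ∀ {σ τ} (f : σ ⟶ τ), h σ ≫ D.map f = h τ)

-- This is `exists_orbitRingMap_eq` read in terms of sections: over the chart of `τ`, the orbit
-- closure of `σ` is the spectrum of a cone ring if `σ ≤ τ`. Otherwise it is empty and imposes no
-- condition.
include hc hw in
lemma exists_toricBoundary_section (k : Type u) [Field k] (τ : A.Cone)
    (U : ∀ σ, ((D.obj σ).toricVariety k).Opens)
    (hU : ∀ σ, U σ = Hom.toricMap (h σ) k ⁻¹ᵁ (A.toricChart k τ).opensRange)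
    (s : ∀ σ, Γ((D.obj σ).toricVariety k, U σ))
    (e : ∀ {σ σ' : A.NonzeroCone} (f : σ ⟶ σ'), U σ' ≤ Hom.toricMap (D.map f) k ⁻¹ᵁ U σ)
    (hs : ∀ {σ σ' : A.NonzeroCone} (f : σ ⟶ σ'),
      (Hom.toricMap (D.map f) k).appLE (U σ) (U σ') (e f) (s σ) = s σ') :
    ∃ t : Γ(A.toricVariety k, (A.toricChart k τ).opensRange),
      ∀ σ, (Hom.toricMap (h σ) k).appLE _ (U σ) (hU σ).le t = s σ := by
  have hle : ∀ {σ : A.NonzeroCone}, σ.1 ≤ τ → Hom.cone (h σ) ≤ τ.1 := fun {σ} hσ => by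
    rw [hc]; exact hσ
  have hUσ : ∀ (σ : A.NonzeroCone) (hσ : σ.1 ≤ τ),
      U σ = ((D.obj σ).toricChart k (Hom.mapCone (h σ) (hle hσ))).opensRange := fun σ hσ => by
    rw [hU, Hom.preimage_opensRange_toricChart]
  have hUtop : ∀ (σ : A.NonzeroCone) (hσ : σ.1 ≤ τ),
      ⊤ ≤ (D.obj σ).toricChart k (Hom.mapCone (h σ) (hle hσ)) ⁻¹ᵁ U σ := fun σ hσ x _ => by
    rw [hUσ σ hσ]; exact ⟨x, rfl⟩
  have hAtop : ⊤ ≤ A.toricChart k τ ⁻¹ᵁ (A.toricChart k τ).opensRange := fun x _ => ⟨x, rfl⟩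
  let evD : ∀ (σ : A.NonzeroCone) (hσ : σ.1 ≤ τ), Γ((D.obj σ).toricVariety k, U σ) ⟶
      CommRingCat.of (ConeRing k (τ.1.map (Hom.realMap (h σ)))) := fun σ hσ =>
    Scheme.evalSpec ((D.obj σ).toricChart k (Hom.mapCone (h σ) (hle hσ))) (U σ) (hUtop σ hσ)
  let evA : Γ(A.toricVariety k, (A.toricChart k τ).opensRange) ⟶
      CommRingCat.of (ConeRing k τ.1) := Scheme.evalSpec (A.toricChart k τ) _ hAtop
  have evD_bij : ∀ σ hσ, Function.Bijective (evD σ hσ) := fun σ hσ =>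
    Scheme.bijective_evalSpec (hχ := inferInstanceAs (IsOpenImmersion
      ((D.obj σ).toricChart k (Hom.mapCone (h σ) (hle hσ))))) _ _ _ (hUσ σ hσ)
  have evA_bij : Function.Bijective evA := Scheme.bijective_evalSpec
    (hχ := inferInstanceAs (IsOpenImmersion (A.toricChart k τ))) _ _ _ rfl
  obtain ⟨r, hr⟩ := exists_orbitRingMap_eq hc hw (k := k) τ hle (fun σ hσ => evD σ hσ (s σ)) (by
    intro σ σ' f hσ hσ' ha hb
    dsimp only
    rw [← hs f]
    refine (Scheme.evalSpec_appLE
      (φ := CommRingCat.ofHom (Hom.orbitRingMap (D.map f) k ha hb)) ?_ _ _ _ _ _ _).symm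
    exact Hom.toricChart_comp_toricMap (D.map f) k (τ := Hom.mapCone (h σ) (hle hσ))
      (ρ := Hom.mapCone (h σ') (hle hσ')) ha hb)
  obtain ⟨t, rfl⟩ := evA_bij.2 r
  refine ⟨t, fun σ => ?_⟩
  by_cases hσ : σ.1 ≤ τ
  · apply (evD_bij σ hσ).1
    rw [← hr σ hσ]
    exact Scheme.evalSpec_appLE
      (φ := CommRingCat.ofHom (Hom.orbitRingMap (h σ) k (hle hσ) rfl))
      (Hom.toricChart_comp_toricMap (h σ) k (τ := τ)
        (ρ := Hom.mapCone (h σ) (hle hσ)) (hle hσ) rfl) _ _ _ _ _ _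
  · have hbot : U σ = ⊥ := by
      rw [hU]
      exact Hom.preimage_opensRange_toricChart_of_not_le (h σ) (by rw [hc]; exact hσ)
    have : Subsingleton Γ((D.obj σ).toricVariety k, U σ) := by
      rw [hbot]; infer_instance
    exact Subsingleton.elim _ _
include hc hw in
/-- The toric boundary, as the colimit of the proper orbit closures. -/
theorem exists_toricBoundary (k : Type u) [Field k] :
    ∃ (c : CategoryTheory.Limits.Cocone (D.op ⋙ toricFunctor k)) (ι : c.pt ⟶ A.toricVariety k),
      Nonempty (IsColimit c) ∧ IsClosedImmersion ι ∧ IsReduced c.pt ∧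
      (∀ σ, c.ι.app (op σ) ≫ ι = Hom.toricMap (h σ) k) ∧
      Set.range ι = ⋃ σ, Set.range (Hom.toricMap (h σ) k) := by
  have hmap : ∀ {σ τ : A.NonzeroCone} (f : σ ⟶ τ),
      Hom.toricMap (D.map f) k ≫ Hom.toricMap (h σ) k = Hom.toricMap (h τ) k := fun {σ τ} f =>
    (Hom.toricMap_comp (k := k) (h σ) (D.map f)).symm.trans
      (congrArg (fun g => Hom.toricMap g k) (hw f))
  let c : CategoryTheory.Limits.Cocone (D.op ⋙ toricFunctor k) :=
    { pt := A.toricVariety k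
      ι :=
        { app := fun σ => Hom.toricMap (h σ.unop) k
          naturality := fun σ τ f => (hmap f.unop).trans (Category.comp_id _).symm } }
  have : Finite A.NonzeroConeᵒᵖ := Finite.of_equiv _ equivToOpposite
  have : ∀ σ τ : A.NonzeroConeᵒᵖ, Finite (σ ⟶ τ) := fun σ τ =>
    have : Subsingleton (σ ⟶ τ) := ⟨fun f g => Quiver.Hom.unop_inj (Subsingleton.elim _ _)⟩
    Finite.of_subsingleton
  have : ∀ σ, IsClosedImmersion (c.ι.app σ) := fun σ =>
    inferInstanceAs (IsClosedImmersion (Hom.toricMap (h σ.unop) k))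
  have : ∀ σ, IsReduced ((D.op ⋙ toricFunctor k).obj σ) := fun σ =>
    inferInstanceAs (IsReduced ((D.obj σ.unop).toricVariety k))
  obtain ⟨b, ι, hb, hι, hred, hfac, hr⟩ := exists_isColimit_of_isClosedImmersion c (by
    intro σ σ' x y hxy
    -- A common point of the orbit closures of `σ` and `σ'` lies in the orbit of a cone `τ`
    -- containing both, hence comes from the orbit closure of `τ`, which maps to each of them.
    obtain ⟨τ, -, hτ⟩ := exists_mem_range_toricMap_iff (k := k)
      (Hom.toricMap (h σ.unop) k x)
    have h1 : σ.unop.1 ≤ τ := by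
      have := (hτ _ (h σ.unop)).mp ⟨x, rfl⟩
      rwa [hc] at this
    have h2 : σ'.unop.1 ≤ τ := by
      have := (hτ _ (h σ'.unop)).mp ⟨y, hxy.symm⟩
      rwa [hc] at this
    have h3 : τ.1 ≠ ⊥ := fun h0 => σ.unop.2 (le_bot_iff.mp (le_of_le_of_eq (b := τ.1) h1 h0 : σ.unop.1.1 ≤ ⊥))
    let υ : A.NonzeroCone := ⟨τ, h3⟩
    obtain ⟨w, hw'⟩ := (hτ _ (h υ)).mpr (hc υ).le
    let a : σ.unop ⟶ υ := homOfLE h1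
    let b : σ'.unop ⟶ υ := homOfLE h2
    refine ⟨op υ, a.op, b.op, w, ?_, ?_⟩
    · exact Hom.toricMap_injective k (h σ.unop) (congr($(hmap a) w).trans hw')
    · exact Hom.toricMap_injective k (h σ'.unop) ((congr($(hmap b) w).trans hw').trans hxy)) (by
    intro z
    obtain ⟨τ, hz⟩ := exists_toricChart_eq k (A := A) z
    have : IsAffine ((A.charts k).obj τ) := inferInstanceAs (IsAffine (Spec _))
    refine ⟨(A.toricChart k τ).opensRange, isAffineOpen_opensRange _, hz, fun s hs => ?_⟩
    obtain ⟨t, ht⟩ := exists_toricBoundary_section hc hw k τ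
      (fun σ => Hom.toricMap (h σ) k ⁻¹ᵁ (A.toricChart k τ).opensRange) (fun _ => rfl)
      (fun σ => s (op σ)) (fun f => Scheme.cocone_preimage_le c _ f.op) (fun f => hs f.op)
    refine ⟨t, fun σ => ?_⟩
    rw [Scheme.Hom.app_eq_appLE]
    exact ht σ.unop)
  refine ⟨b, ι, hb, hι, hred, fun σ => hfac (op σ), hr.trans ?_⟩
  ext z
  simp only [Set.mem_iUnion]
  exact ⟨fun ⟨σ, hσ⟩ => ⟨σ.unop, hσ⟩, fun ⟨σ, hσ⟩ => ⟨op σ, hσ⟩⟩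

end ToricFan

/-! ### Relative interiors and closedness of cones -/

namespace ToricFan

variable {A : ToricFan.{u}} {σ τ : PointedCone ℝ A.space}

lemma zero_mem_openCone_bot : (0 : A.space) ∈ A.openCone ⊥ :=
  ⟨zero_mem _, fun _ _ h => absurd h not_lt_bot⟩

lemma openCone_bot : A.openCone ⊥ = {0} :=
  Set.eq_singleton_iff_unique_mem.mpr ⟨zero_mem_openCone_bot, fun _ h => h.1⟩

/-- The intersection `σ ⊓ τ` is a face of `σ`; were it proper, the open cone would avoid it. -/
lemma le_of_mem_openCone (hσ : σ ∈ A.cones) (hτ : τ ∈ A.cones) {x : A.space}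
    (hx : x ∈ A.openCone σ) (hx' : x ∈ τ) : σ ≤ τ := by
  by_contra h
  exact hx.2 _ (A.face_mem σ hσ _ (A.inter_face σ hσ τ hτ))
    (inf_le_left.lt_of_not_ge fun h' => h (h'.trans inf_le_right)) ⟨hx.1, hx'⟩

/-- The sum of the generators is interior: a covector that is nonnegative on `σ` and zero on the sum
is zero on each generator, so a face containing the sum is all of `σ`. -/
lemma openCone_nonempty (hσ : σ ∈ A.cones) : (A.openCone σ).Nonempty := by
  obtain ⟨S, hS, hgen⟩ := A.rational σ hσ
  have hmem : ∀ s ∈ S, (1 : ℝ) ⊗ₜ[ℤ] s ∈ σ := fun s hs => by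
    rw [hgen]; exact Submodule.subset_span ⟨s, hs, rfl⟩
  refine ⟨∑ s ∈ hS.toFinset, (1 : ℝ) ⊗ₜ[ℤ] s,
    sum_mem fun s hs => hmem s (hS.mem_toFinset.mp hs), fun τ hτ hlt hx => hlt.not_ge ?_⟩
  obtain ⟨m, hm, hm'⟩ := A.isRationalFace_of_le hσ hτ hlt.le
  have h0 := ((hm' _).mp hx).2
  rw [map_sum, Finset.sum_eq_zero_iff_of_nonneg fun s hs =>
    hm _ (hmem s (hS.mem_toFinset.mp hs))] at h0
  rw [hgen]
  refine Submodule.span_le.mpr ?_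
  rintro _ ⟨s, hs, rfl⟩
  exact (hm' _).mpr ⟨hmem s hs, h0 s (hS.mem_toFinset.mpr hs)⟩

lemma smul_mem_openCone {x : A.space} (hx : x ∈ A.openCone σ) {r : ℝ}
    (hr : 0 < r) : r • x ∈ A.openCone σ :=
  ⟨σ.smul_mem hr.le hx.1, fun τ hτ hlt h => hx.2 τ hτ hlt (by
    have := τ.smul_mem (inv_nonneg.mpr hr.le) h
    rwa [smul_smul, inv_mul_cancel₀ hr.ne', one_smul] at this)⟩

/-- Since `0` is a face, some covector is strictly positive on the nonzero generators. It bounds the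
coefficients of a cone point in terms of its value there, so near `x` the cone is contained in the
image of a compact box, which itself lies in the cone. -/
lemma isClosed_preimage_cone {E : Type*} [NormedAddCommGroup E] [NormedSpace ℝ E]
    [FiniteDimensional ℝ E] (φ : E ≃ₗ[ℝ] A.space) (hσ : σ ∈ A.cones) :
    IsClosed (φ ⁻¹' (σ : Set A.space)) := by
  obtain ⟨S, hS, hgen⟩ := A.rational σ hσ
  obtain ⟨m, hm, hm'⟩ := A.isRationalFace_of_le hσ A.bot_mem bot_le
  -- The zero vector is discarded so that `m` is strictly positive on the remaining generators.
  let T : Set A.space := (fun s : A.lattice => (1 : ℝ) ⊗ₜ[ℤ] s) '' S \ {0}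
  have : Finite T := ((hS.image _).subset Set.sdiff_subset).to_subtype
  have := Fintype.ofFinite T
  have hgen' : σ = PointedCone.hull ℝ (Set.range (Subtype.val : T → A.space)) := by
    rw [hgen, Subtype.range_coe]
    exact (Submodule.span_sdiff_singleton_zero).symm
  have hT : ∀ s : T, s.1 ∈ σ := fun s => by
    rw [hgen']; exact Submodule.subset_span ⟨s, rfl⟩
  have hpos : ∀ s : T, 0 < realPairing m s.1 := fun s => (hm _ (hT s)).lt_of_ne fun h0 =>
    s.2.2 ((hm' _).mpr ⟨hT s, h0.symm⟩)
  let f : (T → ℝ) → E := fun a => ∑ s, a s • φ.symm s.1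
  have hf : Continuous f := by fun_prop
  let L : E →ₗ[ℝ] ℝ := realPairing m ∘ₗ φ.toLinearMap
  have hL : Continuous L := L.continuous_of_finiteDimensional
  refine isClosed_of_closure_subset fun x hx => ?_
  let K : Set (T → ℝ) := Set.univ.pi fun s => Set.Icc 0 ((L x + 1) / realPairing m s.1)
  have hK : IsCompact (f '' K) := (isCompact_univ_pi fun _ => isCompact_Icc).image hf
  have hsub : {y | L y < L x + 1} ∩ φ ⁻¹' (σ : Set A.space) ⊆ f '' K := by
    rintro y ⟨hy, hyσ⟩
    have h1 : φ y ∈ PointedCone.hull ℝ (Set.range (Subtype.val : T → A.space)) := hgen' ▸ hyσ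
    obtain ⟨c, hc⟩ := (Submodule.mem_span_range_iff_exists_fun _).mp h1
    refine ⟨fun s => (c s : ℝ), fun s _ => ⟨(c s).2, ?_⟩, ?_⟩
    · rw [le_div_iff₀ (hpos s)]
      have h2 : L y = ∑ t, (c t : ℝ) * realPairing m t.1 := by
        change realPairing m (φ y) = _
        rw [← hc, map_sum]
        exact Finset.sum_congr rfl fun t _ => (realPairing m).map_smul (c t : ℝ) _
      have h3 : (c s : ℝ) * realPairing m s.1 ≤ L y := by
        rw [h2]
        exact Finset.single_le_sum (f := fun t : T => (c t : ℝ) * realPairing m t.1)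
          (fun t _ => mul_nonneg (c t).2 (hpos t).le) (Finset.mem_univ s)
      exact h3.trans (le_of_lt hy)
    · apply φ.injective
      rw [← hc, map_sum]
      exact Finset.sum_congr rfl fun t _ =>
        (φ.map_smul (c t : ℝ) _).trans (congrArg _ (φ.apply_symm_apply _))
  have hx' : x ∈ f '' K := by
    rw [← hK.isClosed.closure_eq]
    exact closure_mono hsub ((isOpen_lt hL continuous_const).inter_closure
      ⟨lt_add_one (L x), hx⟩)
  obtain ⟨a, ha, rfl⟩ := hx'
  change φ (∑ s, a s • φ.symm s.1) ∈ σ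
  rw [map_sum]
  refine sum_mem fun s _ => ?_
  rw [map_smul, φ.apply_symm_apply]
  exact σ.smul_mem (ha s trivial).1 (hT s)

end ToricFan

/-! ### Exit paths in a conical neighbourhood -/

open StratifiedSubset

namespace ConicalNeighborhood

variable {n : ℕ} {𝓜 : Type v} [TopologicalSpace 𝓜] [ChartedSpace (EuclideanSpace ℝ (Fin n)) 𝓜]
  {S : StratifiedSubset n 𝓜} {fan : S.Exit ⥤ ToricFan.{u}}
  {framing : ∀ x : S.Point, normalSpace x ≃ₗ[ℝ] (fan.obj x.toExit).space}
  {p : S.Point} (N : ConicalNeighborhood S fan framing p)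

lemma isOpenEmbedding_domRestrict :
    Topology.IsOpenEmbedding (N.source.domRestrict N.toFun) := by
  refine IsLocalHomeomorph.isOpenEmbedding_of_injective ?_ (Set.injOn_iff_injective.mp N.injOn)
  rw [isLocalHomeomorph_iff_isLocalHomeomorphOn_univ]
  exact N.isLocalDiffeomorphOn.isLocalHomeomorphOn.comp (f := Subtype.val) (t := N.source)
    (N.isOpen_source.isOpenEmbedding_subtypeVal.isLocalHomeomorph.isLocalHomeomorphOn)
    fun x _ => x.2

lemma isOpen_image : IsOpen (N.toFun '' N.source) := by
  rw [← Set.range_domRestrict]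
  exact N.isOpenEmbedding_domRestrict.isOpen_range

lemma toFun_mem_piece_iff {σ : PointedCone ℝ (fan.obj p.toExit).space}
    {q : S.carrier p.stratum × EuclideanSpace ℝ (Fin N.codim)} (hq : q ∈ N.source) :
    N.toFun q ∈ N.piece σ ↔ N.coord q.2 ∈ (fan.obj p.toExit).openCone σ := by
  rw [N.piece_eq]
  constructor
  · rintro ⟨q', ⟨hq', h⟩, he⟩
    rwa [N.injOn hq' hq he] at h
  · exact fun h => ⟨q, ⟨hq, h⟩, rfl⟩

lemma piece_bot_subset : N.piece ⊥ ⊆ S.carrier p.stratum := by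
  rw [N.piece_eq, ToricFan.openCone_bot]
  rintro _ ⟨⟨a, u⟩, ⟨hq, hu⟩, rfl⟩
  obtain rfl : u = 0 := N.coord.map_eq_zero_iff.mp hu
  rw [N.map_zero]
  exact a.2

variable (S) in
lemma _root_.StratifiedSubset.stratum_eq {s s' : S.Stratum} {x : 𝓜} (h : x ∈ S.carrier s)
    (h' : x ∈ S.carrier s') : s = s' := by
  by_contra hne
  exact Set.disjoint_left.mp (S.disjoint s s' hne) h h'

lemma piece_subset_of_mem {σ : PointedCone ℝ (fan.obj p.toExit).space}
    (hσ : σ ∈ (fan.obj p.toExit).cones) {x : 𝓜} {s : S.Stratum} (hx : x ∈ N.piece σ)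
    (hs : x ∈ S.carrier s) : N.piece σ ⊆ S.carrier s := by
  obtain ⟨s', h⟩ := N.exists_stratum σ hσ
  obtain rfl := S.stratum_eq hs (h hx)
  exact h

lemma piece_subset_image (σ : PointedCone ℝ (fan.obj p.toExit).space) :
    N.piece σ ⊆ N.toFun '' N.source := by
  rw [N.piece_eq]
  exact Set.image_mono fun _ h => h.1

/-- One can exit from each point of the stratum along each cone. -/
lemma exists_exitPath (x : S.Point) (hx : x.stratum = p.stratum)
    {σ : PointedCone ℝ (fan.obj p.toExit).space} (hσ : σ ∈ (fan.obj p.toExit).cones) :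
    ∃ (y : S.Point) (γ : ExitPath x y), (∀ t, t ≠ 0 → γ.path t ∈ N.piece σ) ∧
      y.val ∈ N.piece σ ∧ N.piece σ ⊆ S.carrier y.stratum := by
  obtain ⟨v, hv⟩ := ToricFan.openCone_nonempty hσ
  let a : S.carrier p.stratum := ⟨x.val, hx ▸ x.mem⟩
  -- The exit path runs along a ray in the fibre over `x`, in the direction of an interior point of
  -- the cone. It is rescaled by `ε / 2` so that it stays in the source for all times up to `1`.
  let c : ℝ → S.carrier p.stratum × EuclideanSpace ℝ (Fin N.codim) :=
    fun r => (a, r • N.coord.symm v)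
  have hc : Continuous c := by fun_prop
  have hc0 : c 0 = (a, 0) := by simp [c]
  have h0 : c ⁻¹' N.source ∈ 𝓝 (0 : ℝ) := (N.isOpen_source.preimage hc).mem_nhds (by
    rw [Set.mem_preimage, hc0]; exact N.zero_mem a)
  obtain ⟨ε, hε, hball⟩ := Metric.mem_nhds_iff.mp h0
  have hsrc : ∀ t : unitInterval, c (t * (ε / 2)) ∈ N.source := fun t => by
    refine hball ?_
    rw [mem_ball_zero_iff, Real.norm_of_nonneg (mul_nonneg t.2.1 (by positivity))]
    nlinarith [t.2.2, t.2.1]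
  have hpiece : ∀ t : unitInterval, t ≠ 0 → N.toFun (c (t * (ε / 2))) ∈ N.piece σ := fun t ht => by
    rw [N.toFun_mem_piece_iff (hsrc t)]
    change N.coord ((t * (ε / 2)) • N.coord.symm v) ∈ _
    rw [map_smul, N.coord.apply_symm_apply]
    have : (0 : ℝ) < t := unitInterval.pos_iff_ne_zero.mpr ht
    exact ToricFan.smul_mem_openCone hv (by positivity)
  obtain ⟨s, hs⟩ := N.exists_stratum σ hσ
  have hcont : Continuous fun t : unitInterval => N.toFun (c (t * (ε / 2))) :=
    N.isOpenEmbedding_domRestrict.continuous.comp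
      (f := fun t : unitInterval => (⟨c (t * (ε / 2)), hsrc t⟩ : N.source)) (by fun_prop)
  refine ⟨⟨s, N.toFun (c ((1 : unitInterval) * (ε / 2))), hs (hpiece 1 one_ne_zero)⟩,
    ⟨⟨⟨_, hcont⟩, ?_, rfl⟩, fun t ht => hs (hpiece t ht)⟩, hpiece, hpiece 1 one_ne_zero, hs⟩
  change N.toFun (c ((0 : unitInterval) * (ε / 2))) = x.val
  rw [Set.Icc.coe_zero, zero_mul, hc0, N.map_zero]

/-- An exit path starts out in a single piece of the neighbourhood. -/
lemma exists_eventually_mem_piece {y : S.Point} (γ : ExitPath p y) :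
    ∃ σ ∈ (fan.obj p.toExit).cones, N.piece σ ⊆ S.carrier y.stratum ∧
      ∀ᶠ t in 𝓝[>] (0 : unitInterval), γ.path t ∈ N.piece σ := by
  have hV : ∀ᶠ t in 𝓝 (0 : unitInterval), γ.path t ∈ N.toFun '' N.source :=
    γ.path.continuous.continuousAt.eventually (N.isOpen_image.mem_nhds (by
      rw [γ.path.source]
      exact ⟨(⟨p.val, p.mem⟩, 0), N.zero_mem _, N.map_zero _⟩))
  obtain ⟨ε, hε, hIco⟩ := exists_Ico_subset_of_mem_nhds hV ⟨1, zero_lt_one⟩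
  have : PreconnectedSpace (Set.Ioo (0 : unitInterval) ε) :=
    Subtype.preconnectedSpace isPreconnected_Ioo
  let I := Set.Ioo (0 : unitInterval) ε
  have hmem : ∀ t : I, γ.path t ∈ Set.range (N.source.domRestrict N.toFun) := fun t => by
    rw [Set.range_domRestrict]; exact hIco ⟨t.2.1.le, t.2.2⟩
  let q : I → N.source := fun t =>
    N.isOpenEmbedding_domRestrict.toIsEmbedding.toHomeomorph.symm ⟨γ.path t, hmem t⟩
  have hq : ∀ t, N.toFun (q t) = γ.path t := fun t => congrArg Subtype.val
    (N.isOpenEmbedding_domRestrict.toIsEmbedding.toHomeomorph.apply_symm_apply ⟨γ.path t, hmem t⟩)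
  have hqc : Continuous q := by fun_prop
  have hcarr : ∀ t : I, γ.path t ∈ S.carrier y.stratum := fun t => γ.exit t t.2.1.ne'
  -- For small positive times the path lies in pieces belonging to the stratum of `y`. The pieces of
  -- `T` will be shown to partition this connected time interval into finitely many closed subsets,
  -- so only one of them occurs.
  let T : Set (PointedCone ℝ (fan.obj p.toExit).space) :=
    {σ ∈ (fan.obj p.toExit).cones | N.piece σ ⊆ S.carrier y.stratum}
  have hTfin : T.Finite := (fan.obj p.toExit).finite_cones.subset fun _ h => h.1
  have hT : ∀ t : I, ∃ σ ∈ T, γ.path t ∈ N.piece σ := fun t => by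
    obtain ⟨σ, hσ, h⟩ := N.mem_piece (q t) (q t).2 ⟨_, (hq t).symm ▸ hcarr t⟩
    rw [hq] at h
    exact ⟨σ, ⟨hσ, N.piece_subset_of_mem hσ h (hcarr t)⟩, h⟩
  have hpiece : ∀ (t : I) σ, γ.path t ∈ N.piece σ ↔
      N.coord (q t).1.2 ∈ (fan.obj p.toExit).openCone σ := fun t σ => by
    rw [← hq, N.toFun_mem_piece_iff (q t).2]
  -- No cone of `T` is a proper face of another, because the two would belong to different strata.
  -- Hence along the path, being in the closed cone is the same as being in its piece.
  have hmax : ∀ (t : I), ∀ σ ∈ T, N.coord (q t).1.2 ∈ σ → γ.path t ∈ N.piece σ := by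
    intro t σ hσ h
    obtain ⟨τ, hτ, hτt⟩ := hT t
    have hle := ToricFan.le_of_mem_openCone hτ.1 hσ.1 ((hpiece t τ).mp hτt) h
    rcases hle.eq_or_lt with rfl | hlt
    · exact hτt
    · exact absurd hτ.2 (N.ne_stratum σ hσ.1 τ hτ.1 hlt _ hσ.2)
  have hclosed : ∀ σ ∈ T, IsClosed {t : I | γ.path t ∈ N.piece σ} := fun σ hσ => by
    have : {t : I | γ.path t ∈ N.piece σ} =
        (fun t : I => (q t).1.2) ⁻¹' (N.coord ⁻¹' (σ : Set (fan.obj p.toExit).space)) :=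
      Set.ext fun t => ⟨fun h => ((hpiece t σ).mp h).1, hmax t σ hσ⟩
    rw [this]
    exact (ToricFan.isClosed_preimage_cone N.coord hσ.1).preimage (by fun_prop)
  obtain ⟨t₀, ht₀⟩ : Set.Nonempty I := Set.nonempty_Ioo.mpr hε
  obtain ⟨σ, hσ, hσt⟩ := hT ⟨t₀, ht₀⟩
  have hclopen : IsClopen {t : I | γ.path t ∈ N.piece σ} := by
    refine ⟨hclosed σ hσ, ?_⟩
    rw [← isClosed_compl_iff]
    have : {t : I | γ.path t ∈ N.piece σ}ᶜ = ⋃ τ ∈ T \ {σ}, {t : I | γ.path t ∈ N.piece τ} := by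
      ext t
      simp only [Set.mem_compl_iff, Set.mem_iUnion, Set.mem_ofPred_eq]
      constructor
      · intro h
        obtain ⟨τ, hτ, hτt⟩ := hT t
        exact ⟨τ, ⟨hτ, fun h' => h (h' ▸ hτt)⟩, hτt⟩
      · rintro ⟨τ, hτ, hτt⟩ h
        exact hτ.2 (le_antisymm
          (ToricFan.le_of_mem_openCone hτ.1.1 hσ.1 ((hpiece t τ).mp hτt) ((hpiece t σ).mp h).1)
          (ToricFan.le_of_mem_openCone hσ.1 hτ.1.1 ((hpiece t σ).mp h) ((hpiece t τ).mp hτt).1))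
    rw [this]
    exact (hTfin.subset Set.sdiff_subset).isClosed_biUnion fun τ hτ => hclosed τ hτ.1
  have huniv := hclopen.eq_univ ⟨⟨t₀, ht₀⟩, hσt⟩
  refine ⟨σ, hσ.1, hσ.2, Filter.mem_of_superset (Ioo_mem_nhdsGT hε) fun t ht => ?_⟩
  exact (huniv.symm ▸ Set.mem_univ (⟨t, ht⟩ : I) : (⟨t, ht⟩ : I) ∈ {t : I | γ.path t ∈ N.piece σ})

include N in
/-- The dimension of the stratum and that of the fan add up to the dimension of the manifold. -/
lemma dim_add_finrank : S.dim p.stratum + Module.finrank ℝ (fan.obj p.toExit).space = n := by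
  let x : S.carrier p.stratum := ⟨p.val, p.mem⟩
  have h := (N.isLocalDiffeomorphOn ⟨(x, 0), N.zero_mem x⟩).mfderivToContinuousLinearEquiv
    (by simp)
  have h2 : Module.finrank ℝ
      (EuclideanSpace ℝ (Fin (S.dim p.stratum)) × EuclideanSpace ℝ (Fin N.codim)) =
      Module.finrank ℝ (EuclideanSpace ℝ (Fin n)) := h.toLinearEquiv.finrank_eq
  rw [Module.finrank_prod, finrank_euclideanSpace_fin, finrank_euclideanSpace_fin,
    finrank_euclideanSpace_fin] at h2
  rw [← N.coord.finrank_eq, finrank_euclideanSpace_fin, h2]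

end ConicalNeighborhood

/-! ### Cones of exit paths and the shape of the exit path category -/

open StratifiedSubset

namespace Fanifold

variable {n : ℕ} {𝓜 : Type v} [TopologicalSpace 𝓜] [ChartedSpace (EuclideanSpace ℝ (Fin n)) 𝓜]
  [IsManifold (𝓡 n) ∞ 𝓜] (Φ : Fanifold.{u} n 𝓜)

/-- The cone of the morphism of fans associated with a morphism of the exit path category. -/
def cone {x y : Φ.Exit} (f : x ⟶ y) : PointedCone ℝ (Φ.fan.obj x).space :=
  ToricFan.Hom.cone (Φ.fan.map f)

lemma cone_mem {x y : Φ.Exit} (f : x ⟶ y) : Φ.cone f ∈ (Φ.fan.obj x).cones :=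
  ToricFan.Hom.cone_mem (Φ.fan.map f)

lemma cone_id (x : Φ.Exit) : Φ.cone (𝟙 x) = ⊥ :=
  congrArg ToricFan.Hom.cone (Φ.fan.map_id x)

lemma cone_le_cone_comp {x y z : Φ.Exit} (f : x ⟶ y) (g : y ⟶ z) :
    Φ.cone f ≤ Φ.cone (f ≫ g) :=
  (ToricFan.Hom.cone_le_comp_cone (Φ.fan.map f) (Φ.fan.map g)).trans_eq
    (congrArg ToricFan.Hom.cone (Φ.fan.map_comp f g)).symm

lemma map_cone_comp {x y z : Φ.Exit} (f : x ⟶ y) (g : y ⟶ z) :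
    (Φ.cone (f ≫ g)).map (ToricFan.Hom.realMap (Φ.fan.map f)) = Φ.cone g :=
  (congrArg (fun h => (ToricFan.Hom.cone h).map (ToricFan.Hom.realMap (Φ.fan.map f)))
    (Φ.fan.map_comp f g)).trans
      (ToricFan.Hom.map_comp_cone_eq (Φ.fan.map f) (Φ.fan.map g))

lemma cone_comp_eq {x y z : Φ.Exit} (f : x ⟶ y) (g : y ⟶ z)
    {σ : PointedCone ℝ (Φ.fan.obj x).space} (hσ : σ ∈ (Φ.fan.obj x).cones) (hle : Φ.cone f ≤ σ)
    (h : σ.map (ToricFan.Hom.realMap (Φ.fan.map f)) = Φ.cone g) : Φ.cone (f ≫ g) = σ :=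
  ToricFan.Hom.eq_of_map_eq (Φ.fan.map f) (Φ.cone_mem _) hσ (Φ.cone_le_cone_comp f g) hle
    ((Φ.map_cone_comp f g).trans h.symm)

lemma map_cone_self {x y : Φ.Exit} (f : x ⟶ y) :
    (Φ.cone f).map (ToricFan.Hom.realMap (Φ.fan.map f)) = ⊥ := by
  have h := Φ.map_cone_comp f (𝟙 y)
  rwa [Category.comp_id, cone_id] at h

/-- Contractible strata are path connected, and a path within a stratum is an exit path. -/
lemma nonempty_hom_of_stratum_eq (x y : Φ.Exit) (h : x.point.stratum = y.point.stratum) :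
    Nonempty (x ⟶ y) := by
  obtain ⟨⟨s, a, ha⟩⟩ := x
  obtain ⟨⟨s', b, hb⟩⟩ := y
  obtain rfl : s = s' := h
  have := Φ.contractible s
  obtain ⟨γ⟩ := PathConnectedSpace.joined (⟨a, ha⟩ : Φ.carrier s) ⟨b, hb⟩
  exact ⟨ExitPath.toExit (x := ⟨s, a, ha⟩) (y := ⟨s, b, hb⟩)
    ⟨γ.map continuous_subtype_val, fun t _ => (γ t).2⟩⟩

variable [Quiver.IsThin Φ.Exit]

/-- There is a morphism `g` back, and by thinness `f ≫ g` is the identity; the cone of `f` lies in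
that of the composite, which is zero. -/
lemma cone_eq_bot_of_stratum_eq {x y : Φ.Exit} (f : x ⟶ y)
    (h : x.point.stratum = y.point.stratum) : Φ.cone f = ⊥ := by
  obtain ⟨g⟩ := Φ.nonempty_hom_of_stratum_eq y x h.symm
  have h1 := Φ.cone_le_cone_comp f g
  rw [Subsingleton.elim (f ≫ g) (𝟙 x), cone_id] at h1
  exact le_bot_iff.mp h1

variable {Φ} {x : Φ.Exit}
  {N : ConicalNeighborhood Φ.toStratifiedSubset Φ.fan Φ.framing x.point}

omit [Quiver.IsThin Φ.Exit] in
lemma piece_nonempty {σ : PointedCone ℝ (Φ.fan.obj x).space} (hσ : σ ∈ (Φ.fan.obj x).cones) :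
    (N.piece σ).Nonempty := by
  obtain ⟨y, -, -, hy, -⟩ := N.exists_exitPath x.point rfl hσ
  exact ⟨_, hy⟩

omit [Quiver.IsThin Φ.Exit] in
lemma exists_hom_cone_eq (hN : N.IsCompatible) {σ : PointedCone ℝ (Φ.fan.obj x).space}
    (hσ : σ ∈ (Φ.fan.obj x).cones) :
    ∃ (y : Φ.Exit) (f : x ⟶ y), Φ.cone f = σ ∧ N.piece σ ⊆ Φ.carrier y.point.stratum := by
  obtain ⟨y, γ, hγ, -, hy⟩ := N.exists_exitPath x.point rfl hσ
  refine ⟨y.toExit, γ.toExit, (hN y γ σ hσ ?_).1, hy⟩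
  exact Filter.mem_of_superset self_mem_nhdsWithin fun t ht => hγ t (ne_of_gt ht)

/-- By thinness `f` equals an exit path along `σ` followed by a morphism inside the stratum of `y`.
The former has cone `σ` by compatibility and the latter has cone zero. -/
lemma cone_eq_of_piece_subset (hN : N.IsCompatible) {y : Φ.Exit} (f : x ⟶ y)
    {σ : PointedCone ℝ (Φ.fan.obj x).space} (hσ : σ ∈ (Φ.fan.obj x).cones)
    (h : N.piece σ ⊆ Φ.carrier y.point.stratum) : Φ.cone f = σ := by
  obtain ⟨z, g, rfl, hz⟩ := exists_hom_cone_eq hN hσ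
  obtain ⟨q, hq⟩ := piece_nonempty (N := N) (Φ.cone_mem g)
  have hs : z.point.stratum = y.point.stratum := Φ.toStratifiedSubset.stratum_eq (hz hq) (h hq)
  obtain ⟨i⟩ := Φ.nonempty_hom_of_stratum_eq z y hs
  rw [Subsingleton.elim f (g ≫ i)]
  refine Φ.cone_comp_eq g i (Φ.cone_mem g) le_rfl ?_
  rw [Φ.cone_eq_bot_of_stratum_eq i hs, map_cone_self]

-- Morphisms are words in exit paths, so one inducts on the length. Given a piece in the stratum of
-- `y` and a further exit path to `z`, a conical neighbourhood at `y` provides an exit into the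
-- stratum of `z` from a point of that piece. For small times it stays in the neighbourhood of `x`,
-- hence meets a piece there.
omit [Quiver.IsThin Φ.Exit] in
lemma exists_piece_subset {y : Φ.Exit} (f : x ⟶ y) :
    ∃ σ ∈ (Φ.fan.obj x).cones, N.piece σ ⊆ Φ.carrier y.point.stratum := by
  obtain ⟨y⟩ := y
  obtain ⟨g, -⟩ : ∃ f' : Quiver.Path x.point y, _ = f :=
    Functor.map_surjective (C := Paths Φ.Point)
      (CategoryTheory.Quotient.functor.{v, v} (ExitRel (S := Φ.toStratifiedSubset))) f
  clear f
  induction g with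
  | nil => exact ⟨⊥, (Φ.fan.obj x).bot_mem, N.piece_bot_subset⟩
  | @cons y z f γ ih =>
    obtain ⟨σ, hσ, hy⟩ := ih
    obtain ⟨N', -⟩ := Φ.conical y
    obtain ⟨ρ, hρ, hz, -⟩ := N'.exists_eventually_mem_piece γ
    obtain ⟨q, hq⟩ := piece_nonempty (N := N) hσ
    obtain ⟨z', δ, hδ, -, -⟩ := N'.exists_exitPath ⟨_, q, hy hq⟩ rfl hρ
    have hU : ∀ᶠ t in 𝓝[>] (0 : unitInterval), δ.path t ∈ N.toFun '' N.source :=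
      Filter.Eventually.filter_mono nhdsWithin_le_nhds
        (δ.path.continuous.continuousAt.eventually (N.isOpen_image.mem_nhds (by
          rw [δ.path.source]
          exact N.piece_subset_image σ hq)))
    have : (𝓝[>] (0 : unitInterval)).NeBot := nhdsGT_neBot_of_exists_gt ⟨1, zero_lt_one⟩
    obtain ⟨t, ⟨a, ha, hat⟩, ht⟩ := (hU.and self_mem_nhdsWithin).exists
    have hmem : N.toFun a ∈ Φ.carrier z.stratum := by
      rw [hat]; exact hz (hδ t (ne_of_gt ht))
    obtain ⟨τ, hτ, h⟩ := N.mem_piece a ha ⟨_, hmem⟩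
    exact ⟨τ, hτ, N.piece_subset_of_mem hτ h hmem⟩

lemma piece_cone_subset (hN : N.IsCompatible) {y : Φ.Exit} (f : x ⟶ y) :
    N.piece (Φ.cone f) ⊆ Φ.carrier y.point.stratum := by
  obtain ⟨σ, hσ, h⟩ := exists_piece_subset (N := N) f
  exact (congrArg N.piece (cone_eq_of_piece_subset hN f hσ h)).subset.trans h

variable (Φ) in
omit [Quiver.IsThin Φ.Exit] in
lemma exists_isCompatible (x : Φ.Exit) :
    ∃ N : ConicalNeighborhood Φ.toStratifiedSubset Φ.fan Φ.framing x.point, N.IsCompatible :=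
  Φ.conical x.point

omit [Quiver.IsThin Φ.Exit] in
/-- Each cone of the fan at `x` is the cone of a morphism. -/
lemma exists_cone_eq {σ : PointedCone ℝ (Φ.fan.obj x).space} (hσ : σ ∈ (Φ.fan.obj x).cones) :
    ∃ (y : Φ.Exit) (f : x ⟶ y), Φ.cone f = σ := by
  obtain ⟨N, hN⟩ := Φ.exists_isCompatible x
  obtain ⟨y, f, hf, -⟩ := exists_hom_cone_eq hN hσ
  exact ⟨y, f, hf⟩

lemma stratum_eq_of_cone_eq {y z : Φ.Exit} (f : x ⟶ y) (g : x ⟶ z) (h : Φ.cone f = Φ.cone g) :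
    y.point.stratum = z.point.stratum := by
  obtain ⟨N, hN⟩ := Φ.exists_isCompatible x
  obtain ⟨q, hq⟩ := piece_nonempty (N := N) (Φ.cone_mem f)
  exact Φ.toStratifiedSubset.stratum_eq (piece_cone_subset hN f hq)
    (piece_cone_subset hN g (h ▸ hq))

lemma cone_eq_bot_iff {y : Φ.Exit} (f : x ⟶ y) :
    Φ.cone f = ⊥ ↔ x.point.stratum = y.point.stratum :=
  ⟨fun h => stratum_eq_of_cone_eq (𝟙 x) f ((Φ.cone_id x).trans h.symm),
    Φ.cone_eq_bot_of_stratum_eq f⟩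

/-- The image of the cone of `g` in the fan at `y` is the cone of some `f'`. Then `f ≫ f'` has the
same cone as `g`, so it ends in the stratum of `z`. -/
lemma nonempty_hom_of_cone_le {y z : Φ.Exit} (f : x ⟶ y) (g : x ⟶ z)
    (h : Φ.cone f ≤ Φ.cone g) : Nonempty (y ⟶ z) := by
  have hρ : (Φ.cone g).map (ToricFan.Hom.realMap (Φ.fan.map f)) ∈ (Φ.fan.obj y).cones :=
    (ToricFan.Hom.cones_eq (Φ.fan.map f) _).mpr ⟨_, Φ.cone_mem g, h, rfl⟩
  obtain ⟨z', f', hf'⟩ := exists_cone_eq hρ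
  have h1 := Φ.cone_comp_eq f f' (Φ.cone_mem g) h hf'.symm
  obtain ⟨i⟩ := Φ.nonempty_hom_of_stratum_eq z' z (stratum_eq_of_cone_eq _ g h1)
  exact ⟨f' ≫ i⟩

lemma cone_le_of_hom {y z : Φ.Exit} (f : x ⟶ y) (g : x ⟶ z) (h : y ⟶ z) :
    Φ.cone f ≤ Φ.cone g := by
  rw [Subsingleton.elim g (f ≫ h)]
  exact Φ.cone_le_cone_comp f h

/-- Exit paths lead to strata of larger dimension. -/
lemma dim_lt_of_hom {y : Φ.Exit} (f : x ⟶ y) (h : x.point.stratum ≠ y.point.stratum) :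
    Φ.dim x.point.stratum < Φ.dim y.point.stratum := by
  obtain ⟨N, -⟩ := Φ.exists_isCompatible x
  obtain ⟨N', -⟩ := Φ.exists_isCompatible y
  have h1 := N.dim_add_finrank
  have h2 := N'.dim_add_finrank
  have hsurj : Function.Surjective (ToricFan.Hom.realMap (Φ.fan.map f)) := by
    rw [ToricFan.Hom.realMap, LinearMap.baseChange_eq_ltensor]
    exact LinearMap.lTensor_surjective ℝ (ToricFan.Hom.surjective (Φ.fan.map f))
  have h3 := (ToricFan.Hom.realMap (Φ.fan.map f)).finrank_range_add_finrank_ker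
  rw [LinearMap.range_eq_top.mpr hsurj, finrank_top] at h3
  -- A nonzero cone gives the surjection of vector spaces a nonzero kernel, so the codimension
  -- drops.
  have h4 : Φ.cone f ≠ ⊥ := fun h' => h ((cone_eq_bot_iff f).mp h')
  obtain ⟨v, hv, hv0⟩ := (Submodule.ne_bot_iff _).mp h4
  have h5 : v ∈ LinearMap.ker (ToricFan.Hom.realMap (Φ.fan.map f)) :=
    (ToricFan.Hom.realMap_eq_zero_iff (Φ.fan.map f) v).mpr (Submodule.subset_span hv)
  have h6 : 0 < Module.finrank ℝ (LinearMap.ker (ToricFan.Hom.realMap (Φ.fan.map f))) := by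
    have : Nontrivial (LinearMap.ker (ToricFan.Hom.realMap (Φ.fan.map f))) :=
      ⟨⟨v, h5⟩, 0, fun h' => hv0 (congrArg Subtype.val h')⟩
    exact Module.finrank_pos
  change _ + Module.finrank ℝ (Φ.fan.obj x).space = n at h1
  change _ + Module.finrank ℝ (Φ.fan.obj y).space = n at h2
  omega

end Fanifold

/-! ### Colimits over a thin category enlarged by one isomorphism class -/

namespace CategoryTheory.ObjectProperty

variable {C : Type*} [Category* C] [Quiver.IsThin C] {𝒟 : Type*} [Category* 𝒟] {T : C ⥤ 𝒟}
  {p p' q : ObjectProperty C} {x : C}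

/-- `p'` is obtained from the full subcategory `p` of a thin category by adding the isomorphism
class of `x`; the objects of `p` that map to `x` are those of `q`. -/
structure IsAttachment (q p p' : ObjectProperty C) (x : C) : Prop where
  q_le : q ≤ p
  le : p ≤ p'
  mem : p' x
  notMem : ¬ p x
  exists_iso : ∀ y, p' y → ¬ p y → Nonempty (y ⟶ x) ∧ Nonempty (x ⟶ y)
  of_hom : ∀ {y z}, (y ⟶ z) → p' y → p z → p y
  mem_q : ∀ {y}, p y → (y ⟶ x) → q y

/-- The map `g` is compatible with cocones over the restrictions of a diagram to two full
subcategories. -/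
def CompatibleMap (c : Cocone (p.ι ⋙ T)) (c' : Cocone (p'.ι ⋙ T)) (g : c.pt ⟶ c'.pt) : Prop :=
  ∀ (y : C) (hy : p y) (hy' : p' y), c.ι.app ⟨y, hy⟩ ≫ g = c'.ι.app ⟨y, hy'⟩

omit [Quiver.IsThin C] in
lemma exists_compatibleMap {c : Cocone (p.ι ⋙ T)} (hc : IsColimit c) (c' : Cocone (p'.ι ⋙ T))
    (hle : p ≤ p') : ∃ g : c.pt ⟶ c'.pt, CompatibleMap c c' g :=
  ⟨hc.desc (c'.whisker (ObjectProperty.ιOfLE hle)), fun _ _ _ => hc.fac _ _⟩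

namespace IsAttachment

variable (h : IsAttachment q p p' x) {cq : Cocone (q.ι ⋙ T)} {cp : Cocone (p.ι ⋙ T)}
  {g : cq.pt ⟶ cp.pt} (hg : CompatibleMap cq cp g) {j : cq.pt ⟶ T.obj x}
  (hj : ∀ (y : C) (hy : q y) (f : y ⟶ x), cq.ι.app ⟨y, hy⟩ ≫ j = T.map f)

open Classical in
/-- The component at `y` of the cocone over `p'` defined by a cocone over `p` and a map from
`T x`. -/
def component {X : 𝒟} (a : cp.pt ⟶ X) (b : T.obj x ⟶ X) (y : C) (hy : p' y) : T.obj y ⟶ X :=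
  if hp : p y then cp.ι.app ⟨y, hp⟩ ≫ a else T.map (h.exists_iso y hy hp).1.some ≫ b

omit [Quiver.IsThin C] in
lemma component_of_mem {X : 𝒟} (a : cp.pt ⟶ X) (b : T.obj x ⟶ X) {y : C} (hp : p y) :
    h.component a b y (h.le _ hp) = cp.ι.app ⟨y, hp⟩ ≫ a := dif_pos hp

lemma component_of_notMem {X : 𝒟} (a : cp.pt ⟶ X) (b : T.obj x ⟶ X) {y : C} (hy : p' y)
    (hp : ¬ p y) (f : y ⟶ x) : h.component a b y hy = T.map f ≫ b := by
  rw [Subsingleton.elim f (h.exists_iso y hy hp).1.some]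
  exact dif_neg hp

include hg hj in
lemma map_comp_component {X : 𝒟} {a : cp.pt ⟶ X} {b : T.obj x ⟶ X} (w : g ≫ a = j ≫ b)
    {y z : C} (f : y ⟶ z) (hy : p' y) (hz : p' z) :
    T.map f ≫ h.component a b z hz = h.component a b y hy := by
  by_cases hpz : p z
  · have hpy := h.of_hom f hy hpz
    rw [h.component_of_mem a b hpz, h.component_of_mem a b hpy, ← Category.assoc]
    exact congrArg (· ≫ a) (cp.w (ObjectProperty.homMk f :
      (⟨y, hpy⟩ : p.FullSubcategory) ⟶ ⟨z, hpz⟩))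
  · obtain ⟨i⟩ := (h.exists_iso z hz hpz).1
    rw [h.component_of_notMem a b hz hpz i, ← Category.assoc, ← T.map_comp]
    by_cases hpy : p y
    · have hqy := h.mem_q hpy (f ≫ i)
      rw [h.component_of_mem a b hpy, ← hg y hqy hpy, Category.assoc, w, ← Category.assoc,
        hj y hqy (f ≫ i)]
    · rw [h.component_of_notMem a b hy hpy (f ≫ i)]

/-- The cocone over `p'` defined by a cocone over `p` and a map from `T x`. -/
def extend {X : 𝒟} {a : cp.pt ⟶ X} {b : T.obj x ⟶ X} (w : g ≫ a = j ≫ b) :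
    Cocone (p'.ι ⋙ T) where
  pt := X
  ι :=
    { app := fun y => h.component a b y.1 y.2
      naturality := fun y z f => (h.map_comp_component hg hj w f.hom y.2 z.2).trans
        (Category.comp_id _).symm }

lemma extend_app_of_mem {X : 𝒟} {a : cp.pt ⟶ X} {b : T.obj x ⟶ X} (w : g ≫ a = j ≫ b) {y : C}
    (hp : p y) (hy : p' y) :
    (h.extend hg hj w).ι.app ⟨y, hy⟩ = cp.ι.app ⟨y, hp⟩ ≫ a :=
  h.component_of_mem a b hp

lemma extend_app_self {X : 𝒟} {a : cp.pt ⟶ X} {b : T.obj x ⟶ X} (w : g ≫ a = j ≫ b)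
    (hx : p' x) : (h.extend hg hj w).ι.app ⟨x, hx⟩ = b :=
  (h.component_of_notMem a b hx h.notMem (𝟙 x)).trans (by simp)

include h in
omit [Quiver.IsThin C] in
lemma hom_ext {c : Cocone (p'.ι ⋙ T)} {X : 𝒟} {a b : c.pt ⟶ X}
    (h1 : ∀ y (hy : p y), c.ι.app ⟨y, h.le _ hy⟩ ≫ a = c.ι.app ⟨y, h.le _ hy⟩ ≫ b)
    (h2 : c.ι.app ⟨x, h.mem⟩ ≫ a = c.ι.app ⟨x, h.mem⟩ ≫ b) (y : p'.FullSubcategory) :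
    c.ι.app y ≫ a = c.ι.app y ≫ b := by
  obtain ⟨y, hy⟩ := y
  by_cases hp : p y
  · exact h1 y hp
  · obtain ⟨i⟩ := (h.exists_iso y hy hp).1
    have := c.w (ObjectProperty.homMk i : (⟨y, hy⟩ : p'.FullSubcategory) ⟶ ⟨x, h.mem⟩)
    rw [← this, Category.assoc, Category.assoc, h2]

include h hg hj in
lemma exists_desc {c : Cocone (p'.ι ⋙ T)} (hc : IsColimit c) {X : 𝒟} {a : cp.pt ⟶ X}
    {b : T.obj x ⟶ X} (w : g ≫ a = j ≫ b) : ∃ m : c.pt ⟶ X,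
      (∀ y (hy : p y), c.ι.app ⟨y, h.le _ hy⟩ ≫ m = cp.ι.app ⟨y, hy⟩ ≫ a) ∧
      c.ι.app ⟨x, h.mem⟩ ≫ m = b :=
  ⟨hc.desc (h.extend hg hj w),
    fun _ hy => (hc.fac _ _).trans (h.extend_app_of_mem hg hj w hy (h.le _ hy)),
    (hc.fac _ _).trans (h.extend_app_self hg hj w h.mem)⟩

include h hg hj in
omit [Quiver.IsThin C] in
lemma comp_eq (hq : IsColimit cq) {c : Cocone (p'.ι ⋙ T)} {z : cp.pt ⟶ c.pt}
    (hz : CompatibleMap cp c z) (hqx : ∀ y, q y → Nonempty (y ⟶ x)) :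
    g ≫ z = j ≫ c.ι.app ⟨x, h.mem⟩ :=
  hq.hom_ext fun ⟨y, hy⟩ => by
    obtain ⟨f⟩ := hqx y hy
    rw [← Category.assoc, ← Category.assoc, hj y hy f, hg y hy (h.q_le _ hy),
      hz y (h.q_le _ hy) (h.le _ (h.q_le _ hy))]
    exact (c.w (ObjectProperty.homMk f :
      (⟨y, h.le _ (h.q_le _ hy)⟩ : p'.FullSubcategory) ⟶ ⟨x, h.mem⟩)).symm

include h hg hj in
/-- The colimit over `p'` is the pushout of the colimit over `p` and `T x` along that over `q`. -/
theorem isPushout (hq : IsColimit cq) (hp : IsColimit cp) {c : Cocone (p'.ι ⋙ T)}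
    (hc : IsColimit c) {z : cp.pt ⟶ c.pt} (hz : CompatibleMap cp c z)
    (hqx : ∀ y, q y → Nonempty (y ⟶ x)) :
    IsPushout g j z (c.ι.app ⟨x, h.mem⟩) := by
  have w := h.comp_eq hg hj hq hz hqx
  choose m hm hm' using fun s : PushoutCocone g j => h.exists_desc hg hj hc s.condition
  refine ⟨⟨w⟩, ⟨PushoutCocone.IsColimit.mk _ m ?_ hm' ?_⟩⟩
  · intro s
    refine hp.hom_ext fun ⟨y, hy⟩ => ?_
    rw [← Category.assoc, hz y hy (h.le _ hy), hm]
  · intro s l hl hl'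
    refine hc.hom_ext (h.hom_ext (fun y hy => ?_) ?_)
    · rw [hm, ← hz y hy (h.le _ hy), Category.assoc, hl]
    · rw [hm', hl']

include h hg hj in
/-- The pushout of the colimit over `p` and `T x` along the colimit over `q` is a colimit over
`p'`. -/
theorem exists_isColimit (hq : IsColimit cq) (hp : IsColimit cp)
    (hqx : ∀ y, q y → Nonempty (y ⟶ x)) {X : 𝒟} {a : cp.pt ⟶ X} {b : T.obj x ⟶ X}
    (hX : IsPushout g j a b) : Nonempty (ColimitCocone (p'.ι ⋙ T)) := by
  suffices key : ∀ (c : Cocone (p'.ι ⋙ T)) (a : cp.pt ⟶ c.pt) (b : T.obj x ⟶ c.pt),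
      IsPushout g j a b → (∀ y (hy : p y), c.ι.app ⟨y, h.le _ hy⟩ = cp.ι.app ⟨y, hy⟩ ≫ a) →
      c.ι.app ⟨x, h.mem⟩ = b → Nonempty (IsColimit c) by
    obtain ⟨hc⟩ := key (h.extend hg hj hX.w) a b hX
      (fun y hy => h.extend_app_of_mem hg hj hX.w hy (h.le _ hy))
      (h.extend_app_self hg hj hX.w h.mem)
    exact ⟨⟨_, hc⟩⟩
  intro c a b hc hA hB
  have hdesc : ∀ s : Cocone (p'.ι ⋙ T), ∃ m : c.pt ⟶ s.pt,
      (∀ y (hy : p y), c.ι.app ⟨y, h.le _ hy⟩ ≫ m = s.ι.app ⟨y, h.le _ hy⟩) ∧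
      c.ι.app ⟨x, h.mem⟩ ≫ m = s.ι.app ⟨x, h.mem⟩ := by
    intro s
    obtain ⟨z, hz⟩ := exists_compatibleMap hp s h.le
    refine ⟨hc.desc z (s.ι.app ⟨x, h.mem⟩) (h.comp_eq hg hj hq hz hqx), fun y hy => ?_, ?_⟩
    · rw [hA y hy, Category.assoc, hc.inl_desc, hz y hy (h.le _ hy)]
    · rw [hB, hc.inr_desc]
  choose d hd1 hd2 using hdesc
  refine ⟨⟨d, fun s ⟨y, hy⟩ => ?_, fun s m hm => ?_⟩⟩
  · by_cases hpy : p y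
    · exact hd1 s y hpy
    · obtain ⟨i⟩ := (h.exists_iso y hy hpy).1
      let i' : (⟨y, hy⟩ : p'.FullSubcategory) ⟶ ⟨x, h.mem⟩ := ObjectProperty.homMk i
      rw [← c.w i', ← s.w i', Category.assoc, hd2]
  · refine hc.hom_ext (hp.hom_ext fun ⟨y, hy⟩ => ?_) ?_
    · rw [← Category.assoc, ← Category.assoc, ← hA y hy, hm, hd1 s y hy]
    · rw [← hB, hm, hd2]

end IsAttachment

end CategoryTheory.ObjectProperty

/-- Any pushout square is isomorphic to the one constructed from charts, whose legs are closed
immersions. -/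
lemma AlgebraicGeometry.isClosedImmersion_of_isPushout {B X Y P : Scheme.{u}} {i : B ⟶ X}
    {j : B ⟶ Y} {inl : X ⟶ P} {inr : Y ⟶ P} [IsClosedImmersion i] [IsClosedImmersion j]
    (h : IsPushout i j inl inr) : IsClosedImmersion inl ∧ IsClosedImmersion inr := by
  obtain ⟨P', inl', inr', h', hl, hr⟩ := exists_isPushout_of_isClosedImmersion i j
  refine ⟨?_, ?_⟩
  · exact (IsPushout.inl_isoIsPushout_hom X Y h' h) ▸
      (inferInstance : IsClosedImmersion (inl' ≫ (IsPushout.isoIsPushout X Y h' h).hom))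
  · exact (IsPushout.inr_isoIsPushout_hom X Y h' h) ▸
      (inferInstance : IsClosedImmersion (inr' ≫ (IsPushout.isoIsPushout X Y h' h).hom))

/-! ### Induction over the strata -/

namespace CategoryTheory.ObjectProperty

variable {C : Type*} [Category* C] [Quiver.IsThin C] {S : Type*} [Finite S] {st : C → S}
  {dim : S → ℕ}

/-- The objects outside the stratum of `x` that map to `x`. -/
def above (st : C → S) (x : C) : ObjectProperty C := fun y => Nonempty (y ⟶ x) ∧ st y ≠ st x

/-- The objects of `p` outside the stratum of `x`. -/
def remove (st : C → S) (p : ObjectProperty C) (x : C) : ObjectProperty C :=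
  fun y => p y ∧ st y ≠ st x

/-- A property that is inherited by sources of morphisms. -/
def IsSieve (p : ObjectProperty C) : Prop := ∀ ⦃y z : C⦄, (y ⟶ z) → p z → p y

variable (hst : ∀ x y, st x = st y → Nonempty (x ⟶ y))
  (hdim : ∀ {x y : C}, (y ⟶ x) → st y ≠ st x → dim (st x) < dim (st y))

omit [Quiver.IsThin C] [Finite S] in
include hdim in
lemma isSieve_above (x : C) : IsSieve (above st x) := by
  rintro y z f ⟨⟨i⟩, hne⟩
  refine ⟨⟨f ≫ i⟩, fun h => ?_⟩
  have h1 := hdim i hne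
  have h2 := hdim f (h ▸ hne.symm)
  rw [h] at h2
  exact lt_asymm h1 h2

omit [Quiver.IsThin C] [Finite S] in
include hdim in
lemma isSieve_remove {p : ObjectProperty C} (hp : IsSieve p) {x : C}
    (hmin : ∀ y, p y → dim (st x) ≤ dim (st y)) : IsSieve (remove st p x) := by
  rintro y z f ⟨hz, hne⟩
  refine ⟨hp f hz, fun h => ?_⟩
  have h1 := hdim f (h ▸ hne.symm)
  rw [h] at h1
  exact h1.not_ge (hmin z hz)

-- Because `x` has minimal dimension in `p`, no morphism leads from its stratum to another stratum
-- in `p`; thus removing the stratum leaves a sieve.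
omit [Quiver.IsThin C] [Finite S] in
include hst hdim in
lemma isAttachment_remove {p : ObjectProperty C} (hp : IsSieve p) {x : C} (hx : p x)
    (hmin : ∀ y, p y → dim (st x) ≤ dim (st y)) :
    IsAttachment (above st x) (remove st p x) p x where
  q_le y hy := ⟨hp hy.1.some hx, hy.2⟩
  le y hy := hy.1
  mem := hx
  notMem h := h.2 rfl
  exists_iso y hy h := by
    have : st y = st x := by
      by_contra hne
      exact h ⟨hy, hne⟩
    exact ⟨hst _ _ this, hst _ _ this.symm⟩
  of_hom f _ hz := isSieve_remove hdim hp hmin f hz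
  mem_q hy f := ⟨⟨f⟩, hy.2⟩

omit [Quiver.IsThin C] in
lemma ncard_image_remove_lt {p : ObjectProperty C} {x : C} (hx : p x) :
    (st '' {y | remove st p x y}).ncard < (st '' {y | p y}).ncard := by
  refine Set.ncard_lt_ncard ⟨Set.image_mono fun y hy => hy.1, fun h => ?_⟩ (Set.toFinite _)
  obtain ⟨y, hy, he⟩ := h ⟨x, hx, rfl⟩
  exact hy.2 he

variable {T : C ⥤ Scheme.{u}}
  (hbd : ∀ x, ∃ (c : Cocone ((above st x).ι ⋙ T)) (j : c.pt ⟶ T.obj x),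
    Nonempty (IsColimit c) ∧ IsClosedImmersion j ∧
    ∀ (y : C) (hy : above st x y) (f : y ⟶ x), c.ι.app ⟨y, hy⟩ ≫ j = T.map f)

omit [Quiver.IsThin C] [Finite S] in
lemma isIso_of_compatibleMap {p : ObjectProperty C} {c c' : Cocone (p.ι ⋙ T)} (hc : IsColimit c)
    (hc' : IsColimit c') {g : c.pt ⟶ c'.pt} (hg : CompatibleMap c c' g) : IsIso g := by
  have : g = (hc.coconePointUniqueUpToIso hc').hom := hc.hom_ext fun ⟨y, hy⟩ => by
    rw [hg y hy hy, IsColimit.comp_coconePointUniqueUpToIso_hom]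
  rw [this]
  infer_instance

-- Existence and closedness have to be proved together. Attaching the stratum of `x` requires the
-- map from the colimit over `above st x` to the colimit over the rest to be a closed immersion,
-- which is the second claim for a smaller sieve. The second claim for `p` then follows by pasting
-- pushout squares.
include hst hdim hbd in
theorem exists_isColimit_and_isClosedImmersion (n : ℕ) (p : ObjectProperty C) (hp : IsSieve p)
    (hn : (st '' {y | p y}).ncard ≤ n) :
    Nonempty (ColimitCocone (p.ι ⋙ T)) ∧ ∀ p' ≤ p, IsSieve p' →
      ∀ (c' : Cocone (p'.ι ⋙ T)) (c : Cocone (p.ι ⋙ T)), IsColimit c' → IsColimit c →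
      ∀ g : c'.pt ⟶ c.pt, CompatibleMap c' c g → IsClosedImmersion g := by
  induction n generalizing p with
  | zero =>
    have hempty : ∀ y, ¬ p y := fun y hy => by
      have := (Set.ncard_eq_zero (Set.toFinite _)).mp (Nat.le_zero.mp hn)
      exact Set.notMem_empty (st y) (this ▸ ⟨y, hy, rfl⟩)
    have : IsEmpty p.FullSubcategory := ⟨fun y => hempty y.1 y.2⟩
    refine ⟨⟨⟨⟨⊥_ Scheme.{u}, { app := fun y => isEmptyElim y, naturality := fun y => isEmptyElim y }⟩,
      ⟨fun s => initial.to s.pt, fun s y => isEmptyElim y, fun s m _ => Subsingleton.elim _ _⟩⟩⟩, ?_⟩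
    intro p' hle _ c' c hc' hc g hg
    obtain rfl : p' = p := le_antisymm hle fun y hy => absurd hy (hempty y)
    have := isIso_of_compatibleMap hc' hc hg
    infer_instance
  | succ n ih =>
    by_cases hne : ∃ y, p y
    swap
    · refine ih p hp ?_
      have : {y | p y} = ∅ := Set.eq_empty_of_forall_notMem fun y hy => hne ⟨y, hy⟩
      simp [this]
    obtain ⟨x, hx, hmin⟩ : ∃ x, p x ∧ ∀ y, p y → dim (st x) ≤ dim (st y) := by
      obtain ⟨x, hx, hmin⟩ := (Set.toFinite (st '' {y | p y})).exists_minimalFor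
        dim _ (Set.Nonempty.image st hne)
      obtain ⟨x, hx, rfl⟩ := hx
      exact ⟨x, hx, fun y hy => (le_total _ _).elim id fun h => hmin ⟨y, hy, rfl⟩ h⟩
    have step : ∀ p' ≤ p, IsSieve p' → p' x →
        IsAttachment (above st x) (remove st p' x) p' x ∧ IsSieve (remove st p' x) ∧
        (st '' {y | remove st p' x y}).ncard ≤ n := by
      intro p' hle hp' hx'
      have hmin' : ∀ y, p' y → dim (st x) ≤ dim (st y) := fun y hy => hmin y (hle y hy)
      refine ⟨isAttachment_remove hst hdim hp' hx' hmin', isSieve_remove hdim hp' hmin', ?_⟩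
      have h1 := ncard_image_remove_lt (st := st) hx'
      have h2 : (st '' {y | p' y}).ncard ≤ (st '' {y | p y}).ncard :=
        Set.ncard_le_ncard (Set.image_mono fun y hy => hle y hy) (Set.toFinite _)
      omega
    have hqx : ∀ y, above st x y → Nonempty (y ⟶ x) := fun y hy => hy.1
    obtain ⟨cq, j, ⟨hq⟩, hjc, hj⟩ := hbd x
    obtain ⟨hatt, hsv, hcard⟩ := step p le_rfl hp hx
    obtain ⟨⟨cp, hcp⟩⟩ := (ih _ hsv hcard).1
    have ihp := (ih _ hsv hcard).2
    obtain ⟨g0, hg0⟩ := exists_compatibleMap hq cp hatt.q_le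
    have hg0c : IsClosedImmersion g0 :=
      ihp _ hatt.q_le (isSieve_above hdim x) _ _ hq hcp g0 hg0
    refine ⟨?_, ?_⟩
    · obtain ⟨P, inl, inr, hP, -, -⟩ := exists_isPushout_of_isClosedImmersion g0 j
      exact hatt.exists_isColimit hg0 hj hq hcp hqx hP
    intro p' hle hp' c' c hc' hc g hg
    obtain ⟨z, hz⟩ := exists_compatibleMap hcp c hatt.le
    have hpush := hatt.isPushout hg0 hj hq hcp hc hz hqx
    -- If `x` lies in `p'`, then both colimits arise by attaching `T(x)` along the same boundary.
    -- The square from `remove st p' x` to `remove st p x` is then a pushout by pasting, and `g` is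
    -- the leg opposite the closed immersion `g1`.
    by_cases hx' : p' x
    · obtain ⟨hatt', hsv', hcard'⟩ := step p' hle hp' hx'
      obtain ⟨⟨cp', hcp'⟩⟩ := (ih _ hsv' hcard').1
      obtain ⟨g0', hg0'⟩ := exists_compatibleMap hq cp' hatt'.q_le
      have hg0c' : IsClosedImmersion g0' :=
        (ih _ hsv' hcard').2 _ hatt'.q_le (isSieve_above hdim x) _ _ hq hcp' g0' hg0'
      obtain ⟨z', hz'⟩ := exists_compatibleMap hcp' c' hatt'.le
      have hpush' := hatt'.isPushout hg0' hj hq hcp' hc' hz' hqx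
      have hle' : remove st p' x ≤ remove st p x := fun y hy => ⟨hle y hy.1, hy.2⟩
      obtain ⟨g1, hg1⟩ := exists_compatibleMap hcp' cp hle'
      have hg1c : IsClosedImmersion g1 := ihp _ hle' hsv' _ _ hcp' hcp g1 hg1
      have e1 : g0' ≫ g1 = g0 := hq.hom_ext fun ⟨y, hy⟩ => by
        rw [← Category.assoc, hg0' y hy (hatt'.q_le _ hy), hg1 y _ (hatt.q_le _ hy),
          hg0 y hy (hatt.q_le _ hy)]
      have e2 : c'.ι.app ⟨x, hatt'.mem⟩ ≫ g = c.ι.app ⟨x, hatt.mem⟩ := hg x _ _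
      have e3 : g1 ≫ z = z' ≫ g := hcp'.hom_ext fun ⟨y, hy⟩ => by
        rw [← Category.assoc, ← Category.assoc, hg1 y hy (hle' _ hy),
          hz y (hle' _ hy) (hle _ hy.1), hz' y hy hy.1, hg y hy.1 (hle _ hy.1)]
      have hz'c := (isClosedImmersion_of_isPushout hpush').1
      have hbig : IsPushout (g0' ≫ g1) j z (c'.ι.app ⟨x, hatt'.mem⟩ ≫ g) := by
        rw [e1, e2]; exact hpush
      exact (isClosedImmersion_of_isPushout (IsPushout.of_left hbig e3 hpush')).2
    -- A sieve without `x` contains nothing from its stratum, so `g` factors through the colimit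
    -- over the smaller sieve.
    · have hle' : p' ≤ remove st p x := fun y hy => ⟨hle y hy, fun h =>
        hx' (hp' (hst x y h.symm).some hy)⟩
      obtain ⟨g1, hg1⟩ := exists_compatibleMap hc' cp hle'
      have hg1c : IsClosedImmersion g1 := ihp _ hle' hp' _ _ hc' hcp g1 hg1
      have hzc := (isClosedImmersion_of_isPushout hpush).1
      have : g = g1 ≫ z := hc'.hom_ext fun ⟨y, hy⟩ => by
        rw [← Category.assoc, hg1 y hy (hle' _ hy), hz y (hle' _ hy) (hle _ hy),
          hg y hy (hle _ hy)]
      rw [this]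
      infer_instance

end CategoryTheory.ObjectProperty

/-! ### Assembling the colimit of a fanifold -/

open StratifiedSubset

/-- A colimit over a category that is equivalent to a full subcategory of a thin category. -/
lemma CategoryTheory.ObjectProperty.exists_isColimit_of_op_comp {K E A 𝒟 : Type*} [Category* K]
    [Category* E] [Category* A] [Category* 𝒟] [Quiver.IsThin K] [Quiver.IsThin E] {G : K ⥤ E}
    {F : E ⥤ A} {T : Aᵒᵖ ⥤ 𝒟} {q : ObjectProperty Eᵒᵖ} (hq : ∀ a, q (op (G.obj a)))
    (hfull : ∀ a b, (G.obj a ⟶ G.obj b) → Nonempty (a ⟶ b))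
    (hsurj : ∀ y, q (op y) → ∃ a, Nonempty (y ⟶ G.obj a) ∧ Nonempty (G.obj a ⟶ y))
    {c : Cocone ((G ⋙ F).op ⋙ T)} (hc : IsColimit c) {x : E} {j : c.pt ⟶ T.obj (op (F.obj x))}
    (f₀ : ∀ a, x ⟶ G.obj a) (hj : ∀ a, c.ι.app (op a) ≫ j = T.map (F.map (f₀ a)).op)
    (P : ∀ B, (B ⟶ T.obj (op (F.obj x))) → Prop) (hP : P c.pt j) :
    ∃ (c' : Cocone (q.ι ⋙ F.op ⋙ T)) (j' : c'.pt ⟶ (F.op ⋙ T).obj (op x)),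
      Nonempty (IsColimit c') ∧ P c'.pt j' ∧
      ∀ (y : Eᵒᵖ) (hy : q y) (f : y ⟶ op x), c'.ι.app ⟨y, hy⟩ ≫ j' = (F.op ⋙ T).map f := by
  let L : Kᵒᵖ ⥤ q.FullSubcategory := q.lift G.op fun a => hq a.unop
  have : L.Full := ⟨fun {a b} f => by
    obtain ⟨g⟩ := hfull b.unop a.unop f.hom.unop
    exact ⟨g.op, ObjectProperty.hom_ext _ (Quiver.Hom.unop_inj (Subsingleton.elim _ _))⟩⟩
  have : L.Faithful := ⟨fun {a b} f g _ => Quiver.Hom.unop_inj (Subsingleton.elim _ _)⟩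
  have : L.EssSurj := ⟨fun ⟨y, hy⟩ => by
    obtain ⟨a, ⟨f⟩, ⟨g⟩⟩ := hsurj y.unop hy
    refine ⟨op a, ⟨q.isoMk (Iso.op ⟨f, g, Subsingleton.elim _ _, Subsingleton.elim _ _⟩)⟩⟩⟩
  have : L.IsEquivalence := {}
  let c₁ : Cocone (L ⋙ q.ι ⋙ F.op ⋙ T) := c
  have hc₁ : IsColimit c₁ := hc
  refine ⟨Functor.Final.extendCocone.obj c₁, j,
    ⟨(Functor.Final.isColimitExtendCoconeEquiv L c₁).symm hc₁⟩, hP, fun y hy f => ?_⟩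
  let a : Kᵒᵖ := Functor.Final.lift L ⟨y, hy⟩
  let g : y ⟶ op (G.obj a.unop) := (Functor.Final.homToLift L ⟨y, hy⟩).hom
  have hf : f = g ≫ (f₀ a.unop).op := Quiver.Hom.unop_inj (Subsingleton.elim _ _)
  rw [hf]
  exact (Category.assoc _ _ _).trans ((congrArg ((F.op ⋙ T).map g ≫ ·) (hj a.unop)).trans
    ((F.op ⋙ T).map_comp g (f₀ a.unop).op).symm)

namespace Fanifold

variable {n : ℕ} {𝓜 : Type v} [TopologicalSpace 𝓜] [ChartedSpace (EuclideanSpace ℝ (Fin n)) 𝓜]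
  [IsManifold (𝓡 n) ∞ 𝓜] (Φ : Fanifold.{u} n 𝓜) (k : Type u) [Field k] [Quiver.IsThin Φ.Exit]

/-- The stratum of an object of the opposite of the exit path category. -/
abbrev stratumOp (y : Φ.Exitᵒᵖ) : Φ.Stratum := y.unop.point.stratum

/-- By the correspondence between exits and cones, the strata mapping to `x` form a category
equivalent to the opposite of the poset of nonzero cones at `x`. The colimit of proper orbit
closures is therefore the colimit over these strata. -/
theorem exists_isToricBoundary (x : Φ.Exit) :
    ∃ (c : Cocone ((ObjectProperty.above Φ.stratumOp (op x)).ι ⋙ Φ.toricDiagram k))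
      (j : c.pt ⟶ (Φ.toricDiagram k).obj (op x)), Nonempty (IsColimit c) ∧
      Φ.IsToricBoundary k x j ∧
      ∀ (y : Φ.Exitᵒᵖ) (hy : ObjectProperty.above Φ.stratumOp (op x) y) (f : y ⟶ op x),
        c.ι.app ⟨y, hy⟩ ≫ j = (Φ.toricDiagram k).map f := by
  -- One exit is chosen for each nonzero cone. Inclusions of cones give morphisms between the end
  -- points, and thinness makes the choices functorial.
  choose y f hf using fun σ : (Φ.fan.obj x).NonzeroCone => exists_cone_eq σ.1.2
  have hmap : ∀ {σ τ : (Φ.fan.obj x).NonzeroCone}, (σ ⟶ τ) → Nonempty (y σ ⟶ y τ) :=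
    fun {σ τ} g => nonempty_hom_of_cone_le (f σ) (f τ) (by
      rw [hf, hf]; exact leOfHom g)
  let G : (Φ.fan.obj x).NonzeroCone ⥤ Φ.Exit :=
    { obj := y
      map := fun g => (hmap g).some
      map_id := fun _ => Subsingleton.elim _ _
      map_comp := fun _ _ => Subsingleton.elim _ _ }
  have hne : ∀ σ, (y σ).point.stratum ≠ x.point.stratum := fun σ h => σ.2 (by
    rw [← hf σ]; exact (cone_eq_bot_iff (f σ)).mpr h.symm)
  have hlift : ∀ {z : Φ.Exit} (g : x ⟶ z), z.point.stratum ≠ x.point.stratum →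
      ∃ σ, (y σ).point.stratum = z.point.stratum := fun {z} g h =>
    ⟨⟨⟨Φ.cone g, Φ.cone_mem g⟩, fun h' => h ((cone_eq_bot_iff g).mp h').symm⟩,
      stratum_eq_of_cone_eq (f _) g (hf _)⟩
  obtain ⟨c, ι, ⟨hc⟩, hι, hred, hfac, hrange⟩ := ToricFan.exists_toricBoundary
    (D := G ⋙ Φ.fan) (h := fun σ => Φ.fan.map (f σ)) hf
    (fun {σ τ} g => by
      change Φ.fan.map (f σ) ≫ Φ.fan.map (G.map g) = Φ.fan.map (f τ)
      rw [← Φ.fan.map_comp]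
      exact congrArg Φ.fan.map (Subsingleton.elim _ _)) k
  refine ObjectProperty.exists_isColimit_of_op_comp (F := Φ.fan) (T := toricFunctor k)
    (fun σ => ⟨⟨(f σ).op⟩, hne σ⟩) ?_ ?_ hc (j := ι) f hfac (fun B j => Φ.IsToricBoundary k x j) ?_
  · intro σ τ g
    have h : Φ.cone (f σ) ≤ Φ.cone (f τ) := cone_le_of_hom (f σ) (f τ) g
    rw [hf, hf] at h
    exact ⟨homOfLE h⟩
  · rintro z ⟨⟨g⟩, h⟩
    obtain ⟨σ, hσ⟩ := hlift g.unop h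
    exact ⟨σ, Φ.nonempty_hom_of_stratum_eq _ _ hσ.symm, Φ.nonempty_hom_of_stratum_eq _ _ hσ⟩
  · refine ⟨hred, hι, hrange.trans ?_⟩
    refine Set.ext fun p => ⟨fun hp => ?_, fun hp => ?_⟩
    · obtain ⟨σ, hσ⟩ := Set.mem_iUnion.mp hp
      exact Set.mem_iUnion.mpr ⟨y σ, Set.mem_iUnion.mpr ⟨f σ, Set.mem_iUnion.mpr ⟨hne σ, hσ⟩⟩⟩
    · obtain ⟨z, hz⟩ := Set.mem_iUnion.mp hp
      obtain ⟨g, hg⟩ := Set.mem_iUnion.mp hz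
      obtain ⟨h, w, rfl⟩ := Set.mem_iUnion.mp hg
      obtain ⟨σ, hσ⟩ := hlift g h
      obtain ⟨i⟩ := Φ.nonempty_hom_of_stratum_eq _ _ hσ
      refine Set.mem_iUnion.mpr ⟨σ, (Φ.toricDiagram k).map i.op w, ?_⟩
      rw [Subsingleton.elim g (f σ ≫ i), op_comp, Functor.map_comp]
      rfl

omit [Quiver.IsThin Φ.Exit] in
/-- The strata can be enumerated by non-increasing dimension. -/
theorem exists_enumeration :
    ∃ (N : ℕ) (e : Fin N ≃ Φ.Stratum), ∀ i j, i ≤ j → Φ.dim (e j) ≤ Φ.dim (e i) := by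
  let e₀ : Fin (Nat.card Φ.Stratum) ≃ Φ.Stratum := (Finite.equivFin Φ.Stratum).symm
  let f : Fin (Nat.card Φ.Stratum) → ℕᵒᵈ := fun i => OrderDual.toDual (Φ.dim (e₀ i))
  exact ⟨_, (Tuple.sort f).trans e₀, fun i j h => Tuple.monotone_sort f h⟩

lemma dim_lt_of_hom_op {y z : Φ.Exitᵒᵖ} (f : y ⟶ z) (h : Φ.stratumOp y ≠ Φ.stratumOp z) :
    Φ.dim (Φ.stratumOp z) < Φ.dim (Φ.stratumOp y) :=
  dim_lt_of_hom f.unop h.symm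

omit [Quiver.IsThin Φ.Exit] in
lemma nonempty_hom_op (y z : Φ.Exitᵒᵖ) (h : Φ.stratumOp y = Φ.stratumOp z) :
    Nonempty (y ⟶ z) := by
  obtain ⟨f⟩ := Φ.nonempty_hom_of_stratum_eq z.unop y.unop h.symm
  exact ⟨f.op⟩

instance : Quiver.IsThin Φ.Exitᵒᵖ := fun _ _ => ⟨fun _ _ =>
  Quiver.Hom.unop_inj (Subsingleton.elim _ _)⟩

theorem exists_colimitCocone {p : ObjectProperty Φ.Exitᵒᵖ} (hp : p.IsSieve) :
    Nonempty (ColimitCocone (p.ι ⋙ Φ.toricDiagram k)) :=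
  (ObjectProperty.exists_isColimit_and_isClosedImmersion Φ.nonempty_hom_op Φ.dim_lt_of_hom_op
    (fun x => by
      obtain ⟨c, j, hc, hj, h⟩ := Φ.exists_isToricBoundary k x.unop
      exact ⟨c, j, hc, hj.isClosedImmersion, h⟩) _ p hp le_rfl).1

theorem isClosedImmersion_of_compatibleMap {p p' : ObjectProperty Φ.Exitᵒᵖ} (hp : p.IsSieve)
    (hp' : p'.IsSieve) (hle : p' ≤ p) {c' : Cocone (p'.ι ⋙ Φ.toricDiagram k)}
    {c : Cocone (p.ι ⋙ Φ.toricDiagram k)} (hc' : IsColimit c') (hc : IsColimit c)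
    {g : c'.pt ⟶ c.pt} (hg : ObjectProperty.CompatibleMap c' c g) : IsClosedImmersion g :=
  (ObjectProperty.exists_isColimit_and_isClosedImmersion Φ.nonempty_hom_op Φ.dim_lt_of_hom_op
    (fun x => by
      obtain ⟨c, j, hc, hj, h⟩ := Φ.exists_isToricBoundary k x.unop
      exact ⟨c, j, hc, hj.isClosedImmersion, h⟩) _ p hp le_rfl).2 p' hle hp' c' c hc' hc g hg

/-- In the opposite category morphisms never increase the position in the enumeration, so initial
segments are sieves. Consecutive ones differ by one stratum of minimal dimension, which is an
attachment. -/
theorem colimitIsIteratedPushout : Φ.ColimitIsIteratedPushout k := by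
  obtain ⟨N, e, he⟩ := Φ.exists_enumeration
  have hlt : ∀ {y z : Φ.Exitᵒᵖ}, (y ⟶ z) → e.symm (Φ.stratumOp y) ≤ e.symm (Φ.stratumOp z) := by
    intro y z f
    by_cases h : Φ.stratumOp y = Φ.stratumOp z
    · rw [h]
    · by_contra hle
      have h1 := he _ _ (not_le.mp hle).le
      rw [e.apply_symm_apply, e.apply_symm_apply] at h1
      exact h1.not_gt (Φ.dim_lt_of_hom_op f h)
  have hsieve : ∀ i : Fin (N + 1), (Φ.overStrata {s | (e.symm s).castSucc < i}).IsSieve :=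
    fun i y z f hz => lt_of_le_of_lt (Fin.castSucc_le_castSucc_iff.mpr (hlt f)) hz
  obtain ⟨Z⟩ : Nonempty (∀ i : Fin (N + 1),
      ColimitCocone (Φ.restrictedDiagram k {s | (e.symm s).castSucc < i})) :=
    ⟨fun i => (Φ.exists_colimitCocone k (hsieve i)).some⟩
  refine ⟨N, e, he, Z, fun i x hx => ?_⟩
  have hmem : Φ.overStrata {s | (e.symm s).castSucc < i.succ} (op x) := by
    change (e.symm x.point.stratum).castSucc < i.succ
    rw [hx, Equiv.symm_apply_apply]
    exact Fin.castSucc_lt_succ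
  have hremove : ObjectProperty.remove Φ.stratumOp
      (Φ.overStrata {s | (e.symm s).castSucc < i.succ}) (op x) =
      Φ.overStrata {s | (e.symm s).castSucc < i.castSucc} := by
    ext y
    have h1 : Φ.stratumOp y ≠ Φ.stratumOp (op x) ↔ e.symm (Φ.stratumOp y) ≠ i := by
      rw [show Φ.stratumOp (op x) = e i from hx, Ne, Ne, e.symm_apply_eq]
    change (e.symm (Φ.stratumOp y)).castSucc < i.succ ∧ _ ↔
      (e.symm (Φ.stratumOp y)).castSucc < i.castSucc
    rw [h1, Fin.castSucc_lt_succ_iff, Fin.castSucc_lt_castSucc_iff, lt_iff_le_and_ne]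
  have hatt : ObjectProperty.IsAttachment (ObjectProperty.above Φ.stratumOp (op x))
      (Φ.overStrata {s | (e.symm s).castSucc < i.castSucc})
      (Φ.overStrata {s | (e.symm s).castSucc < i.succ}) (op x) := by
    rw [← hremove]
    refine ObjectProperty.isAttachment_remove Φ.nonempty_hom_op Φ.dim_lt_of_hom_op
      (hsieve i.succ) hmem fun y hy => ?_
    have h1 : e.symm (Φ.stratumOp y) ≤ i := Fin.castSucc_lt_succ_iff.mp hy
    have h2 := he _ _ h1
    rw [e.apply_symm_apply] at h2
    rwa [show Φ.stratumOp (op x) = e i from hx]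
  obtain ⟨c, j, ⟨hc⟩, hj, hcj⟩ := Φ.exists_isToricBoundary k x
  obtain ⟨b, hb⟩ := ObjectProperty.exists_compatibleMap hc (Z i.castSucc).cocone hatt.q_le
  obtain ⟨z, hz⟩ := ObjectProperty.exists_compatibleMap (Z i.castSucc).isColimit (Z i.succ).cocone hatt.le
  exact ⟨c.pt, b, j, z, fun y hy => hz (op y) hy _,
    Φ.isClosedImmersion_of_compatibleMap k (hsieve _)
      (ObjectProperty.isSieve_above Φ.dim_lt_of_hom_op (op x)) hatt.q_le hc (Z i.castSucc).isColimit hb, hj,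
    hatt.isPushout hb hcj hc (Z i.castSucc).isColimit (Z i.succ).isColimit hz fun y hy => hy.1⟩

theorem hasColimit_toricDiagram : HasColimit (Φ.toricDiagram k) := by
  let p : ObjectProperty Φ.Exitᵒᵖ := ⊤
  obtain ⟨Z⟩ := Φ.exists_colimitCocone k (p := p) fun _ _ _ _ => trivial
  have : p.ι.EssSurj := ⟨fun y => ⟨⟨y, trivial⟩, ⟨Iso.refl y⟩⟩⟩
  have : p.ι.IsEquivalence := {}
  have : HasColimit (p.ι.asEquivalence.functor ⋙ Φ.toricDiagram k) := ⟨⟨Z⟩⟩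
  exact hasColimit_of_equivalence_comp p.ι.asEquivalence

end Fanifold

end

theorem mainTheorem9 (k : Type u) [Field k] (n : ℕ) (𝓜 : Type v) [TopologicalSpace 𝓜] [T2Space 𝓜]
    [SecondCountableTopology 𝓜] [ChartedSpace (EuclideanSpace ℝ (Fin n)) 𝓜]
    [IsManifold (𝓡 n) ∞ 𝓜] (Φ : Fanifold.{u} n 𝓜)
    (P : Type w) [PartialOrder P] (e : Φ.Exit ≌ P) :
    HasColimit (Φ.toricDiagram k) ∧ Φ.ColimitIsIteratedPushout k := by
  -- The equivalence with a poset enters only through thinness: any two parallel morphisms agree.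
  have : Quiver.IsThin Φ.Exit := fun _ _ => ⟨fun _ _ =>
    e.functor.map_injective (Subsingleton.elim _ _)⟩
  exact ⟨Φ.hasColimit_toricDiagram k, Φ.colimitIsIteratedPushout k⟩
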